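/- Let $k\ge 1$ and let $\sigma(x)=\bar x$ on $\mathbb C$. We consider germs at $(x,\lambda)=(0,0)$ of families of vector fields $X(x;\lambda)\frac{\partial}{\partial x}$, with $x\in\mathbb C$ and $\lambda\in\mathbb R^m$ ($m\ge 0$ arbitrary), holomorphic in $x$ and real analytic in $(x,\lambda)$. Such a family is *symmetric* with respect to the real axis if $\overline{X(\bar x;\lambda)}=X(x;\lambda)$, and *reversible* if $\overline{X(\bar x;\lambda)}=-X(x;\lambda)$. A *conjugacy* from $X$ to $X'$ is a germ $\phi(x;\lambda)$, of the same regularity, with $\phi(0;0)=0$, $\partial_x\phi(0;0)\ne0$ and $X'(\phi(x;\lambda);\lambda)=\partial_x\phi(x;\lambda)\,X(x;\lambda)$; it is an *equivalence* of deformations if moreover $\phi(x;0)\equiv x$; it *commutes with the symmetry* if $\phi(\bar x;\lambda)=\overline{\phi(x;\lambda)}$. A family *induced* from $X'(x;y)$ is $X'(x;\psi(\lambda))$ with $\psi$ a real analytic germ, $\psi(0)=0$. Let $c=(\pm1)^{k+1}$ in the symmetric case and $c=i(\pm1)^{k+1}$ in the reversible case, let $\mu\in\mathbb C$ with $c\mu\in\mathbb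 R$, and consider the families $$X_1'(x;y)=c\left(x^{k+1}+y_{k-1}x^{k-1}+\dots+y_1x+y_0-c(\mu+y_{2k+1})x^{2k+1}\right)\tfrac{\partial}{\partial x},$$ $$X_2'(x;y)=c\left(x^{k+1}+y_{k-1}x^{k-1}+\dots+y_1x+y_0\right)\left(1-c(\mu+y_{2k+1})x^k\right)\tfrac{\partial}{\partial x},$$ $$X_3'(x;y)=\frac{x^{k+1}+y_{k-1}x^{k-1}+\dots+y_1x+y_0}{c+(\mu+y_{2k+1})x^k}\tfrac{\partial}{\partial x},$$ with parameters $y=(y_0,\dots,y_{k-1},y_{2k+1})$ near $0$, where $y_0,\dots,y_{k-1},\,c\,y_{2k+1}\in\mathbb R$. (1) For all such $c,\mu$ and each $j=1,2,3$, the family $X_j'$ is symmetric (resp. reversible), and it is a universal deformation of $X_j'(x;0)$ among symmetric (resp. reversible) deformations: every symmetric (resp. reversible) family $X(x;\lambda)$ with $X(x;0)=X_j'(x;0)$ is equivalent to a family induced from $X_j'$ by some $\psi$, by means of an equivalence that commutes with the symmetry; and the germ of the inducing map $\psi$ is unique (even if equivalences that do not commute with the symmetry are allowed). (2) Every symmetric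 (resp. reversible) family $X(x;\lambda)$ such that $X(x;0)$ vanishes at $x=0$ to order exactly $k+1$ is, for each $j=1,2,3$ and for some $c,\mu$ as above (depending on $j$), conjugate to a family induced from $X_j'$, by a conjugacy that commutes with the symmetry. -/

import Mathlib

open Filter Topology
open scoped ComplexConjugate

namespace RealAxisDeformation

section Families

variable {E : Type*} [NormedAddCommGroup E] [NormedSpace ℝ E]

/-- A germ at `(x, l) = (0, 0)` of a family `f x l`, depending on a real parameter `l` (in a real
normed space `E`), which is holomorphic in the complex variable `x` and real analytic in `(x, l)`.
It represents the family of vector fields `f x l ∂/∂x`, or a family of maps. -/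
structure IsAnalyticFamily (f : ℂ → E → ℂ) : Prop where
  analyticAt : AnalyticAt ℝ (fun p : ℂ × E => f p.1 p.2) 0
  holomorphic : ∀ᶠ p : ℂ × E in 𝓝 0, DifferentiableAt ℂ (fun x => f x p.2) p.1

/-- The germ of change of coordinate `x' = φ x l`, invertible at the origin and preserving the
parameter, conjugates the family of vector fields `X` to the family `X'`, that is `X = φ^* X'`. -/
structure IsConjugacy (φ X X' : ℂ → E → ℂ) : Prop where
  analytic : IsAnalyticFamily φ
  map_zero : φ 0 0 = 0
  invertible : deriv (fun x => φ x 0) 0 ≠ 0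
  pullback : ∀ᶠ p : ℂ × E in 𝓝 0,
    X' (φ p.1 p.2) p.2 = deriv (fun x => φ x p.2) p.1 * X p.1 p.2

/-- Equivalence of deformations: a conjugacy which is the identity at the parameter `0`. -/
structure IsEquivalence (φ X X' : ℂ → E → ℂ) : Prop extends IsConjugacy φ X X' where
  eq_id : ∀ᶠ x : ℂ in 𝓝 0, φ x 0 = x

/-- The germ `φ` commutes with the symmetry `x ↦ conj x`. -/
def CommutesWithConj (φ : ℂ → E → ℂ) : Prop :=
  ∀ᶠ p : ℂ × E in 𝓝 0, φ (conj p.1) p.2 = conj (φ p.1 p.2)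

/-- The two kinds of symmetry with respect to the real axis. -/
inductive AxisSymmetry where
  | symmetric
  | reversible

/-- The sign in `σ_* X = ± X`, where `σ x = conj x`. -/
def AxisSymmetry.sign : AxisSymmetry → ℂ
  | .symmetric => 1
  | .reversible => -1

/-- The factor `1` (symmetric case) or `i` (reversible case) of the constant `c`. -/
def AxisSymmetry.factor : AxisSymmetry → ℂ
  | .symmetric => 1
  | .reversible => Complex.I

/-- The family of vector fields `X` is symmetric (`σ_* X = X`), respectively reversible
(`σ_* X = - X`), for `σ x = conj x`; the push-forward is `(σ_* X) x = conj (X (conj x))`. -/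
def HasSymmetry (τ : AxisSymmetry) (X : ℂ → E → ℂ) : Prop :=
  ∀ᶠ p : ℂ × E in 𝓝 0, conj (X (conj p.1) p.2) = τ.sign * X p.1 p.2

variable {F : Type*} [NormedAddCommGroup F] [NormedSpace ℝ F]

/-- A germ at `0` of a real analytic map of parameters, not necessarily invertible. -/
structure IsParameterMap (ψ : E → F) : Prop where
  analyticAt : AnalyticAt ℝ ψ 0
  map_zero : ψ 0 = 0

/-- The family induced from `X'` by the map of parameters `ψ`. -/
def induced (X' : ℂ → F → ℂ) (ψ : E → F) : ℂ → E → ℂ :=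
  fun x l => X' x (ψ l)

/-- `X'` has the symmetry `τ` and is a universal deformation of `X' · 0` among the deformations
with the symmetry `τ`: each of them is equivalent to a deformation induced from `X'`, by an
equivalence that commutes with the symmetry, and the germ of the inducing map is unique (also
among the inducing maps which come with an equivalence that does not commute). -/
structure IsUniversalWithSymmetry (τ : AxisSymmetry) (X' : ℂ → F → ℂ) : Prop where
  analytic : IsAnalyticFamily X'
  hasSymmetry : HasSymmetry τ X'
  versal : ∀ (m : ℕ) (X : ℂ → (Fin m → ℝ) → ℂ), IsAnalyticFamily X → HasSymmetry τ X →
    (∀ᶠ x : ℂ in 𝓝 0, X x 0 = X' x 0) →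
    ∃ (ψ : (Fin m → ℝ) → F) (φ : ℂ → (Fin m → ℝ) → ℂ),
      IsParameterMap ψ ∧ IsEquivalence φ X (induced X' ψ) ∧ CommutesWithConj φ
  unique : ∀ (m : ℕ) (X : ℂ → (Fin m → ℝ) → ℂ), IsAnalyticFamily X → HasSymmetry τ X →
    (∀ᶠ x : ℂ in 𝓝 0, X x 0 = X' x 0) →
    ∀ (ψ₁ ψ₂ : (Fin m → ℝ) → F) (φ₁ φ₂ : ℂ → (Fin m → ℝ) → ℂ),
      IsParameterMap ψ₁ → IsParameterMap ψ₂ →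
      IsEquivalence φ₁ X (induced X' ψ₁) → IsEquivalence φ₂ X (induced X' ψ₂) →
      ∀ᶠ l in 𝓝 0, ψ₁ l = ψ₂ l

end Families

/-- The parameters `y = ((y_0, …, y_{k-1}), y_{2k+1})` with `y_0, …, y_{k-1}` and `c * y_{2k+1}`
real, as a real vector space. -/
def Param (k : ℕ) (c : ℂ) : Submodule ℝ ((Fin k → ℝ) × ℂ) where
  carrier := {y | (c * y.2).im = 0}
  add_mem' := by
    intro a b ha hb
    simp only [Set.mem_ofPred_eq, Prod.snd_add, mul_add, Complex.add_im] at *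
    rw [ha, hb, add_zero]
  zero_mem' := by simp
  smul_mem' := by
    intro r a ha
    simp only [Set.mem_ofPred_eq, Prod.smul_snd, mul_smul_comm, Complex.smul_im] at *
    rw [ha, smul_zero]

/-- The polynomial `x^{k+1} + y_{k-1} x^{k-1} + … + y_1 x + y_0`. -/
def unfoldingPoly (k : ℕ) (y : Fin k → ℝ) (x : ℂ) : ℂ :=
  x ^ (k + 1) + ∑ j : Fin k, (y j : ℂ) * x ^ (j : ℕ)

/-- `c (x^{k+1} + y_{k-1} x^{k-1} + … + y_0 - c (μ + y_{2k+1}) x^{2k+1}) ∂/∂x`. -/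
def X₁ (k : ℕ) (c μ : ℂ) (x : ℂ) (y : Param k c) : ℂ :=
  c * (unfoldingPoly k y.1.1 x - c * (μ + y.1.2) * x ^ (2 * k + 1))

/-- `c (x^{k+1} + y_{k-1} x^{k-1} + … + y_0) (1 - c (μ + y_{2k+1}) x^k) ∂/∂x`. -/
def X₂ (k : ℕ) (c μ : ℂ) (x : ℂ) (y : Param k c) : ℂ :=
  c * unfoldingPoly k y.1.1 x * (1 - c * (μ + y.1.2) * x ^ k)

/-- `(x^{k+1} + y_{k-1} x^{k-1} + … + y_0) / (c + (μ + y_{2k+1}) x^k) ∂/∂x`. -/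
noncomputable def X₃ (k : ℕ) (c μ : ℂ) (x : ℂ) (y : Param k c) : ℂ :=
  unfoldingPoly k y.1.1 x / (c + (μ + y.1.2) * x ^ k)

/-- The constants allowed in the normal forms: `c = (±1)^{k+1}` in the symmetric case,
`c = i (±1)^{k+1}` in the reversible case, and `c μ` is real. -/
def IsAdmissible (τ : AxisSymmetry) (k : ℕ) (c μ : ℂ) : Prop :=
  (∃ ε : ℂ, (ε = 1 ∨ ε = -1) ∧ c = τ.factor * ε ^ (k + 1)) ∧ (c * μ).im = 0

/-- For some admissible `c` and `μ`, the family `X` is conjugate, by a conjugacy that commutes with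
the symmetry, to a family induced from the member `N c μ` of the list of normal forms `N`. -/
def HasNormalForm (τ : AxisSymmetry) (k : ℕ) (N : (c μ : ℂ) → ℂ → Param k c → ℂ)
    {m : ℕ} (X : ℂ → (Fin m → ℝ) → ℂ) : Prop :=
  ∃ c μ : ℂ, IsAdmissible τ k c μ ∧
    ∃ (ψ : (Fin m → ℝ) → Param k c) (φ : ℂ → (Fin m → ℝ) → ℂ),
      IsParameterMap ψ ∧ IsConjugacy φ X (induced (N c μ) ψ) ∧ CommutesWithConj φ

end RealAxisDeformation

/-! After division by `c`, a symmetric or reversible field is real on the real axis (because `c * c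
= τ.sign` and `conj c = τ.sign * c`). The three families become instances of one rational family
N/D, with N = P_y (1 - α m x^k) - β m x^(2k+1), D = δ + γ m x^k and m = c (μ + y_(2k+1)) real. The
condition (α + β) δ + γ ≠ 0 says that, at y = 0, varying m varies the residue of the dual form D dx
/ N.

A coordinate φ conjugates X to N/D when N(φ) = φ' X D(φ). Write φ = x + f + X h with deg f ≤ k, and
let h be the primitive of w that vanishes at 0. A variation X h of the identity points along the
flow of X, so to first order it changes the equation only by -X² h' D. The linearized equation
therefore contains w = h' but not h, and no derivative is lost. Multiplied by D it reads jet(f, y,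
m) - x^(2k+2) U² w with U a unit, and the 2k+2 scalars in (f, y, m) correspond bijectively, by a
triangular scheme, to the Taylor coefficients of degree at most 2k+1 (`den_mul_fderiv_defect`,
`eq_zero_of_coeff_jetPart`). The linearization is thus an isomorphism of Banach spaces (Wiener
algebras), and the analytic implicit function theorem produces φ, y, m. Solving over ℝ makes φ
commute with conjugation.

For uniqueness, any equivalence is φ = x + f + X g, and the polynomial x + f still conjugates X to
N/D modulo X². With `K = 0` the same equation expresses exactly this, w being the quotient by X² D,
and its linearization is unchanged. Since f and w tend to 0 with the parameter, local uniqueness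
over ℂ makes (y, m) a function of X alone.

For part (2), a field x^(k+1) G(x) is blown up by x ↦ θρx. This gives a deformation, with parameter
ρ, of the homogeneous field, to which the existence theorem applies. At a fixed small ρ ≠ 0 the
normal form so obtained has a zero of multiplicity k+1, which forces y = 0; undoing the scaling puts
the initial field into normal form (`exists_conjugacy_initial`). The family transported by this
coordinate is then a deformation of the kind treated in part (1). -/

namespace RealAxisDeformation

/-! ### The Wiener algebra of power series which converge absolutely on a closed disc -/

section Wiener

/-- The algebra of the power series `∑ a n x ^ n` such that `∑ ‖a n‖ * r ^ n` converges. -/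
def wienerSubalgebra (r : {r : ℝ // 0 < r}) (𝕜 : Type*) [RCLike 𝕜] : Subalgebra 𝕜 (PowerSeries 𝕜) where
  carrier := {a | Summable fun n => ‖PowerSeries.coeff n a‖ * (r : ℝ) ^ n}
  mul_mem' := by
    intro a b ha hb
    have h := summable_norm_sum_mul_antidiagonal_of_summable_norm
      (f := fun n => ((‖PowerSeries.coeff n a‖ * (r : ℝ) ^ n : ℝ)))
      (g := fun n => ((‖PowerSeries.coeff n b‖ * (r : ℝ) ^ n : ℝ)))
      (by simpa [abs_of_pos r.2] using ha) (by simpa [abs_of_pos r.2] using hb)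
    refine Summable.of_nonneg_of_le (fun n => mul_nonneg (norm_nonneg _) (pow_nonneg r.2.le _))
      (fun n => ?_) h
    rw [PowerSeries.coeff_mul]
    refine le_trans (mul_le_mul_of_nonneg_right (norm_sum_le _ _) (pow_nonneg r.2.le _)) ?_
    refine le_trans (le_of_eq ?_) (le_abs_self _)
    rw [Finset.sum_mul]
    refine Finset.sum_congr rfl fun p hp => ?_
    rw [Finset.HasAntidiagonal.mem_antidiagonal] at hp
    rw [norm_mul, ← hp, pow_add]; ring
  add_mem' := by
    intro a b ha hb
    refine Summable.of_nonneg_of_le (fun n => mul_nonneg (norm_nonneg _) (pow_nonneg r.2.le _))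
      (fun n => ?_) (Summable.add ha hb)
    rw [map_add, ← add_mul]
    exact mul_le_mul_of_nonneg_right (norm_add_le _ _) (pow_nonneg r.2.le _)
  algebraMap_mem' := by
    intro c
    refine summable_of_ne_finset_zero (s := {0}) fun n hn => ?_
    have : n ≠ 0 := by simpa using hn
    simp [PowerSeries.coeff_C, this]

/-- The type of the power series `∑ a n x ^ n` such that `∑ ‖a n‖ * r ^ n` converges. -/
structure Wiener (r : {r : ℝ // 0 < r}) (𝕜 : Type*) [RCLike 𝕜] where
  /-- The underlying element of the algebra of formal power series. -/
  val : wienerSubalgebra r 𝕜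

variable {r : {r : ℝ // 0 < r}} {𝕜 : Type*} [RCLike 𝕜]

namespace Wiener

/-- The type `Wiener r 𝕜` is a copy of the subalgebra `wienerSubalgebra r 𝕜`. -/
def equivSubalgebra : Wiener r 𝕜 ≃ wienerSubalgebra r 𝕜 := ⟨val, mk, fun _ => rfl, fun _ => rfl⟩

noncomputable instance : CommRing (Wiener r 𝕜) := equivSubalgebra.commRing

noncomputable instance : Algebra 𝕜 (Wiener r 𝕜) := equivSubalgebra.algebra 𝕜

/-- The underlying formal power series. -/
noncomputable def toPS : Wiener r 𝕜 →ₐ[𝕜] PowerSeries 𝕜 :=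
  (wienerSubalgebra r 𝕜).val.comp (equivSubalgebra.algEquiv 𝕜).toAlgHom

lemma toPS_injective : Function.Injective (toPS : Wiener r 𝕜 → PowerSeries 𝕜) :=
  Subtype.val_injective.comp equivSubalgebra.injective

/-- The coefficient of `x ^ n`. -/
noncomputable def coeff (n : ℕ) : Wiener r 𝕜 →ₗ[𝕜] 𝕜 := PowerSeries.coeff n ∘ₗ toPS.toLinearMap

lemma coeff_toPS (n : ℕ) (a : Wiener r 𝕜) : PowerSeries.coeff n (toPS a) = coeff n a := rfl

lemma summable (a : Wiener r 𝕜) : Summable fun n => ‖coeff n a‖ * (r : ℝ) ^ n := a.val.2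

@[ext] lemma ext {a b : Wiener r 𝕜} (h : ∀ n, coeff n a = coeff n b) : a = b :=
  toPS_injective (PowerSeries.ext h)

noncomputable instance : Norm (Wiener r 𝕜) := ⟨fun a => ∑' n, ‖coeff n a‖ * (r : ℝ) ^ n⟩

lemma norm_def (a : Wiener r 𝕜) : ‖a‖ = ∑' n, ‖coeff n a‖ * (r : ℝ) ^ n := rfl

lemma norm_coeff_mul_le (n : ℕ) (a : Wiener r 𝕜) : ‖coeff n a‖ * (r : ℝ) ^ n ≤ ‖a‖ :=
  (summable a).le_tsum n fun _ _ => mul_nonneg (norm_nonneg _) (pow_nonneg r.2.le _)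

lemma normedSpaceCore : NormedSpace.Core 𝕜 (Wiener r 𝕜) where
  norm_nonneg a := tsum_nonneg fun _ => mul_nonneg (norm_nonneg _) (pow_nonneg r.2.le _)
  norm_smul c a := by
    simp only [norm_def, map_smul, smul_eq_mul, norm_mul, mul_assoc, tsum_mul_left]
  norm_triangle a b := by
    rw [norm_def, norm_def, norm_def, ← (summable a).tsum_add (summable b)]
    refine (summable (a + b)).tsum_le_tsum (fun n => ?_) ((summable a).add (summable b))
    rw [map_add, ← add_mul]
    exact mul_le_mul_of_nonneg_right (norm_add_le _ _) (pow_nonneg r.2.le _)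
  norm_eq_zero_iff a := by
    constructor
    · intro h
      ext n
      have h1 := norm_coeff_mul_le n a
      rw [h] at h1
      have h2 : 0 < (r : ℝ) ^ n := pow_pos r.2 _
      have h3 : ‖coeff n a‖ ≤ 0 := by
        by_contra hc
        push Not at hc
        nlinarith [mul_pos hc h2]
      simpa using h3
    · rintro rfl
      simp [norm_def]

noncomputable instance : NormedAddCommGroup (Wiener r 𝕜) :=
  NormedAddCommGroup.ofCore normedSpaceCore

lemma norm_mul_le' (a b : Wiener r 𝕜) : ‖a * b‖ ≤ ‖a‖ * ‖b‖ := by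
  have ha := summable a
  have hb := summable b
  have ha' : Summable fun n => ‖‖coeff n a‖ * (r : ℝ) ^ n‖ := by simpa [abs_of_pos r.2] using ha
  have hb' : Summable fun n => ‖‖coeff n b‖ * (r : ℝ) ^ n‖ := by simpa [abs_of_pos r.2] using hb
  rw [norm_def, norm_def, norm_def, tsum_mul_tsum_eq_tsum_sum_antidiagonal_of_summable_norm ha' hb']
  refine (summable (a * b)).tsum_le_tsum (fun n => ?_)
    (summable_norm_sum_mul_antidiagonal_of_summable_norm ha' hb').of_norm
  rw [← coeff_toPS, map_mul, PowerSeries.coeff_mul]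
  refine le_trans (mul_le_mul_of_nonneg_right (norm_sum_le _ _) (pow_nonneg r.2.le _)) ?_
  refine le_of_eq ?_
  rw [Finset.sum_mul]
  refine Finset.sum_congr rfl fun p hp => ?_
  rw [Finset.HasAntidiagonal.mem_antidiagonal] at hp
  rw [norm_mul, ← hp, pow_add]
  simp only [coeff_toPS]; ring

noncomputable instance : NormedCommRing (Wiener r 𝕜) where
  __ := (inferInstance : NormedAddCommGroup (Wiener r 𝕜))
  __ := (inferInstance : CommRing (Wiener r 𝕜))
  dist_eq := fun _ _ => rfl
  norm_mul_le := norm_mul_le'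

noncomputable instance : NormedAlgebra 𝕜 (Wiener r 𝕜) where
  __ := (inferInstance : Algebra 𝕜 (Wiener r 𝕜))
  norm_smul_le c a := (normedSpaceCore.norm_smul c a).le

lemma norm_coeff_le (n : ℕ) (a : Wiener r 𝕜) : ‖coeff n a‖ ≤ ((r : ℝ) ^ n)⁻¹ * ‖a‖ := by
  rw [inv_mul_eq_div, le_div_iff₀ (pow_pos r.2 _)]
  exact norm_coeff_mul_le n a

/-- The element with given coefficients. -/
def ofCoeff (f : ℕ → 𝕜) (hf : Summable fun n => ‖f n‖ * (r : ℝ) ^ n) : Wiener r 𝕜 :=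
  ⟨⟨PowerSeries.mk f, by simpa [wienerSubalgebra] using hf⟩⟩

@[simp] lemma coeff_ofCoeff (f : ℕ → 𝕜) (hf : Summable fun n => ‖f n‖ * (r : ℝ) ^ n) (n : ℕ) :
    coeff n (ofCoeff f hf) = f n :=
  PowerSeries.coeff_mk n f

instance : CompleteSpace (Wiener r 𝕜) := by
  have hp : (0 : ℝ) < (1 : ENNReal).toReal := by simp
  have hr : ∀ n, (r : ℝ) ^ n ≠ 0 := fun n => (pow_pos r.2 n).ne'
  have hn : ∀ n, ‖((r : ℝ) : 𝕜) ^ n‖ = (r : ℝ) ^ n := fun n => by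
    simp [abs_of_pos r.2]
  -- Weighting the coefficients by r^n identifies the algebra isometrically with ℓ¹, whose
  -- completeness is inherited.
  let Ψ : Wiener r 𝕜 → lp (fun _ : ℕ => 𝕜) 1 := fun a =>
    ⟨fun n => ((r : ℝ) : 𝕜) ^ n * coeff n a, memℓp_gen (by
      simpa [hn, abs_of_pos r.2, mul_comm] using summable a)⟩
  have hΨ : Isometry Ψ := by
    refine Isometry.of_dist_eq fun a b => ?_
    rw [dist_eq_norm, dist_eq_norm, lp.norm_eq_tsum_rpow hp, norm_def (a - b)]
    simp only [ENNReal.toReal_one, Real.rpow_one, div_one]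
    refine tsum_congr fun n => ?_
    change ‖((r : ℝ) : 𝕜) ^ n * coeff n a - ((r : ℝ) : 𝕜) ^ n * coeff n b‖ = _
    rw [← mul_sub, norm_mul, hn, map_sub, mul_comm]
  have hs : Function.Surjective Ψ := by
    intro g
    have hg : Summable fun n => ‖g n‖ := by
      simpa using (memℓp_gen_iff hp).1 g.2
    refine ⟨ofCoeff (fun n => (((r : ℝ) : 𝕜) ^ n)⁻¹ * g n) ?_, ?_⟩
    · refine hg.congr fun n => ?_
      rw [norm_mul, norm_inv, hn, mul_assoc, mul_comm, mul_assoc, mul_inv_cancel₀ (hr n), mul_one]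
    · refine Subtype.ext (funext fun n => ?_)
      change ((r : ℝ) : 𝕜) ^ n * coeff n (ofCoeff _ _) = _
      rw [coeff_ofCoeff, mul_inv_cancel_left₀]
      exact pow_ne_zero _ (by exact_mod_cast r.2.ne')
  exact (IsometryEquiv.mk (Equiv.ofBijective Ψ ⟨hΨ.injective, hs⟩) hΨ).completeSpace

/-- The variable `x`. -/
noncomputable def var : Wiener r 𝕜 :=
  ofCoeff (fun n => PowerSeries.coeff n PowerSeries.X)
    (summable_of_ne_finset_zero (s := {1}) fun n hn => by
      have : n ≠ 1 := by simpa using hn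
      simp [PowerSeries.coeff_X, this])

@[simp] lemma toPS_var : toPS (var : Wiener r 𝕜) = PowerSeries.X :=
  PowerSeries.ext fun n => by rw [coeff_toPS, var, coeff_ofCoeff]

lemma coeff_var_pow_mul (n i : ℕ) (a : Wiener r 𝕜) :
    coeff i (var ^ n * a) = if n ≤ i then coeff (i - n) a else 0 := by
  rw [← coeff_toPS, map_mul, map_pow, toPS_var, PowerSeries.coeff_X_pow_mul']
  rfl

lemma coeff_var_pow (n i : ℕ) : coeff i (var ^ n : Wiener r 𝕜) = if i = n then 1 else 0 := by
  rw [← coeff_toPS, map_pow, toPS_var, PowerSeries.coeff_X_pow]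

lemma coeff_one (n : ℕ) : coeff n (1 : Wiener r 𝕜) = if n = 0 then 1 else 0 := by
  simpa using coeff_var_pow (r := r) (𝕜 := 𝕜) 0 n

/-- A series without terms of degree less than `n` is divisible by `x ^ n`. -/
lemma exists_eq_var_pow_mul {n : ℕ} {a : Wiener r 𝕜} (ha : ∀ i < n, coeff i a = 0) :
    ∃ q, a = var ^ n * q := by
  refine ⟨ofCoeff (fun i => coeff (i + n) a) ?_, ?_⟩
  · have h := ((summable_nat_add_iff n).2 (summable a)).mul_right ((r : ℝ) ^ n)⁻¹
    refine h.congr fun i => ?_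
    rw [pow_add, mul_assoc, mul_assoc, mul_inv_cancel₀ (pow_pos r.2 n).ne', mul_one]
  · ext i
    rw [coeff_var_pow_mul]
    split_ifs with h
    · rw [coeff_ofCoeff, Nat.sub_add_cancel h]
    · exact ha i (not_le.1 h)

lemma var_pow_mul_left_cancel {n : ℕ} {a b : Wiener r 𝕜} (h : var ^ n * a = var ^ n * b) :
    a = b := by
  ext i
  have := congrArg (coeff (i + n)) h
  simpa [coeff_var_pow_mul] using this

lemma norm_var_pow_mul (n : ℕ) (a : Wiener r 𝕜) : ‖var ^ n * a‖ = (r : ℝ) ^ n * ‖a‖ := by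
  rw [norm_def, norm_def, ← tsum_mul_left,
    ← (summable (var ^ n * a)).sum_add_tsum_nat_add n, Finset.sum_eq_zero, zero_add]
  · refine tsum_congr fun i => ?_
    rw [coeff_var_pow_mul, if_pos (Nat.le_add_left n i), Nat.add_sub_cancel, pow_add]
    ring
  · intro i hi
    rw [coeff_var_pow_mul, if_neg (by simpa using hi)]
    simp

lemma norm_one' : ‖(1 : Wiener r 𝕜)‖ = 1 := by
  rw [norm_def, tsum_eq_single 0]
  · simp [coeff_one]
  · intro n hn
    simp [coeff_one, hn]

instance : NormOneClass (Wiener r 𝕜) := ⟨norm_one'⟩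

lemma norm_var_pow (n : ℕ) : ‖(var ^ n : Wiener r 𝕜)‖ = (r : ℝ) ^ n := by
  simpa using norm_var_pow_mul n (1 : Wiener r 𝕜)

end Wiener
end Wiener

/-! ### Bounded operators between Wiener algebras. -/

namespace Wiener

section Maps

variable {r s : {r : ℝ // 0 < r}} {𝕜 : Type*} [RCLike 𝕜]

lemma norm_le_of_hasSum {a : Wiener r 𝕜} {g : ℕ → ℝ} {M : ℝ} (hg : HasSum g M)
    (h : ∀ n, ‖coeff n a‖ * (r : ℝ) ^ n ≤ g n) : ‖a‖ ≤ M := by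
  rw [norm_def, ← hg.tsum_eq]
  exact (summable a).tsum_le_tsum h hg.summable

/-- The coefficients as continuous linear forms. -/
noncomputable def coeffL (n : ℕ) : Wiener r 𝕜 →L[𝕜] 𝕜 :=
  (coeff n).mkContinuous ((r : ℝ) ^ n)⁻¹ (norm_coeff_le n)

@[simp] lemma coeffL_apply (n : ℕ) (a : Wiener r 𝕜) : coeffL n a = coeff n a := rfl

lemma norm_coeffL_le (n : ℕ) : ‖(coeffL n : Wiener r 𝕜 →L[𝕜] 𝕜)‖ ≤ ((r : ℝ) ^ n)⁻¹ :=
  LinearMap.mkContinuous_norm_le _ (inv_nonneg.2 (pow_nonneg r.2.le _)) _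

section Lift

variable {𝕂 V : Type*} [NontriviallyNormedField 𝕂] [NormedSpace 𝕂 𝕜]
  [NormedSpace 𝕂 (Wiener r 𝕜)] [LinearMap.CompatibleSMul (Wiener r 𝕜) 𝕜 𝕂 𝕜]
  [SeminormedAddCommGroup V] [NormedSpace 𝕂 V]

/-- The continuous linear map with given coefficients. -/
noncomputable def lift (T : ℕ → V →ₗ[𝕂] 𝕜) (g : V → ℕ → ℝ) (C : ℝ)
    (hg : ∀ v, HasSum (g v) (C * ‖v‖)) (hT : ∀ v n, ‖T n v‖ * (r : ℝ) ^ n ≤ g v n) :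
    V →L[𝕂] Wiener r 𝕜 :=
  have hs : ∀ v, Summable fun n => ‖T n v‖ * (r : ℝ) ^ n := fun v =>
    Summable.of_nonneg_of_le (fun n => mul_nonneg (norm_nonneg _) (pow_nonneg r.2.le _)) (hT v)
      (hg v).summable
  LinearMap.mkContinuous
    { toFun := fun v => ofCoeff (fun n => T n v) (hs v)
      map_add' := fun v w => by ext n; simp
      map_smul' := fun c v => by
        ext n
        rw [LinearMap.map_smul_of_tower]
        simp } C fun v => norm_le_of_hasSum (hg v) fun n => by simpa using hT v n

@[simp] lemma coeff_lift (T : ℕ → V →ₗ[𝕂] 𝕜) (g : V → ℕ → ℝ) (C : ℝ)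
    (hg : ∀ v, HasSum (g v) (C * ‖v‖)) (hT : ∀ v n, ‖T n v‖ * (r : ℝ) ^ n ≤ g v n) (n : ℕ)
    (v : V) : coeff n (lift (r := r) T g C hg hT v) = T n v := by
  simp [lift]

end Lift

/-- The primitive vanishing at `0`. -/
noncomputable def primitive : Wiener r 𝕜 →L[𝕜] Wiener r 𝕜 :=
  -- At n = 0 the index `n - 1` is truncated, but the factor `(0 : 𝕜)⁻¹ = 0` makes the constant term
  -- vanish.
  lift (fun n => (n : 𝕜)⁻¹ • (coeff (n - 1) : Wiener r 𝕜 →ₗ[𝕜] 𝕜))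
    (fun a n => if n = 0 then 0 else (r : ℝ) * (‖coeff (n - 1) a‖ * (r : ℝ) ^ (n - 1))) r
    (fun a => by
      have h := (summable a).hasSum.mul_left (r : ℝ)
      rw [← norm_def] at h
      refine (hasSum_nat_add_iff' 1).1 ?_
      simpa using h)
    (fun a n => by
      rcases n with _ | n
      · simp
      · have : ‖((n + 1 : ℕ) : 𝕜)⁻¹‖ ≤ 1 := by
          rw [norm_inv, RCLike.norm_natCast]
          exact inv_le_one_of_one_le₀ (by exact_mod_cast Nat.le_add_left 1 n)
        have h2 : 0 ≤ ‖coeff n a‖ * (r : ℝ) ^ n * r :=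
          mul_nonneg (mul_nonneg (norm_nonneg _) (pow_nonneg r.2.le _)) r.2.le
        simp only [LinearMap.smul_apply, smul_eq_mul, norm_mul, Nat.add_sub_cancel, pow_succ,
          Nat.succ_ne_zero, if_false]
        nlinarith [mul_le_mul_of_nonneg_right this h2])

lemma derivative_primitive (a : Wiener r 𝕜) :
    PowerSeries.derivative _ (toPS (primitive a)) = toPS a := by
  ext n
  rw [PowerSeries.coeff_derivative, coeff_toPS, coeff_toPS, primitive, coeff_lift]
  have : ((n : 𝕜) + 1) ≠ 0 := by exact_mod_cast Nat.succ_ne_zero n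
  simp only [LinearMap.smul_apply, smul_eq_mul, Nat.add_sub_cancel, Nat.cast_add, Nat.cast_one]
  field_simp

/-- The restriction to a smaller disc. -/
noncomputable def restrict (h : s < r) : Wiener r 𝕜 →L[𝕜] Wiener s 𝕜 :=
  lift coeff (fun a n => ‖coeff n a‖ * (r : ℝ) ^ n) 1
    (fun a => by rw [one_mul]; exact (summable a).hasSum)
    (fun a n => mul_le_mul_of_nonneg_left (pow_le_pow_left₀ s.2.le h.le n) (norm_nonneg _))

@[simp] lemma toPS_restrict (h : s < r) (a : Wiener r 𝕜) : toPS (restrict h a) = toPS a := by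
  ext n
  rw [coeff_toPS, restrict, coeff_lift, coeff_toPS]

/-- The derivative, on a smaller disc. -/
noncomputable def derivative (h : s < r) : Wiener r 𝕜 →L[𝕜] Wiener s 𝕜 :=
  have hq0 : 0 ≤ (s : ℝ) / r := div_nonneg s.2.le r.2.le
  have hq : Summable fun n : ℕ => (n : ℝ) * ((s : ℝ) / r) ^ n := by
    simpa using summable_pow_mul_geometric_of_norm_lt_one 1 (r := (s : ℝ) / r)
      (by rw [Real.norm_of_nonneg hq0, div_lt_one r.2]; exact h)
  lift (fun n => ((n + 1 : ℕ) : 𝕜) • coeff (n + 1))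
    (fun a n => (s : ℝ)⁻¹ * (((n + 1 : ℕ) : ℝ) * ((s : ℝ) / r) ^ (n + 1)) * ‖a‖)
    ((s : ℝ)⁻¹ * ∑' n : ℕ, ((n + 1 : ℕ) : ℝ) * ((s : ℝ) / r) ^ (n + 1))
    (fun a => ((((summable_nat_add_iff 1).2 hq).hasSum.mul_left _).mul_right _))
    (fun a n => by
      have h1 := norm_coeff_mul_le (n + 1) a
      have hs : (s : ℝ) ≠ 0 := s.2.ne'
      have hr : (r : ℝ) ≠ 0 := r.2.ne'
      -- The factor n+1 produced by differentiation is absorbed by the geometric ratio s/r < 1; this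
      -- is why the disc has to shrink.
      have e : (s : ℝ) ^ n = (s : ℝ)⁻¹ * ((s : ℝ) / r) ^ (n + 1) * (r : ℝ) ^ (n + 1) := by
        rw [div_pow]; field_simp; ring
      simp only [LinearMap.smul_apply, smul_eq_mul, norm_mul, RCLike.norm_natCast]
      rw [e]
      have h2 : 0 ≤ ((n + 1 : ℕ) : ℝ) * ((s : ℝ)⁻¹ * ((s : ℝ) / r) ^ (n + 1)) :=
        mul_nonneg (Nat.cast_nonneg _) (mul_nonneg (inv_nonneg.2 s.2.le) (pow_nonneg hq0 _))
      nlinarith [mul_le_mul_of_nonneg_left h1 h2])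

@[simp] lemma toPS_derivative (h : s < r) (a : Wiener r 𝕜) :
    toPS (derivative h a) = PowerSeries.derivative _ (toPS a) := by
  ext n
  rw [coeff_toPS, derivative, coeff_lift, PowerSeries.coeff_derivative, coeff_toPS]
  simp [mul_comm]

/-- The series of the real parts of the coefficients. -/
noncomputable def rePart : Wiener r ℂ →L[ℝ] Wiener r ℝ :=
  lift (fun n => Complex.reLm ∘ₗ (coeff n).restrictScalars ℝ)
    (fun a n => ‖coeff n a‖ * (r : ℝ) ^ n) 1
    (fun a => by rw [one_mul]; exact (summable a).hasSum)
    (fun a n => mul_le_mul_of_nonneg_right (Complex.abs_re_le_norm _) (pow_nonneg r.2.le _))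

@[simp] lemma coeff_rePart (n : ℕ) (a : Wiener r ℂ) : coeff n (rePart a) = (coeff n a).re :=
  coeff_lift _ _ _ _ _ _ _

/-- A series with real coefficients as a series with complex coefficients. -/
noncomputable def ofRealL : Wiener r ℝ →L[ℝ] Wiener r ℂ :=
  lift (fun n => Complex.ofRealCLM.toLinearMap ∘ₗ (coeff n : Wiener r ℝ →ₗ[ℝ] ℝ))
    (fun a n => ‖coeff n a‖ * (r : ℝ) ^ n) 1
    (fun a => by rw [one_mul]; exact (summable a).hasSum)
    (fun a n => by simp)

@[simp] lemma coeff_ofRealL (n : ℕ) (a : Wiener r ℝ) : coeff n (ofRealL a) = ((coeff n a : ℝ) : ℂ) :=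
  coeff_lift _ _ _ _ _ _ _

lemma toPS_ofRealL (a : Wiener r ℝ) :
    toPS (ofRealL a) = PowerSeries.map Complex.ofRealHom (toPS a) := by
  ext n
  rw [coeff_toPS, coeff_ofRealL, PowerSeries.coeff_map, coeff_toPS]
  rfl

/-- `ofRealL` as a ring homomorphism. -/
noncomputable def ofRealHom : Wiener r ℝ →+* Wiener r ℂ where
  toFun := ofRealL
  map_one' := toPS_injective (by rw [toPS_ofRealL]; simp)
  map_mul' a b := toPS_injective (by simp [toPS_ofRealL])
  map_zero' := map_zero _
  map_add' := map_add _

lemma ofRealHom_apply (a : Wiener r ℝ) : ofRealHom a = ofRealL a := rfl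

lemma ofRealHom_rePart {a : Wiener r ℂ} (ha : ∀ n, (coeff n a).im = 0) :
    ofRealHom (rePart a) = a := by
  ext n
  rw [ofRealHom_apply, coeff_ofRealL, coeff_rePart]
  exact Complex.ext rfl (ha n).symm

end Maps

/-! ### Sums of series as holomorphic functions. -/

section Eval

variable {r s : {r : ℝ // 0 < r}}

/-- The sum of the series at a point of the disc. -/
noncomputable def eval (x : ℂ) (a : Wiener r ℂ) : ℂ := ∑' n, coeff n a * x ^ n

lemma norm_term_le {x : ℂ} (hx : ‖x‖ ≤ r) (a : Wiener r ℂ) (n : ℕ) :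
    ‖coeff n a * x ^ n‖ ≤ ‖coeff n a‖ * (r : ℝ) ^ n := by
  rw [norm_mul, norm_pow]
  exact mul_le_mul_of_nonneg_left (pow_le_pow_left₀ (norm_nonneg _) hx n) (norm_nonneg _)

lemma summable_norm_term {x : ℂ} (hx : ‖x‖ ≤ r) (a : Wiener r ℂ) :
    Summable fun n => ‖coeff n a * x ^ n‖ :=
  Summable.of_nonneg_of_le (fun _ => norm_nonneg _) (norm_term_le hx a) (summable a)

lemma eval_restrict (h : s < r) (x : ℂ) (a : Wiener r ℂ) : eval x (restrict h a) = eval x a := by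
  simp only [eval, ← coeff_toPS, toPS_restrict]

/-- The evaluation at a point of the disc is a homomorphism of algebras. -/
noncomputable def evalHom (x : ℂ) (hx : ‖x‖ ≤ r) : Wiener r ℂ →ₐ[ℂ] ℂ :=
  AlgHom.ofLinearMap
    { toFun := eval x
      map_add' := fun a b => by
        simp only [eval, map_add, add_mul]
        exact (summable_norm_term hx a).of_norm.tsum_add (summable_norm_term hx b).of_norm
      map_smul' := fun c a => by
        simp only [eval, map_smul, smul_eq_mul, mul_assoc, tsum_mul_left, RingHom.id_apply] }
    (by
      change eval x 1 = 1
      rw [eval, tsum_eq_single 0]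
      · simp [coeff_one]
      · intro n hn
        simp [coeff_one, hn])
    (fun a b => by
      change eval x (a * b) = eval x a * eval x b
      rw [eval, eval, eval, tsum_mul_tsum_eq_tsum_sum_antidiagonal_of_summable_norm
        (summable_norm_term hx a) (summable_norm_term hx b)]
      refine tsum_congr fun n => ?_
      rw [← coeff_toPS, map_mul, PowerSeries.coeff_mul, Finset.sum_mul]
      refine Finset.sum_congr rfl fun p hp => ?_
      rw [Finset.HasAntidiagonal.mem_antidiagonal] at hp
      rw [← hp, pow_add, coeff_toPS, coeff_toPS]
      ring)

lemma evalHom_apply (x : ℂ) (hx : ‖x‖ ≤ r) (a : Wiener r ℂ) : evalHom x hx a = eval x a := rfl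

lemma eval_var (x : ℂ) : eval x (var : Wiener r ℂ) = x := by
  rw [eval, tsum_eq_single 1]
  · have := coeff_var_pow (r := r) (𝕜 := ℂ) 1 1
    rw [pow_one, if_pos rfl] at this
    rw [this, one_mul, pow_one]
  · intro n hn
    have := coeff_var_pow (r := r) (𝕜 := ℂ) 1 n
    rw [pow_one, if_neg hn] at this
    rw [this, zero_mul]

lemma eval_conj_ofRealL (x : ℂ) (a : Wiener r ℝ) :
    eval (conj x) (ofRealL a) = conj (eval x (ofRealL a)) := by
  rw [eval, eval, Complex.conj_tsum]
  simp

lemma hasFPowerSeriesAt_eval (a : Wiener r ℂ) :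
    HasFPowerSeriesAt (fun x => eval x a)
      (FormalMultilinearSeries.ofScalars ℂ fun n => coeff n a) 0 := by
  rw [hasFPowerSeriesAt_iff]
  filter_upwards [Metric.ball_mem_nhds (0 : ℂ) r.2] with x hx
  have hx' : ‖x‖ ≤ r := by simpa using (Metric.mem_ball.1 hx).le
  have := (summable_norm_term hx' a).of_norm.hasSum
  simpa [eval, mul_comm] using this

/-- The coefficients are determined by the sum of the series near `0`. -/
lemma coeff_eq_of_eventuallyEq {a : Wiener r ℂ} {b : Wiener s ℂ}
    (h : ∀ᶠ x in 𝓝 0, eval x a = eval x b) (n : ℕ) : coeff n a = coeff n b := by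
  have := HasFPowerSeriesAt.eq_formalMultilinearSeries_of_eventually (hasFPowerSeriesAt_eval a)
    (hasFPowerSeriesAt_eval b) h
  have h2 := congrArg (fun p => FormalMultilinearSeries.coeff p n) this
  simpa using h2

lemma eq_of_eventuallyEq {a b : Wiener r ℂ} (h : ∀ᶠ x in 𝓝 0, eval x a = eval x b) : a = b :=
  ext fun n => coeff_eq_of_eventuallyEq h n

/-- Two radii are allowed: s = r serves when the derivative is already known to lie in the same
algebra, s < r when it comes from `derivative`. -/
lemma hasDerivAt_eval {a : Wiener r ℂ} {b : Wiener s ℂ} (hs : s ≤ r)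
    (hb : PowerSeries.derivative _ (toPS a) = toPS b) {x : ℂ} (hx : ‖x‖ < s) :
    HasDerivAt (fun x => eval x a) (eval x b) x := by
  have hc : ∀ n, ((n + 1 : ℕ) : ℂ) * coeff (n + 1) a = coeff n b := fun n => by
    rw [← coeff_toPS n b, ← hb, PowerSeries.coeff_derivative, coeff_toPS]
    push_cast; ring
  have hx0 : x ∈ Metric.ball (0 : ℂ) s := by simpa using hx
  let u : ℕ → ℝ := fun n => if n = 0 then 0 else ‖coeff (n - 1) b‖ * (s : ℝ) ^ (n - 1)
  have hu : Summable u := by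
    rw [← summable_nat_add_iff 1]
    simpa [u] using summable b
  have key := hasDerivAt_tsum_of_isPreconnected (g := fun n (y : ℂ) => coeff n a * y ^ n)
    (g' := fun n y => coeff n a * ((n : ℂ) * y ^ (n - 1))) hu Metric.isOpen_ball
    (convex_ball (0 : ℂ) (s : ℝ)).isPreconnected
    (fun n y _ => (hasDerivAt_pow n y).const_mul _)
    (fun n y hy => by
      rcases n with _ | n
      · simp [u]
      · have hy' : ‖y‖ ≤ s := by simpa using (Metric.mem_ball.1 hy).le
        have e : coeff (n + 1) a * (((n + 1 : ℕ) : ℂ) * y ^ (n + 1 - 1)) = coeff n b * y ^ n := by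
          rw [← hc n, Nat.add_sub_cancel]; ring
        rw [e]
        simpa [u] using norm_term_le hy' b n)
    hx0 (summable_norm_term (hx.le.trans hs) a).of_norm hx0
  suffices h : ∑' n, coeff n a * ((n : ℂ) * x ^ (n - 1)) = eval x b by rwa [h] at key
  have hsum : Summable fun n : ℕ => coeff n a * ((n : ℂ) * x ^ (n - 1)) := by
    rw [← summable_nat_add_iff 1]
    refine (summable_norm_term hx.le b).of_norm.congr fun n => ?_
    rw [← hc n, Nat.add_sub_cancel]; ring
  rw [hsum.tsum_eq_zero_add, eval]
  simp only [Nat.cast_zero, zero_mul, mul_zero, zero_add]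
  refine tsum_congr fun n => ?_
  rw [← hc n, Nat.add_sub_cancel]; ring

/-- The evaluation is jointly analytic. -/
lemma analyticAt_eval (a : Wiener r ℂ) :
    AnalyticAt ℂ (fun p : ℂ × Wiener r ℂ => eval p.1 p.2) (0, a) := by
  have hr := r.2
  have hr2 : 0 < (r : ℝ) / 2 := by linarith
  -- Evaluation at x is viewed as a holomorphic function of x with values in the dual. Joint
  -- analyticity then follows from the bilinear pairing.
  let δ : ℂ → (Wiener r ℂ →L[ℂ] ℂ) := fun x => ∑' n, x ^ n • coeffL n
  have hbound : ∀ (n : ℕ) (w : ℂ), w ∈ Metric.ball (0 : ℂ) ((r : ℝ) / 2) →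
      ‖w ^ n • (coeffL n : Wiener r ℂ →L[ℂ] ℂ)‖ ≤ (1 / 2 : ℝ) ^ n := by
    intro n w hw
    have hw' : ‖w‖ ≤ (r : ℝ) / 2 := by simpa using (Metric.mem_ball.1 hw).le
    rw [norm_smul, norm_pow]
    calc ‖w‖ ^ n * ‖(coeffL n : Wiener r ℂ →L[ℂ] ℂ)‖ ≤ ((r : ℝ) / 2) ^ n * ((r : ℝ) ^ n)⁻¹ :=
          mul_le_mul (pow_le_pow_left₀ (norm_nonneg _) hw' n) (norm_coeffL_le n) (norm_nonneg _)
            (pow_nonneg hr2.le _)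
      _ = (1 / 2 : ℝ) ^ n := by
          rw [← inv_pow, ← mul_pow]
          congr 1
          field_simp
  have hsum : Summable fun n : ℕ => (1 / 2 : ℝ) ^ n :=
    summable_geometric_of_lt_one (by norm_num) (by norm_num)
  have hδ : AnalyticAt ℂ δ 0 :=
    (Complex.differentiableOn_tsum_of_summable_norm hsum
      (fun n => (differentiable_id.pow n).differentiableOn.smul_const _) Metric.isOpen_ball
      hbound).analyticAt (Metric.ball_mem_nhds _ hr2)
  have h1 : AnalyticAt ℂ (fun p : ℂ × Wiener r ℂ => (δ p.1) p.2) (0, a) := by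
    have h2 : AnalyticAt ℂ (fun p : ℂ × Wiener r ℂ => δ p.1) (0, a) :=
      AnalyticAt.fun_comp (g := δ) (f := fun p : ℂ × Wiener r ℂ => p.1) hδ analyticAt_fst
    exact AnalyticAt.fun_comp (g := fun q : (Wiener r ℂ →L[ℂ] ℂ) × Wiener r ℂ => q.1 q.2)
      (f := fun p : ℂ × Wiener r ℂ => (δ p.1, p.2))
      ((ContinuousLinearMap.id ℂ (Wiener r ℂ →L[ℂ] ℂ)).analyticAt_bilinear _)
      (h2.prod analyticAt_snd)
  refine h1.congr ?_
  have hn : ∀ᶠ p : ℂ × Wiener r ℂ in 𝓝 (0, a), p.1 ∈ Metric.ball (0 : ℂ) ((r : ℝ) / 2) :=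
    continuousAt_fst.eventually (Metric.ball_mem_nhds _ hr2)
  filter_upwards [hn] with p hp
  have hs : Summable fun n => p.1 ^ n • (coeffL n : Wiener r ℂ →L[ℂ] ℂ) :=
    Summable.of_norm_bounded hsum fun n => hbound n _ hp
  change (∑' n, p.1 ^ n • (coeffL n : Wiener r ℂ →L[ℂ] ℂ)) p.2 = _
  have := (ContinuousLinearMap.apply ℂ ℂ p.2).map_tsum hs
  rw [ContinuousLinearMap.apply_apply] at this
  rw [this, eval]
  refine tsum_congr fun n => ?_
  simp [mul_comm]

end Eval

end Wiener

/-! ### Analyticity of composition operators on spaces of continuous functions. -/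

section Superposition

variable {K V W : Type*} [TopologicalSpace K] [CompactSpace K] [NormedAddCommGroup V]
  [NormedSpace ℝ V] [NormedAddCommGroup W] [NormedSpace ℝ W]

/-- The power series of the superposition operator `u ↦ f ∘ u` on continuous functions. -/
noncomputable def superposition (K : Type*) [TopologicalSpace K] [CompactSpace K]
    (p : FormalMultilinearSeries ℝ V W) : FormalMultilinearSeries ℝ C(K, V) C(K, W) := fun n =>
  MultilinearMap.mkContinuous
    { toFun := fun u => ⟨fun x => p n fun i => u i x, by fun_prop⟩
      map_update_add' := fun {_} m i x y => by
        ext t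
        have e : ∀ z : C(K, V), (fun j => Function.update m i z j t) =
            Function.update (fun j => m j t) i (z t) := fun z => by
          funext j
          rcases eq_or_ne j i with rfl | h
          · simp
          · simp [h]
        simp [e]
      map_update_smul' := fun {_} m i c x => by
        ext t
        have e : ∀ z : C(K, V), (fun j => Function.update m i z j t) =
            Function.update (fun j => m j t) i (z t) := fun z => by
          funext j
          rcases eq_or_ne j i with rfl | h
          · simp
          · simp [h]
        simp [e] } ‖p n‖ fun u => by
      rw [ContinuousMap.norm_le _ (mul_nonneg (norm_nonneg _)
        (Finset.prod_nonneg fun _ _ => norm_nonneg _))]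
      intro x
      refine (ContinuousMultilinearMap.le_opNorm _ _).trans ?_
      exact mul_le_mul_of_nonneg_left (Finset.prod_le_prod (fun _ _ => norm_nonneg _)
        fun i _ => (u i).norm_coe_le_norm x) (norm_nonneg _)

/-- Each multilinear term acts pointwise, so its norm does not exceed `‖p n‖`. -/
lemma radius_le_radius_superposition (p : FormalMultilinearSeries ℝ V W) :
    p.radius ≤ (superposition K p).radius :=
  FormalMultilinearSeries.radius_le_of_le fun _ =>
    MultilinearMap.mkContinuous_norm_le _ (norm_nonneg _) _

lemma hasFPowerSeriesOnBall_superposition [CompleteSpace W] {f : V → W}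
    {p : FormalMultilinearSeries ℝ V W} {R : ENNReal} (hf : HasFPowerSeriesOnBall f p 0 R) :
    HasFPowerSeriesOnBall (superposition K p).sum (superposition K p) 0 R :=
  ((superposition K p).hasFPowerSeriesOnBall
    (hf.r_pos.trans_le (hf.r_le.trans (radius_le_radius_superposition p)))).mono hf.r_pos
      (hf.r_le.trans (radius_le_radius_superposition p))

/-- Evaluation at a point of `K` is continuous and linear, so it carries the sum in C(K, W) to the
power series of `f` at `u x`. -/
lemma superposition_sum_apply [CompleteSpace W] {f : V → W}
    {p : FormalMultilinearSeries ℝ V W} {R : ENNReal} (hf : HasFPowerSeriesOnBall f p 0 R)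
    {u : C(K, V)} (hu : ‖u‖ₑ < R) (x : K) : (superposition K p).sum u x = f (u x) := by
  have h1 := (hasFPowerSeriesOnBall_superposition (K := K) hf).hasSum (y := u)
    (by simpa using hu)
  rw [zero_add] at h1
  have h2 := (ContinuousMap.evalCLM ℝ x : C(K, W) →L[ℝ] W).hasSum h1
  have hux : ‖u x‖ₑ < R := lt_of_le_of_lt (by
    rw [← ofReal_norm, ← ofReal_norm]
    exact ENNReal.ofReal_le_ofReal (u.norm_coe_le_norm x)) hu
  have h3 := hf.hasSum (y := u x) (by simpa using hux)
  rw [zero_add] at h3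
  exact h2.unique h3

end Superposition

/-! ### Taylor series from values on a circle. -/

section Cauchy

variable {r : {r : ℝ // 0 < r}} {ρ : ℝ}

/-- The point of the circle at the angle `θ`. -/
noncomputable def circlePoint (hρ : 0 < ρ) (θ : ℝ) : Metric.sphere (0 : ℂ) ρ :=
  ⟨circleMap 0 ρ θ, circleMap_mem_sphere 0 hρ.le θ⟩

lemma continuous_circlePoint (hρ : 0 < ρ) : Continuous (circlePoint hρ) :=
  (continuous_circleMap 0 ρ).subtype_mk _

lemma continuous_cauchyIntegrand (hρ : 0 < ρ) (g : C(Metric.sphere (0 : ℂ) ρ, ℂ)) (n : ℕ) :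
    Continuous fun θ => (circleMap 0 ρ θ ^ n)⁻¹ * g (circlePoint hρ θ) := by
  refine Continuous.mul (Continuous.inv₀ ((continuous_circleMap 0 ρ).pow n) fun θ => ?_)
    (g.continuous.comp (continuous_circlePoint hρ))
  exact pow_ne_zero _ (circleMap_ne_center hρ.ne')

/-- The Cauchy formula for the coefficients of a holomorphic function. -/
noncomputable def cauchyCoeff (hρ : 0 < ρ) (n : ℕ) : C(Metric.sphere (0 : ℂ) ρ, ℂ) →ₗ[ℝ] ℂ where
  toFun g := (2 * Real.pi)⁻¹ •
    ∫ θ in (0 : ℝ)..2 * Real.pi, (circleMap 0 ρ θ ^ n)⁻¹ * g (circlePoint hρ θ)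
  map_add' g h := by
    rw [← smul_add, ← intervalIntegral.integral_add
      ((continuous_cauchyIntegrand hρ g n).intervalIntegrable _ _)
      ((continuous_cauchyIntegrand hρ h n).intervalIntegrable _ _)]
    simp only [ContinuousMap.add_apply, mul_add]
  map_smul' c g := by
    simp only [ContinuousMap.smul_apply, mul_smul_comm, intervalIntegral.integral_smul,
      RingHom.id_apply]
    rw [smul_comm]

lemma cauchyCoeff_apply (hρ : 0 < ρ) (n : ℕ) (g : C(Metric.sphere (0 : ℂ) ρ, ℂ)) :
    cauchyCoeff hρ n g = (2 * Real.pi)⁻¹ •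
      ∫ θ in (0 : ℝ)..2 * Real.pi, (circleMap 0 ρ θ ^ n)⁻¹ * g (circlePoint hρ θ) := rfl

lemma norm_cauchyCoeff_le (hρ : 0 < ρ) (n : ℕ) (g : C(Metric.sphere (0 : ℂ) ρ, ℂ)) :
    ‖cauchyCoeff hρ n g‖ ≤ (ρ ^ n)⁻¹ * ‖g‖ := by
  have h := intervalIntegral.norm_integral_le_of_norm_le_const
    (f := fun θ => (circleMap 0 ρ θ ^ n)⁻¹ * g (circlePoint hρ θ)) (a := 0) (b := 2 * Real.pi)
    (C := (ρ ^ n)⁻¹ * ‖g‖) fun θ _ => by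
      rw [norm_mul, norm_inv, norm_pow, norm_circleMap_zero, abs_of_pos hρ]
      exact mul_le_mul_of_nonneg_left (g.norm_coe_le_norm _) (inv_nonneg.2 (pow_nonneg hρ.le _))
  have hpi : 0 < 2 * Real.pi := Real.two_pi_pos
  rw [cauchyCoeff_apply, norm_smul, norm_inv, Real.norm_of_nonneg hpi.le, inv_mul_le_iff₀ hpi]
  rw [sub_zero, abs_of_pos hpi] at h
  linarith

/-- The Taylor series at `0` of a holomorphic function given on a circle. -/
noncomputable def cauchySeries (hρ : 0 < ρ) (h : r < ρ) :
    C(Metric.sphere (0 : ℂ) ρ, ℂ) →L[ℝ] Wiener r ℂ :=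
  have hq0 : 0 ≤ (r : ℝ) / ρ := div_nonneg r.2.le hρ.le
  have hq : Summable fun n : ℕ => ((r : ℝ) / ρ) ^ n :=
    summable_geometric_of_lt_one hq0 ((div_lt_one hρ).2 h)
  Wiener.lift (cauchyCoeff hρ) (fun g n => ((r : ℝ) / ρ) ^ n * ‖g‖)
    (∑' n : ℕ, ((r : ℝ) / ρ) ^ n) (fun _ => hq.hasSum.mul_right _)
    (fun g n => by
      have := mul_le_mul_of_nonneg_right (norm_cauchyCoeff_le hρ n g) (pow_nonneg r.2.le n)
      refine this.trans (le_of_eq ?_)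
      rw [div_pow, div_eq_mul_inv]
      ring)

lemma eval_cauchySeries (hρ : 0 < ρ) (h : r < ρ) {f : ℂ → ℂ}
    (hf : DiffContOnCl ℂ f (Metric.ball 0 ρ)) {g : C(Metric.sphere (0 : ℂ) ρ, ℂ)}
    (hg : ∀ z, g z = f z) {x : ℂ} (hx : ‖x‖ < r) :
    Wiener.eval x (cauchySeries (r := r) hρ h g) = f x := by
  lift ρ to NNReal using hρ.le
  have hs := (hf.hasFPowerSeriesOnBall (NNReal.coe_pos.1 hρ)).hasSum (y := x) (by
    have : ‖x‖₊ < ρ := by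
      rw [← NNReal.coe_lt_coe, coe_nnnorm]; exact hx.trans h
    rw [Metric.mem_eball, edist_zero_right, enorm_eq_nnnorm]
    exact_mod_cast this)
  rw [zero_add] at hs
  rw [← hs.tsum_eq, Wiener.eval]
  refine tsum_congr fun n => ?_
  rw [cauchySeries, Wiener.coeff_lift, cauchyPowerSeries_apply, circleIntegral]
  rw [cauchyCoeff_apply, smul_mul_assoc, ← intervalIntegral.integral_mul_const, Complex.real_smul,
    ← intervalIntegral.integral_const_mul, smul_eq_mul, ← intervalIntegral.integral_const_mul]
  refine intervalIntegral.integral_congr fun θ _ => ?_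
  have h0 : circleMap 0 (ρ : ℝ) θ ≠ 0 := circleMap_ne_center hρ.ne'
  have hg' : g (circlePoint hρ θ) = f (circleMap 0 ρ θ) := hg _
  have hI := Complex.I_ne_zero
  have hpi : (Real.pi : ℂ) ≠ 0 := by exact_mod_cast Real.pi_ne_zero
  simp only [hg', deriv_circleMap, sub_zero, smul_eq_mul, div_pow]
  push_cast
  field_simp

end Cauchy

/-! ### Analytic families as analytic curves in a Wiener algebra. -/

section Families

variable {E : Type*} [NormedAddCommGroup E] [NormedSpace ℝ E]

/-- A family of holomorphic functions is an analytic curve in the Wiener algebra. -/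
lemma IsAnalyticFamily.exists_wiener {f : ℂ → E → ℂ} (hf : IsAnalyticFamily f) :
    ∃ R > 0, ∀ r : {r : ℝ // 0 < r}, (r : ℝ) < R → ∃ F : E → Wiener r ℂ, AnalyticAt ℝ F 0 ∧
      ∀ᶠ l in 𝓝 0, ∀ x : ℂ, ‖x‖ < r → Wiener.eval x (F l) = f x l := by
  obtain ⟨p, R₁, hp⟩ := hf.analyticAt
  obtain ⟨R₂, hR₂, hd⟩ := Metric.eventually_nhds_iff.1 hf.holomorphic
  obtain ⟨R₃, hR₃, hR₃1⟩ : ∃ R : ℝ, 0 < R ∧ ENNReal.ofReal R < R₁ := by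
    rcases eq_or_ne R₁ ⊤ with h | h
    · exact ⟨1, one_pos, by simp [h]⟩
    · have h0 : 0 < R₁.toReal := ENNReal.toReal_pos hp.r_pos.ne' h
      refine ⟨R₁.toReal / 2, by linarith, ?_⟩
      rw [ENNReal.ofReal_lt_iff_lt_toReal (by linarith) h]
      linarith
  refine ⟨min R₂ R₃, lt_min hR₂ hR₃, fun r hr => ?_⟩
  obtain ⟨ρ, hrρ, hρR⟩ := exists_between hr
  have hρ : 0 < ρ := r.2.trans hrρ
  let K := Metric.sphere (0 : ℂ) ρ
  -- The map sending l to the function z ↦ (z, l) on the circle is affine. Composing it with the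
  -- superposition operator of f shows that the boundary values depend analytically on l; holomorphy
  -- in x is needed only to recover f from them.
  let u₀ : C(K, ℂ × E) := ⟨fun z => ((z : ℂ), 0), by fun_prop⟩
  let L : E →L[ℝ] C(K, ℂ × E) := LinearMap.mkContinuous
    { toFun := fun l => ContinuousMap.const K (0, l)
      map_add' := fun a b => by ext x <;> simp
      map_smul' := fun c a => by ext x <;> simp } 1 fun l => by
        rw [one_mul, ContinuousMap.norm_le _ (norm_nonneg _)]
        intro x
        simp [Prod.norm_def]
  have hL : ∀ l z, L l z = (0, l) := fun l z => rfl
  have hnorm : ∀ᶠ l : E in 𝓝 0, ‖u₀ + L l‖ₑ < R₁ := by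
    have hl : ∀ᶠ l : E in 𝓝 0, ‖l‖ < R₃ := by
      filter_upwards [Metric.ball_mem_nhds (0 : E) hR₃] with l hl
      simpa using hl
    filter_upwards [hl] with l hl
    refine lt_of_le_of_lt ?_ hR₃1
    rw [← ofReal_norm]
    refine ENNReal.ofReal_le_ofReal ?_
    rw [ContinuousMap.norm_le _ hR₃.le]
    intro z
    have hz : ‖(z : ℂ)‖ = ρ := by simp
    have e : (u₀ + L l) z = ((z : ℂ), l) := by
      rw [ContinuousMap.add_apply, hL]; simp [u₀]
    rw [e, Prod.norm_def]
    exact max_le (hz.le.trans (hρR.le.trans (min_le_right _ _))) hl.le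
  let G : E → C(K, ℂ) := fun l => (superposition K p).sum (u₀ + L l)
  have hG : AnalyticAt ℝ G 0 := by
    have h1 : AnalyticAt ℝ (superposition K p).sum (u₀ + L 0) := by
      refine (hasFPowerSeriesOnBall_superposition (K := K) hp).analyticAt_of_mem ?_
      simpa using hnorm.self_of_nhds
    exact AnalyticAt.fun_comp (g := (superposition K p).sum) (f := fun l => u₀ + L l) h1
      (analyticAt_const.add (L.analyticAt 0))
  refine ⟨fun l => cauchySeries hρ hrρ (G l), ?_, ?_⟩
  · exact AnalyticAt.fun_comp (g := cauchySeries (r := r) hρ hrρ)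
      ((cauchySeries (r := r) hρ hrρ).analyticAt _) hG
  · have hl : ∀ᶠ l : E in 𝓝 0, ‖l‖ < R₂ := by
      filter_upwards [Metric.ball_mem_nhds (0 : E) hR₂] with l hl
      simpa using hl
    filter_upwards [hnorm, hl] with l h1 h2 x hx
    refine eval_cauchySeries hρ hrρ (f := fun x => f x l) ?_ ?_ hx
    · refine DifferentiableOn.diffContOnCl_ball (U := Metric.ball 0 R₂) ?_ ?_
      · intro z hz
        refine DifferentiableAt.differentiableWithinAt (hd (y := (z, l)) ?_)
        rw [dist_zero_right, Prod.norm_def]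
        exact max_lt (by simpa using hz) h2
      · exact Metric.closedBall_subset_ball (hρR.trans_le (min_le_left _ _))
    · intro z
      have e : (u₀ + L l) z = ((z : ℂ), l) := by
        rw [ContinuousMap.add_apply, hL]; simp [u₀]
      change (superposition K p).sum (u₀ + L l) z = _
      rw [superposition_sum_apply hp h1, e]

/-- An analytic curve in the Wiener algebra is a family of holomorphic functions. -/
lemma isAnalyticFamily_eval {r : {r : ℝ // 0 < r}} {F : E → Wiener r ℂ} (hF : AnalyticAt ℝ F 0) :
    IsAnalyticFamily fun x l => Wiener.eval x (F l) where
  analyticAt := by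
    have h1 := (Wiener.analyticAt_eval (F 0)).restrictScalars (𝕜 := ℝ)
    have h2 : AnalyticAt ℝ (fun p : ℂ × E => (p.1, F p.2)) 0 :=
      analyticAt_fst.prod (AnalyticAt.fun_comp (g := F) (f := fun p : ℂ × E => p.2) hF
        analyticAt_snd)
    exact AnalyticAt.fun_comp (g := fun p : ℂ × Wiener r ℂ => Wiener.eval p.1 p.2)
      (f := fun p : ℂ × E => (p.1, F p.2)) h1 h2
  holomorphic := by
    obtain ⟨s, hs0, hsr⟩ := exists_between r.2
    have hn : ∀ᶠ p : ℂ × E in 𝓝 0, p.1 ∈ Metric.ball (0 : ℂ) s :=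
      continuousAt_fst.eventually (Metric.ball_mem_nhds _ hs0)
    filter_upwards [hn] with p hp
    exact (Wiener.hasDerivAt_eval (s := ⟨s, hs0⟩) hsr.le
      (Wiener.toPS_derivative (s := ⟨s, hs0⟩) hsr (F p.2)).symm
      (by simpa using hp)).differentiableAt

end Families

/-! ### A common shape for the three normal forms. -/

/-- The data of a normal form `(P_y (1 - α m x^k) - β m x^(2k+1)) / (δ + γ m x^k)`, where
`P_y = x^(k+1) + y_(k-1) x^(k-1) + … + y_0`. -/
structure NormalForm where
  /-- the multiplicity of the singular point, minus one -/
  k : ℕ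
  /-- the coefficient of `m` in the second factor of the numerator -/
  α : ℝ
  /-- the coefficient of `m` in the last term of the numerator -/
  β : ℝ
  /-- the coefficient of `m` in the denominator -/
  γ : ℝ
  /-- the constant term of the denominator -/
  δ : ℝ
  one_le_k : 1 ≤ k
  δ_ne_zero : δ ≠ 0
  transversal : (α + β) * δ + γ ≠ 0

namespace NormalForm

section Polynomials

variable (q : NormalForm) {𝕜 : Type*} [RCLike 𝕜]

/-- The numerator. -/
noncomputable def num (y : Fin q.k → 𝕜) (m : 𝕜) : Polynomial 𝕜 :=
  (Polynomial.X ^ (q.k + 1) + ∑ j : Fin q.k, Polynomial.C (y j) * Polynomial.X ^ (j : ℕ)) *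
    (1 - Polynomial.C ((q.α : 𝕜) * m) * Polynomial.X ^ q.k) -
      Polynomial.C ((q.β : 𝕜) * m) * Polynomial.X ^ (2 * q.k + 1)

/-- The denominator. -/
noncomputable def den (m : 𝕜) : Polynomial 𝕜 :=
  Polynomial.C (q.δ : 𝕜) + Polynomial.C ((q.γ : 𝕜) * m) * Polynomial.X ^ q.k

lemma aeval_num {A : Type*} [CommRing A] [Algebra 𝕜 A] (φ : A) (y : Fin q.k → 𝕜) (m : 𝕜) :
    Polynomial.aeval φ (q.num y m) =
      (φ ^ (q.k + 1) + ∑ j : Fin q.k, y j • φ ^ (j : ℕ)) * (1 - ((q.α : 𝕜) * m) • φ ^ q.k) -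
        ((q.β : 𝕜) * m) • φ ^ (2 * q.k + 1) := by
  simp [num, Algebra.smul_def]

lemma aeval_den {A : Type*} [CommRing A] [Algebra 𝕜 A] (φ : A) (m : 𝕜) :
    Polynomial.aeval φ (q.den m) = algebraMap 𝕜 A q.δ + ((q.γ : 𝕜) * m) • φ ^ q.k := by
  simp [den, Algebra.smul_def]

end Polynomials

end NormalForm

namespace Wiener

variable {r : {r : ℝ // 0 < r}} {𝕜 : Type*} [RCLike 𝕜]

/-- The polynomial of degree less than `n` with coefficients `b`. -/
noncomputable def lowPoly {n : ℕ} (b : Fin n → 𝕜) : Wiener r 𝕜 := ∑ j, b j • var ^ (j : ℕ)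

/-- The derivative of `lowPoly b`. -/
noncomputable def lowPolyDeriv {n : ℕ} (b : Fin n → 𝕜) : Wiener r 𝕜 :=
  ∑ j, b j • ((j : ℕ) : 𝕜) • var ^ ((j : ℕ) - 1)

lemma derivative_lowPoly {n : ℕ} (b : Fin n → 𝕜) :
    PowerSeries.derivative _ (toPS (lowPoly b : Wiener r 𝕜)) =
      toPS (lowPolyDeriv b : Wiener r 𝕜) := by
  simp only [lowPoly, lowPolyDeriv, map_sum, map_smul, map_pow, toPS_var, Derivation.map_smul]
  refine Finset.sum_congr rfl fun j _ => ?_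
  rw [Derivation.leibniz_pow, PowerSeries.derivative_X, smul_eq_mul, mul_one, Nat.cast_smul_eq_nsmul]

lemma coeff_lowPoly {n : ℕ} (b : Fin n → 𝕜) (i : ℕ) :
    coeff i (lowPoly b : Wiener r 𝕜) = if h : i < n then b ⟨i, h⟩ else 0 := by
  simp only [lowPoly, map_sum, map_smul, coeff_var_pow, smul_eq_mul, mul_ite, mul_one, mul_zero]
  split_ifs with h
  · rw [Finset.sum_eq_single ⟨i, h⟩]
    · simp
    · intro j _ hj
      rw [if_neg]
      intro e
      exact hj (Fin.ext e.symm)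
    · simp
  · refine Finset.sum_eq_zero fun j _ => if_neg ?_
    have := j.2
    omega

lemma var_mul_lowPolyDeriv {n : ℕ} (b : Fin n → 𝕜) :
    var * (lowPolyDeriv b : Wiener r 𝕜) = lowPoly fun j => ((j : ℕ) : 𝕜) * b j := by
  rw [lowPolyDeriv, lowPoly, Finset.mul_sum]
  refine Finset.sum_congr rfl fun j _ => ?_
  rw [mul_smul_comm, mul_smul_comm, smul_smul, mul_comm]
  rcases Nat.eq_zero_or_pos (j : ℕ) with h | h
  · simp [h]
  · rw [← pow_succ', Nat.sub_add_cancel h]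

@[simp] lemma lowPoly_zero {n : ℕ} : (lowPoly (0 : Fin n → 𝕜) : Wiener r 𝕜) = 0 := by
  simp [lowPoly]

@[simp] lemma lowPolyDeriv_zero {n : ℕ} : (lowPolyDeriv (0 : Fin n → 𝕜) : Wiener r 𝕜) = 0 := by
  simp [lowPolyDeriv]

/-- Neumann series, once `c` is factored out. -/
lemma isUnit_add_smul_var_pow {c d : 𝕜} {n : ℕ} (h : ‖d‖ * (r : ℝ) ^ n < ‖c‖) :
    IsUnit (algebraMap 𝕜 (Wiener r 𝕜) c + d • var ^ n) := by
  have hc : c ≠ 0 := by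
    rintro rfl
    rw [norm_zero] at h
    exact absurd h (not_lt.2 (mul_nonneg (norm_nonneg _) (pow_nonneg r.2.le _)))
  have e : algebraMap 𝕜 (Wiener r 𝕜) c + d • var ^ n =
      algebraMap 𝕜 (Wiener r 𝕜) c * (1 - (-(c⁻¹ * d)) • var ^ n) := by
    rw [mul_sub, mul_one, neg_smul, mul_neg, sub_neg_eq_add, ← Algebra.smul_def, smul_smul,
      mul_inv_cancel_left₀ hc]
  rw [e]
  refine ((isUnit_iff_ne_zero.2 hc).map (algebraMap 𝕜 (Wiener r 𝕜))).mul
    (isUnit_one_sub_of_norm_lt_one ?_)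
  rw [norm_smul, norm_var_pow, norm_neg, norm_mul, norm_inv, mul_assoc, inv_mul_lt_iff₀
    (norm_pos_iff.2 hc), mul_one]
  exact h

end Wiener

open Wiener
open scoped ContDiff

/-! ### The equation of conjugacy as a map of Banach spaces. -/

namespace NormalForm

section Equation

variable (q : NormalForm) {r : {r : ℝ // 0 < r}} {𝕜 : Type*} [RCLike 𝕜]

/-- The finite dimensional part of the unknowns: a polynomial of degree at most `k`, and the
parameters of the normal form. -/
abbrev Unknown (𝕜 : Type*) [RCLike 𝕜] : Type _ := (Fin (q.k + 1) → 𝕜) × ((Fin q.k → 𝕜) × 𝕜)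

/-- The change of coordinate `x + f + X * K w`, with `f` of degree at most `k`. -/
noncomputable def change (K : Wiener r 𝕜 →L[𝕜] Wiener r 𝕜) (X : Wiener r 𝕜) (b : Fin (q.k + 1) → 𝕜)
    (w : Wiener r 𝕜) : Wiener r 𝕜 := var + lowPoly b + X * K w

/-- The derivative of the change of coordinate, if `X₁` is the derivative of `X` and `K` is either
zero or the primitive; in the former case it is corrected by `X * w`. -/
noncomputable def changeDeriv (K : Wiener r 𝕜 →L[𝕜] Wiener r 𝕜) (X X₁ : Wiener r 𝕜)
    (b : Fin (q.k + 1) → 𝕜) (w : Wiener r 𝕜) : Wiener r 𝕜 :=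
  1 + lowPolyDeriv b + X₁ * K w + X * w

/-- The equation of conjugacy of the vector field `X` to the normal form. -/
noncomputable def defect (K : Wiener r 𝕜 →L[𝕜] Wiener r 𝕜)
    (p : (Wiener r 𝕜 × Wiener r 𝕜) × (q.Unknown 𝕜 × Wiener r 𝕜)) : Wiener r 𝕜 :=
  Polynomial.aeval (q.change K p.1.1 p.2.1.1 p.2.2) (q.num p.2.1.2.1 p.2.1.2.2) -
    q.changeDeriv K p.1.1 p.1.2 p.2.1.1 p.2.2 * p.1.1 *
      Polynomial.aeval (q.change K p.1.1 p.2.1.1 p.2.2) (q.den p.2.1.2.2)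

/-- `X₁` is an independent argument and `K` is bounded, so no unbounded differentiation occurs: the
defect is polynomial in its arguments and in `K w`. -/
lemma contDiff_defect (K : Wiener r 𝕜 →L[𝕜] Wiener r 𝕜) : ContDiff 𝕜 ω (q.defect K) := by
  unfold defect
  simp only [aeval_num, aeval_den]
  unfold change changeDeriv lowPoly lowPolyDeriv
  fun_prop

end Equation

end NormalForm

/-! ### The linearized equation. -/

namespace NormalForm

section Linearization


variable (q : NormalForm) {r : {r : ℝ // 0 < r}} {𝕜 : Type*} [RCLike 𝕜]

lemma derivative_aeval (p : Polynomial 𝕜) {a a' : Wiener r 𝕜}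
    (ha : PowerSeries.derivative _ (toPS a) = toPS a') :
    PowerSeries.derivative _ (toPS (Polynomial.aeval a p)) =
      toPS (Polynomial.aeval a (Polynomial.derivative p) * a') := by
  rw [← Polynomial.aeval_algHom_apply, Derivation.map_aeval, ha, smul_eq_mul, map_mul,
    Polynomial.aeval_algHom_apply]

lemma derivative_var : PowerSeries.derivative _ (toPS (var : Wiener r 𝕜)) =
    toPS (1 : Wiener r 𝕜) := by
  rw [toPS_var, PowerSeries.derivative_X, map_one]

variable {m₀ : 𝕜} {X₀ X₁ : Wiener r 𝕜}

/-- The derivative of the relation X₀ D = N. It is what cancels the terms in `K w` of the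
linearization, that is, the variations along the flow of X₀. -/
lemma derivative_relation
    (h₀ : X₀ * Polynomial.aeval var (q.den m₀) = Polynomial.aeval var (q.num 0 m₀))
    (h₁ : PowerSeries.derivative _ (toPS X₀) = toPS X₁) :
    X₁ * Polynomial.aeval var (q.den m₀) +
        X₀ * Polynomial.aeval var (Polynomial.derivative (q.den m₀)) =
      Polynomial.aeval var (Polynomial.derivative (q.num 0 m₀)) := by
  have h := congrArg (fun a => PowerSeries.derivative _ (toPS a)) h₀
  simp only [map_mul, Derivation.leibniz, smul_eq_mul, h₁, derivative_aeval _ derivative_var,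
    mul_one] at h
  rw [← map_mul, ← map_mul, ← map_add] at h
  have h2 := toPS_injective h
  rw [← h2]; ring

lemma aeval_derivative_num (m : 𝕜) :
    Polynomial.aeval var (Polynomial.derivative (q.num 0 m)) =
      (((q.k : 𝕜) + 1) • var ^ q.k * (1 - ((q.α : 𝕜) * m) • var ^ q.k) -
        var ^ (q.k + 1) * (((q.α : 𝕜) * m) • (q.k : 𝕜) • var ^ (q.k - 1)) -
        ((q.β : 𝕜) * m) • (2 * (q.k : 𝕜) + 1) • var ^ (2 * q.k) : Wiener r 𝕜) := by
  simp [num, Algebra.smul_def, Polynomial.derivative_X_pow, map_ofNat]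
  ring

lemma aeval_derivative_den (m : 𝕜) :
    Polynomial.aeval var (Polynomial.derivative (q.den m)) =
      (((q.γ : 𝕜) * m) • (q.k : 𝕜) • var ^ (q.k - 1) : Wiener r 𝕜) := by
  simp [den, Algebra.smul_def, Polynomial.derivative_X_pow]

/-- The variation of the normal form in the direction `(y, m)`. -/
noncomputable def variation (m₀ : 𝕜) (X₀ : Wiener r 𝕜) (y : Fin q.k → 𝕜) (m : 𝕜) : Wiener r 𝕜 :=
  lowPoly y * (1 - ((q.α : 𝕜) * m₀) • var ^ q.k) -
    var ^ (q.k + 1) * (((q.α : 𝕜) * m) • var ^ q.k) - ((q.β : 𝕜) * m) • var ^ (2 * q.k + 1) -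
    X₀ * (((q.γ : 𝕜) * m) • var ^ q.k)

/-- The differential is computed along the affine line through the base point, where the coordinate
is x + tΔ and its derivative is replaced by 1 + tΔ'. -/
lemma fderiv_defect (K : Wiener r 𝕜 →L[𝕜] Wiener r 𝕜)
    (b : Fin (q.k + 1) → 𝕜) (y : Fin q.k → 𝕜) (m : 𝕜) (w : Wiener r 𝕜) :
    fderiv 𝕜 (q.defect K) ((X₀, X₁), ((0, (0, m₀)), 0)) ((0, 0), ((b, (y, m)), w)) =
      Polynomial.aeval var (Polynomial.derivative (q.num 0 m₀)) * (lowPoly b + X₀ * K w)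
        - (lowPolyDeriv b + X₁ * K w + X₀ * w) * X₀ * Polynomial.aeval var (q.den m₀)
        - X₀ * Polynomial.aeval var (Polynomial.derivative (q.den m₀)) * (lowPoly b + X₀ * K w)
        + q.variation m₀ X₀ y m := by
  have hd : HasFDerivAt (q.defect K) (fderiv 𝕜 (q.defect K) ((X₀, X₁), ((0, (0, m₀)), 0)))
      ((X₀, X₁), ((0, (0, m₀)), 0)) :=
    ((q.contDiff_defect K).differentiable (by simp) _).hasFDerivAt
  have hline : HasDerivAt (fun t : 𝕜 => (((X₀, X₁), ((0, (0, m₀)), 0)) +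
      t • ((0, 0), ((b, (y, m)), w)) :
        (Wiener r 𝕜 × Wiener r 𝕜) × (q.Unknown 𝕜 × Wiener r 𝕜)))
      ((0, 0), ((b, (y, m)), w)) 0 := by
    simpa using ((hasDerivAt_id (0 : 𝕜)).smul_const
      (((0, 0), ((b, (y, m)), w)) : (Wiener r 𝕜 × Wiener r 𝕜) × (q.Unknown 𝕜 × Wiener r 𝕜))
        ).const_add ((X₀, X₁), ((0, (0, m₀)), 0))
  have h1 := HasFDerivAt.comp_hasDerivAt (0 : 𝕜) (by simpa using hd) hline
  refine h1.unique ?_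
  set Δ := (lowPoly b + X₀ * K w : Wiener r 𝕜) with hΔ
  set Δ' := (lowPolyDeriv b + X₁ * K w + X₀ * w : Wiener r 𝕜) with hΔ'
  have hφ : HasDerivAt (fun t : 𝕜 => (var : Wiener r 𝕜) + t • Δ) Δ 0 := by
    simpa using ((hasDerivAt_id (0 : 𝕜)).smul_const Δ).const_add (var : Wiener r 𝕜)
  have hψ : HasDerivAt (fun t : 𝕜 => (1 : Wiener r 𝕜) + t • Δ') Δ' 0 := by
    simpa using ((hasDerivAt_id (0 : 𝕜)).smul_const Δ').const_add (1 : Wiener r 𝕜)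
  have hm : ∀ c : ℝ, HasDerivAt (fun t : 𝕜 => (c : 𝕜) * (m₀ + t * m)) ((c : 𝕜) * m) 0 :=
    fun c => by
      simpa using (((hasDerivAt_id (0 : 𝕜)).mul_const m).const_add m₀).const_mul (c : 𝕜)
  have hy : HasDerivAt (fun t : 𝕜 => ∑ j, (t * y j) • ((var : Wiener r 𝕜) + t • Δ) ^ (j : ℕ))
      (lowPoly y) 0 := by
    have : ∀ j : Fin q.k, HasDerivAt
        (fun t : 𝕜 => (t * y j) • ((var : Wiener r 𝕜) + t • Δ) ^ (j : ℕ)) (y j • var ^ (j : ℕ)) 0 :=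
      fun j => by
        simpa using ((hasDerivAt_id' (0 : 𝕜)).mul_const (y j)).fun_smul (hφ.fun_pow j)
    exact HasDerivAt.fun_sum fun j _ => this j
  have hN := (((hφ.fun_pow (q.k + 1)).add hy).mul
    (((hm q.α).smul (hφ.fun_pow q.k)).const_sub 1)).sub
      ((hm q.β).smul (hφ.fun_pow (2 * q.k + 1)))
  have hD := ((hm q.γ).smul (hφ.fun_pow q.k)).const_add (algebraMap 𝕜 (Wiener r 𝕜) q.δ)
  have h2 := hN.sub ((hψ.mul_const X₀).mul hD)
  have hlow : ∀ t : 𝕜, (lowPoly (t • b) : Wiener r 𝕜) = t • lowPoly b := fun t => by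
    simp [lowPoly, Finset.smul_sum, smul_smul]
  have hlow' : ∀ t : 𝕜, (lowPolyDeriv (t • b) : Wiener r 𝕜) = t • lowPolyDeriv b := fun t => by
    simp [lowPolyDeriv, Finset.smul_sum, smul_smul, mul_assoc]
  convert h2 using 1
  · funext t
    have e1 : q.change K X₀ (t • b) (t • w) = var + t • Δ := by
      rw [change, hlow, map_smul, hΔ, smul_add, mul_smul_comm, add_assoc]
    have e2 : q.changeDeriv K X₀ X₁ (t • b) (t • w) = 1 + t • Δ' := by
      rw [changeDeriv, hlow', map_smul, hΔ', smul_add, smul_add, mul_smul_comm, mul_smul_comm,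
        add_assoc, add_assoc, add_assoc]
    simp only [defect, Function.comp_apply, Prod.smul_mk, Prod.mk_add_mk, smul_zero, add_zero,
      zero_add, e1, e2, aeval_num, aeval_den, Pi.sub_apply, Pi.mul_apply, Pi.add_apply,
      Pi.smul_apply, smul_eq_mul, Pi.smul_apply']
  · rw [aeval_derivative_num, aeval_derivative_den, aeval_den, variation]
    have h2 : algebraMap 𝕜 (Wiener r 𝕜) 2 = 2 := map_ofNat _ 2
    simp [Algebra.smul_def, h2]
    ring

end Linearization

end NormalForm

/-! ### Invertibility of the linearization. -/

namespace NormalForm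

section Bijectivity

variable (q : NormalForm) {r : {r : ℝ // 0 < r}} {𝕜 : Type*} [RCLike 𝕜]

/-- The radius `r` is small with respect to `m`: the factors of the normal form other than the
power of `x` are invertible on the disc of radius `r`. -/
structure IsSmallRadius (r : {r : ℝ // 0 < r}) (m : 𝕜) : Prop where
  num_lt : ‖((q.α + q.β : ℝ) : 𝕜) * m‖ * (r : ℝ) ^ q.k < 1
  den_lt : ‖(q.γ : 𝕜) * m‖ * (r : ℝ) ^ q.k < ‖(q.δ : 𝕜)‖

variable {m₀ : 𝕜} {X₀ X₁ : Wiener r 𝕜}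

/-- The second factor of the numerator of the normal form at the parameter `y = 0`. -/
noncomputable def numUnit (m : 𝕜) : Wiener r 𝕜 := 1 - (((q.α + q.β : ℝ) : 𝕜) * m) • var ^ q.k

lemma isUnit_numUnit (h : q.IsSmallRadius r m₀) : IsUnit (q.numUnit m₀ : Wiener r 𝕜) := by
  have := isUnit_add_smul_var_pow (r := r) (c := (1 : 𝕜)) (d := -(((q.α + q.β : ℝ) : 𝕜) * m₀))
    (n := q.k) (by simpa using h.num_lt)
  rwa [map_one, neg_smul, ← sub_eq_add_neg] at this

lemma isUnit_den (h : q.IsSmallRadius r m₀) :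
    IsUnit (Polynomial.aeval var (q.den m₀) : Wiener r 𝕜) := by
  rw [aeval_den]
  exact isUnit_add_smul_var_pow h.den_lt

lemma aeval_num_zero (m : 𝕜) :
    (Polynomial.aeval var (q.num 0 m) : Wiener r 𝕜) = var ^ (q.k + 1) * q.numUnit m := by
  rw [aeval_num, numUnit]
  simp [Algebra.smul_def]
  ring

lemma aeval_derivative_num' (m : 𝕜) :
    (Polynomial.aeval var (Polynomial.derivative (q.num 0 m)) : Wiener r 𝕜) =
      var ^ q.k * (algebraMap 𝕜 _ ((q.k : 𝕜) + 1) -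
        ((2 * (q.k : 𝕜) + 1) * (((q.α + q.β : ℝ) : 𝕜) * m)) • var ^ q.k) := by
  have h2 : algebraMap 𝕜 (Wiener r 𝕜) 2 = 2 := map_ofNat _ 2
  have hk : (var : Wiener r 𝕜) * var ^ (q.k - 1) = var ^ q.k := by
    rw [← pow_succ', Nat.sub_add_cancel q.one_le_k]
  rw [aeval_derivative_num]
  simp only [Algebra.smul_def, map_mul, map_add, map_natCast, map_one, h2]
  linear_combination (-var ^ q.k * (algebraMap 𝕜 (Wiener r 𝕜) q.α) *
    (algebraMap 𝕜 (Wiener r 𝕜) m) * (q.k : Wiener r 𝕜)) * hk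

lemma var_mul_aeval_derivative_den (m : 𝕜) :
    (var * Polynomial.aeval var (Polynomial.derivative (q.den m)) : Wiener r 𝕜) =
      ((q.k : 𝕜) * ((q.γ : 𝕜) * m)) • var ^ q.k := by
  have hk : (var : Wiener r 𝕜) * var ^ (q.k - 1) = var ^ q.k := by
    rw [← pow_succ', Nat.sub_add_cancel q.one_le_k]
  rw [aeval_derivative_den]
  simp only [Algebra.smul_def, map_mul]
  linear_combination (algebraMap 𝕜 (Wiener r 𝕜) q.γ * algebraMap 𝕜 (Wiener r 𝕜) m *
    algebraMap 𝕜 (Wiener r 𝕜) q.k) * hk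

/-- The linearized equation, up to the term in `w`. -/
noncomputable def jetPart (m₀ : 𝕜) (p : q.Unknown 𝕜) : Wiener r 𝕜 :=
  (q.δ : 𝕜) • lowPoly p.2.1 +
  var ^ q.k * ((((q.k : 𝕜) + 1) * (q.δ : 𝕜)) • lowPoly p.1 -
      (q.δ : 𝕜) • lowPoly (fun j => ((j : ℕ) : 𝕜) * p.1 j) +
      ((q.γ : 𝕜) * m₀ - (q.α : 𝕜) * m₀ * q.δ) • lowPoly p.2.1) +
  var ^ (2 * q.k) * (((q.γ : 𝕜) * m₀ -
        (2 * (q.k : 𝕜) + 1) * (((q.α + q.β : ℝ) : 𝕜) * m₀) * q.δ) • lowPoly p.1 -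
      ((q.γ : 𝕜) * m₀ - ((q.α + q.β : ℝ) : 𝕜) * m₀ * q.δ) •
        lowPoly (fun j => ((j : ℕ) : 𝕜) * p.1 j) -
      ((q.γ : 𝕜) * m₀ * ((q.α : 𝕜) * m₀)) • lowPoly p.2.1) +
  var ^ (3 * q.k) * ((((q.α + q.β : ℝ) : 𝕜) * m₀ * ((q.γ : 𝕜) * m₀)) •
    (lowPoly (fun j => ((j : ℕ) : 𝕜) * p.1 j) - ((q.k : 𝕜) + 1) • lowPoly p.1)) -
  (p.2.2 * (((q.α + q.β) * q.δ + q.γ : ℝ) : 𝕜)) • var ^ (2 * q.k + 1)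

/-- The right-hand side does not involve `K`. Hence the same linear algebra serves for existence
(`K` the primitive) and for uniqueness (`K = 0`). -/
lemma den_mul_fderiv_defect (K : Wiener r 𝕜 →L[𝕜] Wiener r 𝕜)
    (h₀ : X₀ * Polynomial.aeval var (q.den m₀) = Polynomial.aeval var (q.num 0 m₀))
    (h₁ : PowerSeries.derivative _ (toPS X₀) = toPS X₁) (p : q.Unknown 𝕜) (w : Wiener r 𝕜) :
    Polynomial.aeval var (q.den m₀) *
      fderiv 𝕜 (q.defect K) ((X₀, X₁), ((0, (0, m₀)), 0)) ((0, 0), (p, w)) =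
    q.jetPart m₀ p - var ^ (2 * q.k + 2) * (q.numUnit m₀ ^ 2 * w) := by
  obtain ⟨b, y, m⟩ := p
  rw [fderiv_defect]
  have hrel := q.derivative_relation h₀ h₁
  have hD := q.var_mul_aeval_derivative_den (r := r) m₀
  have hN' := q.aeval_derivative_num' (r := r) m₀
  have hf := var_mul_lowPolyDeriv (r := r) b
  have hDe := q.aeval_den (var : Wiener r 𝕜) m₀
  rw [aeval_num_zero] at h₀
  set D := (Polynomial.aeval var (q.den m₀) : Wiener r 𝕜)
  set D' := (Polynomial.aeval var (Polynomial.derivative (q.den m₀)) : Wiener r 𝕜)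
  set N' := (Polynomial.aeval var (Polynomial.derivative (q.num 0 m₀)) : Wiener r 𝕜)
  set f := (lowPoly b : Wiener r 𝕜)
  set f' := (lowPolyDeriv b : Wiener r 𝕜)
  set θ := (lowPoly (fun j => ((j : ℕ) : 𝕜) * b j) : Wiener r 𝕜)
  set Y := (lowPoly y : Wiener r 𝕜)
  set U := (q.numUnit m₀ : Wiener r 𝕜) with hU
  have h2 : algebraMap 𝕜 (Wiener r 𝕜) 2 = 2 := map_ofNat _ 2
  -- All terms in `K w` add up to X₀ D (K w) (N' - X₁ D - X₀ D'), which is zero by `hrel`.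
  have e1 : D * (N' * (f + X₀ * K w) - (f' + X₁ * K w + X₀ * w) * X₀ * D -
      X₀ * D' * (f + X₀ * K w) + q.variation m₀ X₀ y m) =
      D * N' * f - var ^ (q.k + 1) * U * D' * f - var ^ (q.k + 1) * U * D * f'
        - (var ^ (q.k + 1) * U) ^ 2 * w +
        (D * (Y * (1 - ((q.α : 𝕜) * m₀) • var ^ q.k) -
    var ^ (q.k + 1) * (((q.α : 𝕜) * m) • var ^ q.k) - ((q.β : 𝕜) * m) • var ^ (2 * q.k + 1)) -
    var ^ (q.k + 1) * U * (((q.γ : 𝕜) * m) • var ^ q.k)) := by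
    rw [variation, ← h₀]
    linear_combination (-X₀ * D * K w) * hrel
  rw [e1, jetPart]
  -- One factor x is borrowed from x^(k+1), because x D' and x f' have simple closed forms.
  have e2 : var ^ (q.k + 1) * U * D' * f = var ^ q.k * U * f *
      (((q.k : 𝕜) * ((q.γ : 𝕜) * m₀)) • var ^ q.k) := by
    rw [← hD]; ring
  have e3 : var ^ (q.k + 1) * U * D * f' = var ^ q.k * U * D * θ := by
    rw [← hf]; ring
  rw [e2, e3, hN', hDe, hU, numUnit]
  simp only [Algebra.smul_def, map_mul, map_add, map_sub, map_natCast, map_one, h2]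
  ring

/-- The system is triangular: degrees below k determine y, degrees k to 2k determine b, and degree
2k+1 determines m through the transversality constant. -/
lemma eq_zero_of_coeff_jetPart {p : q.Unknown 𝕜}
    (h : ∀ i < 2 * q.k + 2, coeff i (q.jetPart m₀ p : Wiener r 𝕜) = 0) : p = 0 := by
  obtain ⟨b, y, m⟩ := p
  have hk := q.one_le_k
  have hδ : (q.δ : 𝕜) ≠ 0 := by exact_mod_cast q.δ_ne_zero
  have hy : y = 0 := by
    funext i
    have := h i (by omega)
    have h1 : ¬ q.k ≤ (i : ℕ) := by omega
    have h2 : ¬ 2 * q.k ≤ (i : ℕ) := by omega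
    have h3 : ¬ 3 * q.k ≤ (i : ℕ) := by omega
    have h4 : (i : ℕ) ≠ 2 * q.k + 1 := by omega
    simp only [jetPart, map_add, map_sub, map_smul, coeff_var_pow_mul, coeff_var_pow, h1, h2, h3,
      h4, if_false, coeff_lowPoly, i.2, dif_pos, smul_eq_mul, mul_zero, add_zero, sub_zero,
      mul_eq_zero] at this
    exact this.resolve_left hδ
  subst hy
  have hb : ∀ i < q.k, ∀ hi : i < q.k + 1, b ⟨i, hi⟩ = 0 := by
    intro i hik hi
    have := h (q.k + i) (by omega)
    have h1 : q.k ≤ q.k + i := by omega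
    have h2 : ¬ 2 * q.k ≤ q.k + i := by omega
    have h3 : ¬ 3 * q.k ≤ q.k + i := by omega
    have h4 : q.k + i ≠ 2 * q.k + 1 := by omega
    simp only [jetPart, map_add, map_sub, map_smul, coeff_var_pow_mul, coeff_var_pow, h1, h2, h3,
      h4, if_false, if_true, coeff_lowPoly, hi, dif_pos, smul_eq_mul, mul_zero, add_zero, sub_zero,
      lowPoly_zero, smul_zero, zero_add, Nat.add_sub_cancel_left] at this
    -- The factor k+1-i comes from the bracket of x^i with x^(k+1); it does not vanish for i ≤ k.
    have e : (q.δ : 𝕜) * ((q.k : 𝕜) + 1 - (i : 𝕜)) * b ⟨i, hi⟩ = 0 := by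
      linear_combination this
    have hne : ((q.k : 𝕜) + 1 - (i : 𝕜)) ≠ 0 := by
      rw [sub_ne_zero]
      exact_mod_cast (by omega : q.k + 1 ≠ i)
    simpa [hδ, hne] using e
  have hbk : b = 0 := by
    funext j
    rcases Nat.lt_succ_iff_lt_or_eq.1 j.2 with hj | hj
    · exact hb j hj j.2
    · have := h (q.k + q.k) (by omega)
      have h1 : q.k ≤ q.k + q.k := by omega
      have h2 : 2 * q.k ≤ q.k + q.k := by omega
      have h3 : ¬ 3 * q.k ≤ q.k + q.k := by omega
      have h4 : q.k + q.k ≠ 2 * q.k + 1 := by omega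
      have h5 : q.k + q.k - 2 * q.k = 0 := by omega
      have h6 : q.k < q.k + 1 := by omega
      -- In degree 2k the block x^(2k) also contributes, through its constant term, a multiple of
      -- b_0; this is already known to be zero.
      have h0 : b ⟨0, Nat.succ_pos _⟩ = 0 := hb 0 (by omega) _
      simp only [jetPart, map_add, map_sub, map_smul, coeff_var_pow_mul, coeff_var_pow, h1, h2, h3,
        h4, h5, h6, if_false, if_true, coeff_lowPoly, dif_pos, smul_eq_mul, mul_zero, add_zero,
        sub_zero, lowPoly_zero, smul_zero, zero_add, Nat.add_sub_cancel_left,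
        Nat.succ_pos, h0] at this
      have e : (q.δ : 𝕜) * b ⟨q.k, h6⟩ = 0 := by
        linear_combination this
      have ej : j = ⟨q.k, h6⟩ := Fin.ext hj
      rw [ej]
      simpa [hδ] using e
  subst hbk
  have hm : m = 0 := by
    have := h (2 * q.k + 1) (by omega)
    have hz : (lowPoly (fun j : Fin (q.k + 1) => ((j : ℕ) : 𝕜) * (0 : Fin (q.k + 1) → 𝕜) j) :
        Wiener r 𝕜) = 0 := by
      rw [← lowPoly_zero (n := q.k + 1)]
      congr 1
      funext j
      simp
    simp only [jetPart, hz, lowPoly_zero, smul_zero, sub_zero, add_zero, mul_zero, zero_sub,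
      map_neg, map_smul, coeff_var_pow, if_true, smul_eq_mul, mul_one, neg_eq_zero,
      mul_eq_zero] at this
    refine this.resolve_right ?_
    exact_mod_cast q.transversal
  subst hm
  rfl

/-- The Taylor coefficients of degree at most 2k+1 see only the scalar unknowns. The remainder is
divisible by x^(2k+2) and is absorbed by w, whose coefficient is a unit. -/
lemma bijective_fderiv_defect (K : Wiener r 𝕜 →L[𝕜] Wiener r 𝕜) (hr : q.IsSmallRadius r m₀)
    (h₀ : X₀ * Polynomial.aeval var (q.den m₀) = Polynomial.aeval var (q.num 0 m₀))
    (h₁ : PowerSeries.derivative _ (toPS X₀) = toPS X₁) :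
    Function.Bijective (fderiv 𝕜 (q.defect K) ((X₀, X₁), ((0, (0, m₀)), 0)) ∘L
      ContinuousLinearMap.inr 𝕜 (Wiener r 𝕜 × Wiener r 𝕜) (q.Unknown 𝕜 × Wiener r 𝕜)) := by
  set L := fderiv 𝕜 (q.defect K) ((X₀, X₁), ((0, (0, m₀)), 0)) ∘L
      ContinuousLinearMap.inr 𝕜 (Wiener r 𝕜 × Wiener r 𝕜) (q.Unknown 𝕜 × Wiener r 𝕜) with hL
  set D := (Polynomial.aeval var (q.den m₀) : Wiener r 𝕜) with hD
  have key : ∀ p w, D * L (p, w) =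
      q.jetPart m₀ p - var ^ (2 * q.k + 2) * (q.numUnit m₀ ^ 2 * w) :=
    fun p w => q.den_mul_fderiv_defect K h₀ h₁ p w
  have hDu : IsUnit D := q.isUnit_den hr
  have hU : IsUnit (q.numUnit m₀ ^ 2 : Wiener r 𝕜) := (q.isUnit_numUnit hr).pow 2
  have hjet : ∀ p w, ∀ i < 2 * q.k + 2, coeff i (D * L (p, w)) =
      coeff i (q.jetPart m₀ p : Wiener r 𝕜) := by
    intro p w i hi
    rw [key, map_sub, coeff_var_pow_mul, if_neg (by omega), sub_zero]
  constructor
  · rw [injective_iff_map_eq_zero]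
    rintro ⟨p, w⟩ h
    have hp : p = 0 := q.eq_zero_of_coeff_jetPart (r := r) (m₀ := m₀) fun i hi => by
      rw [← hjet p w i hi, h, mul_zero, map_zero]
    subst hp
    have hz : (q.jetPart m₀ 0 : Wiener r 𝕜) = 0 := by
      have := key 0 0
      rw [show ((0 : q.Unknown 𝕜), (0 : Wiener r 𝕜)) = 0 from rfl, map_zero] at this
      simpa using this.symm
    have h1 := key 0 w
    rw [h, hz, mul_zero, zero_sub, eq_comm, neg_eq_zero] at h1
    have h2 : q.numUnit m₀ ^ 2 * w = 0 :=
      var_pow_mul_left_cancel (n := 2 * q.k + 2) (by rw [h1, mul_zero])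
    rw [hU.mul_right_eq_zero] at h2
    rw [h2]
    rfl
  · intro g
    let τ : q.Unknown 𝕜 →ₗ[𝕜] (Fin (2 * q.k + 2) → 𝕜) :=
      LinearMap.pi fun i => (coeff i : Wiener r 𝕜 →ₗ[𝕜] 𝕜) ∘ₗ LinearMap.mulLeft 𝕜 D ∘ₗ
        L.toLinearMap ∘ₗ LinearMap.inl 𝕜 _ _
    have hτ : ∀ p i, τ p i = coeff (i : ℕ) (D * L (p, 0)) := fun p i => rfl
    have hinj : Function.Injective τ := by
      rw [injective_iff_map_eq_zero]
      intro p hp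
      refine q.eq_zero_of_coeff_jetPart (r := r) (m₀ := m₀) fun i hi => ?_
      rw [← hjet p 0 i hi, ← hτ p ⟨i, hi⟩, hp]
      rfl
    -- The (k+1) + k + 1 scalars in b, y, m match the 2k+2 coefficients, so injectivity suffices.
    have hsurj : Function.Surjective τ := by
      refine (LinearMap.injective_iff_surjective_of_finrank_eq_finrank ?_).1 hinj
      simp only [Module.finrank_prod, Module.finrank_fintype_fun_eq_card, Fintype.card_fin,
        Module.finrank_self]
      omega
    obtain ⟨p, hp⟩ := hsurj fun i => coeff (i : ℕ) (D * g)
    obtain ⟨s, hs⟩ := exists_eq_var_pow_mul (n := 2 * q.k + 2) (a := D * g - D * L (p, 0))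
      fun i hi => by
        rw [map_sub, ← hτ p ⟨i, hi⟩, hp, sub_self]
    obtain ⟨v, hv⟩ := hU.exists_right_inv
    refine ⟨(p, -(v * s)), hDu.mul_left_cancel ?_⟩
    have h1 := key p 0
    have h2 := key p (-(v * s))
    linear_combination h2 - h1 - hs + var ^ (2 * q.k + 2) * s * hv

end Bijectivity

end NormalForm

/-! ### Solving the equation and dividing by implicit functions. -/

/-- The analytic implicit function theorem, with the local uniqueness of the solution. -/
lemma exists_implicitFunction {𝕜 V U W : Type*} [RCLike 𝕜] [NormedAddCommGroup V]
    [NormedSpace 𝕜 V] [CompleteSpace V] [NormedAddCommGroup U] [NormedSpace 𝕜 U] [CompleteSpace U]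
    [NormedAddCommGroup W] [NormedSpace 𝕜 W] [CompleteSpace W] {G : V × U → W} {v₀ : V} {u₀ : U}
    (hG : ContDiffAt 𝕜 ω G (v₀, u₀)) (h0 : G (v₀, u₀) = 0)
    (hb : Function.Bijective (fderiv 𝕜 G (v₀, u₀) ∘L ContinuousLinearMap.inr 𝕜 V U)) :
    ∃ g : V → U, AnalyticAt 𝕜 g v₀ ∧ g v₀ = u₀ ∧ (∀ᶠ v in 𝓝 v₀, G (v, g v) = 0) ∧
      ∀ᶠ p in 𝓝 (v₀, u₀), G p = 0 → g p.1 = p.2 := by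
  have hinv : (fderiv 𝕜 G (v₀, u₀) ∘L ContinuousLinearMap.inr 𝕜 V U).IsInvertible :=
    ⟨ContinuousLinearEquiv.ofBijective _ (LinearMap.ker_eq_bot.2 hb.1)
      (LinearMap.range_eq_top.2 hb.2), by ext; rfl⟩
  have hω : (ω : ℕ∞ω) ≠ 0 := by simp
  refine ⟨hG.implicitFunction hω hinv, (hG.contDiffAt_implicitFunction hω hinv).analyticAt,
    hG.implicitFunction_apply_self hω hinv, ?_, ?_⟩
  · filter_upwards [hG.eventually_apply_implicitFunction hω hinv] with v hv
    rw [hv, h0]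
  · filter_upwards [hG.eventually_apply_eq_iff_implicitFunction hω hinv] with p hp h
    exact hp.1 (by rw [h, h0])

namespace NormalForm

section Implicit

variable (q : NormalForm) {r : {r : ℝ // 0 < r}} {𝕜 : Type*} [RCLike 𝕜]
variable {m₀ : 𝕜} {X₀ X₁ : Wiener r 𝕜}

lemma exists_solution (K : Wiener r 𝕜 →L[𝕜] Wiener r 𝕜) (hr : q.IsSmallRadius r m₀)
    (h₀ : X₀ * Polynomial.aeval var (q.den m₀) = Polynomial.aeval var (q.num 0 m₀))
    (h₁ : PowerSeries.derivative _ (toPS X₀) = toPS X₁) :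
    ∃ g : Wiener r 𝕜 × Wiener r 𝕜 → q.Unknown 𝕜 × Wiener r 𝕜, AnalyticAt 𝕜 g (X₀, X₁) ∧
      g (X₀, X₁) = ((0, (0, m₀)), 0) ∧ (∀ᶠ v in 𝓝 (X₀, X₁), q.defect K (v, g v) = 0) ∧
      ∀ᶠ p in 𝓝 ((X₀, X₁), ((0, (0, m₀)), 0)), q.defect K p = 0 → g p.1 = p.2 := by
  refine exists_implicitFunction (q.contDiff_defect K).contDiffAt ?_
    (q.bijective_fderiv_defect K hr h₀ h₁)
  simp only [defect, change, changeDeriv, lowPoly_zero, lowPolyDeriv_zero, map_zero, mul_zero,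
    add_zero, one_mul]
  rw [← h₀, sub_self]

lemma exists_unit (hr : q.IsSmallRadius r m₀)
    (h₀ : X₀ * Polynomial.aeval var (q.den m₀) = Polynomial.aeval var (q.num 0 m₀)) :
    ∃ u : Wiener r 𝕜, IsUnit u ∧ X₀ = var ^ (q.k + 1) * u := by
  obtain ⟨v, hv⟩ := (q.isUnit_den hr).exists_right_inv
  refine ⟨q.numUnit m₀ * v, (q.isUnit_numUnit hr).mul (IsUnit.of_mul_eq_one_right _ hv), ?_⟩
  rw [aeval_num_zero] at h₀
  linear_combination v * h₀ - X₀ * hv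

/-- Division by a deformation of `X₀`, with a remainder of degree at most `k`. -/
lemma exists_division (hr : q.IsSmallRadius r m₀)
    (h₀ : X₀ * Polynomial.aeval var (q.den m₀) = Polynomial.aeval var (q.num 0 m₀)) :
    ∃ d : Wiener r 𝕜 × Wiener r 𝕜 → (Fin (q.k + 1) → 𝕜) × Wiener r 𝕜,
      ContinuousAt d (0, X₀) ∧ d (0, X₀) = 0 ∧
      ∀ᶠ v in 𝓝 (0, X₀), lowPoly (d v).1 + v.2 * (d v).2 = v.1 := by
  obtain ⟨u, hu, hX⟩ := q.exists_unit hr h₀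
  -- The implicit function theorem yields a division depending continuously on the divisor. At X₀ =
  -- x^(k+1) u its linearization is division by x^(k+1), up to the unit u.
  let G : (Wiener r 𝕜 × Wiener r 𝕜) × ((Fin (q.k + 1) → 𝕜) × Wiener r 𝕜) → Wiener r 𝕜 :=
    fun p => lowPoly p.2.1 + p.1.2 * p.2.2 - p.1.1
  have hG : ContDiff 𝕜 ω G := by
    unfold G lowPoly
    fun_prop
  have hlow : ∀ (t : 𝕜) (b : Fin (q.k + 1) → 𝕜),
      (lowPoly (t • b) : Wiener r 𝕜) = t • lowPoly b := fun t b => by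
    simp [lowPoly, Finset.smul_sum, smul_smul]
  have hlow0 : (lowPoly (0 : Fin (q.k + 1) → 𝕜) : Wiener r 𝕜) = 0 := lowPoly_zero
  have hd : ∀ b w, (fderiv 𝕜 G ((0, X₀), 0) ∘L
      ContinuousLinearMap.inr 𝕜 (Wiener r 𝕜 × Wiener r 𝕜) ((Fin (q.k + 1) → 𝕜) × Wiener r 𝕜))
        (b, w) = lowPoly b + X₀ * w := by
    intro b w
    have h1 : HasFDerivAt G (fderiv 𝕜 G ((0, X₀), 0)) ((0, X₀), 0) :=
      (hG.differentiable (by simp) _).hasFDerivAt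
    have hline : HasDerivAt (fun t : 𝕜 => (((0, X₀), 0) + t • (0, (b, w)) :
        (Wiener r 𝕜 × Wiener r 𝕜) × ((Fin (q.k + 1) → 𝕜) × Wiener r 𝕜))) (0, (b, w)) 0 := by
      simpa using ((hasDerivAt_id (0 : 𝕜)).smul_const ((0, (b, w)) :
        (Wiener r 𝕜 × Wiener r 𝕜) × ((Fin (q.k + 1) → 𝕜) × Wiener r 𝕜))).const_add ((0, X₀), 0)
    have h2 := HasFDerivAt.comp_hasDerivAt (0 : 𝕜) (by simpa using h1) hline
    have h3 : ∀ a : Wiener r 𝕜, HasDerivAt (fun t : 𝕜 => t • a) a 0 := fun a => by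
      simpa using (hasDerivAt_id (0 : 𝕜)).smul_const a
    have e : (G ∘ fun t : 𝕜 => (((0, X₀), 0) + t • (0, (b, w)) :
        (Wiener r 𝕜 × Wiener r 𝕜) × ((Fin (q.k + 1) → 𝕜) × Wiener r 𝕜))) =
        fun t => t • (lowPoly b + X₀ * w) := by
      funext t
      simp [G, hlow]
    rw [e] at h2
    exact h2.unique (h3 _)
  obtain ⟨g, hg, hg0, hg1, -⟩ := exists_implicitFunction (G := G) (v₀ := (0, X₀)) (u₀ := 0)
    hG.contDiffAt (by simp [G, hlow0]) (by
      constructor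
      · rw [injective_iff_map_eq_zero]
        rintro ⟨b, w⟩ h
        rw [hd, hX, mul_assoc] at h
        have hb : b = 0 := by
          funext i
          have := congrArg (coeff (i : ℕ)) h
          rw [map_add, coeff_var_pow_mul, if_neg (by omega), coeff_lowPoly, dif_pos i.2,
            map_zero, add_zero] at this
          exact this
        subst hb
        rw [hlow0, zero_add] at h
        have h2 : u * w = 0 := var_pow_mul_left_cancel (n := q.k + 1) (by rw [h, mul_zero])
        rw [hu.mul_right_eq_zero] at h2
        rw [h2]
        rfl
      · intro a
        obtain ⟨s, hs⟩ := exists_eq_var_pow_mul (n := q.k + 1)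
          (a := a - lowPoly fun j : Fin (q.k + 1) => coeff (j : ℕ) a) fun i hi => by
            rw [map_sub, coeff_lowPoly, dif_pos hi, sub_self]
        obtain ⟨v, hv⟩ := hu.exists_right_inv
        refine ⟨(fun j => coeff (j : ℕ) a, v * s), ?_⟩
        rw [hd, hX]
        linear_combination (var ^ (q.k + 1) * s) * hv - hs)
  refine ⟨g, hg.continuousAt, hg0, ?_⟩
  filter_upwards [hg1] with v hv
  exact sub_eq_zero.1 hv

end Implicit

end NormalForm

/-- In a product, points near the origin in the second variable have nearby first variables. -/
lemma eventually_eventually_of_prod {E : Type*} [NormedAddCommGroup E] {P : ℂ × E → Prop}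
    (h : ∀ᶠ p in 𝓝 0, P p) : ∀ᶠ l : E in 𝓝 0, ∀ᶠ x : ℂ in 𝓝 0, P (x, l) := by
  have h1 : ∀ᶠ p : E × ℂ in 𝓝 0 ×ˢ 𝓝 0, P (p.2, p.1) := by
    have h2 : Tendsto (fun p : E × ℂ => (p.2, p.1)) (𝓝 0 ×ˢ 𝓝 0) (𝓝 (0 : ℂ × E)) := by
      rw [Prod.zero_eq_mk, nhds_prod_eq]
      exact tendsto_snd.prodMk tendsto_fst
    exact h2.eventually h
  exact h1.curry

lemma eventually_norm_lt {E : Type*} [NormedAddCommGroup E] (r : {r : ℝ // 0 < r}) :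
    ∀ᶠ p : ℂ × E in 𝓝 0, ‖p.1‖ < r := by
  have hn : ∀ᶠ p : ℂ × E in 𝓝 0, p.1 ∈ Metric.ball (0 : ℂ) r :=
    continuousAt_fst.eventually (Metric.ball_mem_nhds _ r.2)
  filter_upwards [hn] with p hp
  simpa using hp

/-! ### Passage between real and complex series. -/

namespace Wiener

variable {r s : {r : ℝ // 0 < r}}

lemma eval_aeval {x : ℂ} (hx : ‖x‖ ≤ r) (a : Wiener r ℂ) (p : Polynomial ℂ) :
    eval x (Polynomial.aeval a p) = p.eval (eval x a) := by
  rw [← evalHom_apply x hx, ← Polynomial.aeval_algHom_apply, Polynomial.coe_aeval_eq_eval,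
    evalHom_apply]

lemma eval_mul {x : ℂ} (hx : ‖x‖ ≤ r) (a b : Wiener r ℂ) :
    eval x (a * b) = eval x a * eval x b := by
  rw [← evalHom_apply x hx, map_mul]
  rfl

lemma eval_ofRealL_rePart {x : ℂ} (hx : ‖x‖ ≤ r) (a : Wiener r ℂ) :
    eval x (ofRealL (rePart a)) = (eval x a + conj (eval (conj x) a)) / 2 := by
  have hx' : ‖conj x‖ ≤ r := by rwa [RCLike.norm_conj]
  have h2 : Summable fun n => conj (coeff n a * conj x ^ n) :=
    Complex.summable_conj.2 (summable_norm_term hx' a).of_norm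
  rw [eval, eval, eval, Complex.conj_tsum, ← (summable_norm_term hx a).of_norm.tsum_add h2,
    ← tsum_div_const]
  refine tsum_congr fun n => ?_
  rw [coeff_ofRealL, coeff_rePart, Complex.re_eq_add_conj, map_mul, map_pow, Complex.conj_conj]
  ring

lemma ofRealHom_rePart_of_eval {a : Wiener r ℂ}
    (h : ∀ᶠ x in 𝓝 0, eval (conj x) a = conj (eval x a)) : ofRealHom (rePart a) = a := by
  refine eq_of_eventuallyEq ?_
  filter_upwards [h, Metric.closedBall_mem_nhds (0 : ℂ) r.2] with x hx hxr
  rw [ofRealHom_apply, eval_ofRealL_rePart (by simpa using hxr), hx, Complex.conj_conj]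
  ring

lemma ofRealHom_smul (c : ℝ) (a : Wiener r ℝ) : ofRealHom (c • a) = (c : ℂ) • ofRealHom a := by
  ext n
  simp [ofRealHom_apply]

lemma ofRealHom_algebraMap (c : ℝ) :
    ofRealHom (algebraMap ℝ (Wiener r ℝ) c) = algebraMap ℂ (Wiener r ℂ) c := by
  rw [Algebra.algebraMap_eq_smul_one, ofRealHom_smul, map_one, ← Algebra.algebraMap_eq_smul_one]

lemma ofRealHom_var : ofRealHom (var : Wiener r ℝ) = var := by
  refine toPS_injective ?_
  rw [ofRealHom_apply, toPS_ofRealL, toPS_var, toPS_var, PowerSeries.map_X]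

lemma ofRealHom_injective : Function.Injective (ofRealHom : Wiener r ℝ → Wiener r ℂ) := by
  intro a b h
  ext n
  have := congrArg (coeff n) h
  rw [ofRealHom_apply, ofRealHom_apply, coeff_ofRealL, coeff_ofRealL] at this
  exact_mod_cast this

lemma derivative_rePart {a : Wiener r ℂ} {b : Wiener s ℂ}
    (h : PowerSeries.derivative _ (toPS a) = toPS b) :
    PowerSeries.derivative _ (toPS (rePart a)) = toPS (rePart b) := by
  ext n
  rw [PowerSeries.coeff_derivative, coeff_toPS, coeff_toPS, coeff_rePart, coeff_rePart,
    ← coeff_toPS n b, ← h, PowerSeries.coeff_derivative, coeff_toPS]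
  simp

lemma derivative_ofRealL {a : Wiener r ℝ} {b : Wiener s ℝ}
    (h : PowerSeries.derivative _ (toPS a) = toPS b) :
    PowerSeries.derivative _ (toPS (ofRealL a)) = toPS (ofRealL b) := by
  ext n
  rw [PowerSeries.coeff_derivative, coeff_toPS, coeff_toPS, coeff_ofRealL, coeff_ofRealL,
    ← coeff_toPS n b, ← h, PowerSeries.coeff_derivative, coeff_toPS]
  simp

end Wiener

namespace NormalForm

variable (q : NormalForm)

lemma ofRealHom_aeval_num {r : {r : ℝ // 0 < r}} (a : Wiener r ℝ) (y : Fin q.k → ℝ) (m : ℝ) :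
    ofRealHom (Polynomial.aeval a (q.num y m)) =
      Polynomial.aeval (ofRealHom a) (q.num (fun j => (y j : ℂ)) (m : ℂ)) := by
  simp [aeval_num, ofRealHom_smul]

lemma ofRealHom_aeval_den {r : {r : ℝ // 0 < r}} (a : Wiener r ℝ) (m : ℝ) :
    ofRealHom (Polynomial.aeval a (q.den m)) =
      Polynomial.aeval (ofRealHom a) (q.den (m : ℂ)) := by
  simp [aeval_den, ofRealHom_smul, ofRealHom_algebraMap]

/-- The function `(P_y (1 - α m x^k) - β m x^(2k+1)) / (δ + γ m x^k)`. -/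
noncomputable def fn (y : Fin q.k → ℂ) (m x : ℂ) : ℂ := (q.num y m).eval x / (q.den m).eval x

lemma eval_den (m x : ℂ) : (q.den m).eval x = q.δ + q.γ * m * x ^ q.k := by
  simp [den]

lemma eval_num (y : Fin q.k → ℂ) (m x : ℂ) : (q.num y m).eval x =
    (x ^ (q.k + 1) + ∑ j : Fin q.k, y j * x ^ (j : ℕ)) * (1 - q.α * m * x ^ q.k) -
      q.β * m * x ^ (2 * q.k + 1) := by
  simp [num, Polynomial.eval_finsetSum]

lemma eval_den_ne_zero {ι : Type*} {l : Filter ι} {m x : ι → ℂ} {m₀ : ℂ}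
    (hm : Tendsto m l (𝓝 m₀)) (hx : Tendsto x l (𝓝 0)) : ∀ᶠ i in l, (q.den (m i)).eval (x i) ≠ 0 := by
  have h : Tendsto (fun i => (q.den (m i)).eval (x i)) l (𝓝 (q.δ + q.γ * m₀ * 0 ^ q.k)) := by
    simp only [eval_den]
    exact tendsto_const_nhds.add ((tendsto_const_nhds.mul hm).mul (hx.pow _))
  refine h.eventually_ne ?_
  rw [zero_pow (Nat.one_le_iff_ne_zero.1 q.one_le_k), mul_zero, add_zero]
  exact_mod_cast q.δ_ne_zero

lemma exists_isSmallRadius (m : ℂ) : ∃ R > 0, ∀ r : {r : ℝ // 0 < r}, (r : ℝ) < R →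
    q.IsSmallRadius r m := by
  have h : ∀ c d : ℝ, 0 < d → ∀ᶠ r : ℝ in 𝓝 0, c * r ^ q.k < d := fun c d hd => by
    have h1 : Tendsto (fun r : ℝ => c * r ^ q.k) (𝓝 0) (𝓝 (c * 0 ^ q.k)) :=
      (tendsto_id.pow q.k).const_mul c
    rw [zero_pow (Nat.one_le_iff_ne_zero.1 q.one_le_k), mul_zero] at h1
    exact h1.eventually_lt_const hd
  obtain ⟨R, hR, hR'⟩ := Metric.eventually_nhds_iff.1
    ((h ‖((q.α + q.β : ℝ) : ℂ) * m‖ 1 one_pos).and (h ‖(q.γ : ℂ) * m‖ ‖(q.δ : ℂ)‖ (by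
      rw [norm_pos_iff]; exact_mod_cast q.δ_ne_zero)))
  refine ⟨R, hR, fun r hr => ?_⟩
  have := hR' (y := (r : ℝ)) (by
    rw [Real.dist_0_eq_abs, abs_of_pos r.2]; exact hr)
  exact ⟨by simpa using this.1, by simpa using this.2⟩

lemma isSmallRadius_ofReal {r : {r : ℝ // 0 < r}} {m : ℝ} (h : q.IsSmallRadius r (m : ℂ)) :
    q.IsSmallRadius r m := by
  refine ⟨?_, ?_⟩
  · have := h.num_lt
    rw [norm_mul] at this ⊢
    simpa [← Complex.ofReal_add] using this
  · have := h.den_lt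
    rw [norm_mul] at this ⊢
    simpa using this

end NormalForm

/-! ### Existence of the equivalence. -/

namespace NormalForm

variable (q : NormalForm) {E : Type*} [NormedAddCommGroup E] [NormedSpace ℝ E]

/-- The linear relation between a field and the normal form, in the algebra of series. -/
lemma mul_den_eq_num {r : {r : ℝ // 0 < r}} {m₀ : ℂ} {X₀ : Wiener r ℂ}
    (h : ∀ᶠ x in 𝓝 0, eval x X₀ = q.fn 0 m₀ x) :
    X₀ * Polynomial.aeval var (q.den m₀) = Polynomial.aeval var (q.num 0 m₀) := by
  refine eq_of_eventuallyEq ?_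
  filter_upwards [h, Metric.closedBall_mem_nhds (0 : ℂ) r.2,
    q.eval_den_ne_zero (m := fun _ : ℂ => m₀) tendsto_const_nhds tendsto_id] with x hx hxr hD
  have hxr' : ‖x‖ ≤ r := by simpa using hxr
  rw [eval_mul hxr', eval_aeval hxr', eval_aeval hxr', eval_var, hx, fn]
  exact div_mul_cancel₀ _ hD

/-- A real deformation of the normal form at `y = 0` is equivalent to a deformation which is
induced from the normal form. -/
theorem exists_equivalence {m₀ : ℝ} {Y : ℂ → E → ℂ} (hY : IsAnalyticFamily Y)
    (hreal : ∀ᶠ p : ℂ × E in 𝓝 0, Y (conj p.1) p.2 = conj (Y p.1 p.2))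
    (h0 : ∀ᶠ x in 𝓝 0, Y x 0 = q.fn 0 m₀ x) :
    ∃ (y : E → Fin q.k → ℝ) (m : E → ℝ) (φ : ℂ → E → ℂ), AnalyticAt ℝ y 0 ∧ AnalyticAt ℝ m 0 ∧
      y 0 = 0 ∧ m 0 = m₀ ∧ CommutesWithConj φ ∧
      IsEquivalence φ Y fun x l => q.fn (fun j => (y l j : ℂ)) (m l) x := by
  obtain ⟨R₁, hR₁, hF⟩ := hY.exists_wiener
  obtain ⟨R₂, hR₂, hsmall⟩ := q.exists_isSmallRadius (m₀ : ℂ)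
  -- The family is expanded on the disc of radius s, so that both the field and its derivative are
  -- available on the smaller disc of radius r.
  obtain ⟨s, hs0, hsR⟩ := exists_between (lt_min hR₁ hR₂)
  obtain ⟨r, hr0, hrs⟩ := exists_between hs0
  lift r to {r : ℝ // 0 < r} using hr0
  lift s to {r : ℝ // 0 < r} using hs0
  replace hrs : r < s := hrs
  obtain ⟨F, hFa, hFY⟩ := hF s (hsR.trans_le (min_le_left _ _))
  have hr : q.IsSmallRadius r m₀ := q.isSmallRadius_ofReal
    (hsmall r (lt_trans hrs (hsR.trans_le (min_le_right _ _))))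
  have hFr : ∀ᶠ l in 𝓝 0, ofRealHom (rePart (F l)) = F l := by
    filter_upwards [hFY, eventually_eventually_of_prod hreal] with l h1 h2
    refine ofRealHom_rePart_of_eval ?_
    filter_upwards [h2, Metric.ball_mem_nhds (0 : ℂ) s.2] with x hx hxs
    have hxs' : ‖x‖ < s := by simpa using hxs
    rw [h1 x hxs', h1 (conj x) (by rwa [RCLike.norm_conj]), hx]
  let G : E → Wiener r ℝ := fun l => rePart (restrict hrs (F l))
  let G₁ : E → Wiener r ℝ := fun l => rePart (derivative hrs (F l))
  have hGG₁ : ∀ l, PowerSeries.derivative _ (toPS (G l)) = toPS (G₁ l) := fun l =>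
    derivative_rePart (by rw [toPS_restrict, toPS_derivative])
  have hG : AnalyticAt ℝ G 0 :=
    (rePart.comp ((restrict hrs).restrictScalars ℝ)).analyticAt (F 0) |>.fun_comp hFa
  have hG₁ : AnalyticAt ℝ G₁ 0 :=
    (rePart.comp ((derivative hrs).restrictScalars ℝ)).analyticAt (F 0) |>.fun_comp hFa
  have hGY : ∀ᶠ l in 𝓝 0, ∀ x : ℂ, ‖x‖ < r → eval x (ofRealHom (G l)) = Y x l := by
    filter_upwards [hFY, hFr] with l h1 h2 x hx
    have e : ofRealHom (G l) = restrict hrs (F l) := by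
      refine ofRealHom_rePart fun n => ?_
      have h3 := congrArg (fun a => (coeff n a).im) h2
      simp only [ofRealHom_apply, coeff_ofRealL, Complex.ofReal_im] at h3
      rw [← coeff_toPS, toPS_restrict, coeff_toPS, ← h3]
    rw [e, eval_restrict, h1 x (lt_trans hx hrs)]
  have hX₀ : G 0 * Polynomial.aeval var (q.den m₀) = Polynomial.aeval var (q.num 0 m₀) := by
    apply ofRealHom_injective
    rw [map_mul, ofRealHom_aeval_den, ofRealHom_aeval_num, ofRealHom_var]
    have hz : (fun j : Fin q.k => (((0 : Fin q.k → ℝ) j : ℝ) : ℂ)) = 0 := by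
      funext j; simp
    rw [hz]
    refine q.mul_den_eq_num ?_
    filter_upwards [h0, Metric.ball_mem_nhds (0 : ℂ) r.2] with x hx hxr
    rw [hGY.self_of_nhds x (by simpa using hxr), hx]
  -- The equation is solved over ℝ, so that the coordinate has real coefficients. With the primitive
  -- as `K`, `changeDeriv` is the true derivative of `change`.
  obtain ⟨g, hga, hg0, hgs, -⟩ := q.exists_solution primitive hr hX₀ (hGG₁ 0)
  let u : E → q.Unknown ℝ × Wiener r ℝ := fun l => g (G l, G₁ l)
  have hu : AnalyticAt ℝ u 0 :=
    AnalyticAt.fun_comp (g := g) (f := fun l => (G l, G₁ l)) hga (hG.prod hG₁)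
  have hu0 : u 0 = ((0, (0, m₀)), 0) := hg0
  have hus : ∀ᶠ l in 𝓝 0, q.defect primitive ((G l, G₁ l), u l) = 0 :=
    (hG.continuousAt.prodMk hG₁.continuousAt).eventually hgs
  have hu1 : AnalyticAt ℝ (fun l => (u l).1) 0 := analyticAt_fst.fun_comp hu
  have hu2 : AnalyticAt ℝ (fun l => (u l).2) 0 := analyticAt_snd.fun_comp hu
  have hu11 : AnalyticAt ℝ (fun l => (u l).1.1) 0 := analyticAt_fst.fun_comp hu1
  have hu12 : AnalyticAt ℝ (fun l => (u l).1.2) 0 := analyticAt_snd.fun_comp hu1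
  let Φ : E → Wiener r ℝ := fun l => q.change primitive (G l) (u l).1.1 (u l).2
  let Φ₁ : E → Wiener r ℝ := fun l => q.changeDeriv primitive (G l) (G₁ l) (u l).1.1 (u l).2
  have hΦ : AnalyticAt ℝ Φ 0 := by
    have h2 : AnalyticAt ℝ (fun l => primitive (u l).2) 0 :=
      (primitive.analyticAt (u 0).2).fun_comp (f := fun l => (u l).2) hu2
    have h3 : AnalyticAt ℝ (fun l => (lowPoly (u l).1.1 : Wiener r ℝ)) 0 := by
      unfold lowPoly
      refine Finset.analyticAt_fun_sum _ fun j _ => ?_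
      have h4 : AnalyticAt ℝ (fun l => (u l).1.1 j) 0 :=
        ((ContinuousLinearMap.proj (R := ℝ) (φ := fun _ : Fin (q.k + 1) => ℝ) j).analyticAt
          (u 0).1.1).fun_comp (f := fun l => (u l).1.1) hu11
      exact h4.smul analyticAt_const
    exact (analyticAt_const.add h3).add (hG.mul h2)
  have hΦ₁ : ∀ l, PowerSeries.derivative _ (toPS (Φ l)) = toPS (Φ₁ l) := by
    intro l
    simp only [Φ, Φ₁, change, changeDeriv, map_add, map_mul, Derivation.leibniz, smul_eq_mul,
      derivative_primitive, derivative_lowPoly, derivative_var, hGG₁]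
    ring
  have hΦ0 : Φ 0 = var := by
    simp [Φ, hu0, change]
  let φ : ℂ → E → ℂ := fun x l => eval x (ofRealHom (Φ l))
  have hφ : IsAnalyticFamily φ :=
    isAnalyticFamily_eval ((ofRealL.analyticAt (Φ 0)).fun_comp hΦ)
  have hφ0 : ∀ x, φ x 0 = x := fun x => by
    simp only [φ, hΦ0, ofRealHom_var, eval_var]
  refine ⟨fun l => (u l).1.2.1, fun l => (u l).1.2.2, φ, analyticAt_fst.fun_comp hu12,
    analyticAt_snd.fun_comp hu12, by simp [hu0],
    by simp [hu0], ?_, ⟨⟨hφ, hφ0 0, ?_, ?_⟩, Eventually.of_forall hφ0⟩⟩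
  · exact Eventually.of_forall fun p => eval_conj_ofRealL _ _
  · have : (fun x => φ x 0) = fun x => x := funext hφ0
    rw [this, deriv_id'']
    exact one_ne_zero
  · have hm : Tendsto (fun p : ℂ × E => (((u p.2).1.2.2 : ℝ) : ℂ)) (𝓝 0) (𝓝 m₀) := by
      have h1 : ContinuousAt (fun l => (((u l).1.2.2 : ℝ) : ℂ)) 0 := by
        have := hu.continuousAt
        fun_prop
      have h2 : Tendsto (fun l => (((u l).1.2.2 : ℝ) : ℂ)) (𝓝 0) (𝓝 m₀) := by
        simpa [ContinuousAt, hu0] using h1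
      exact h2.comp continuousAt_snd
    have hφt : Tendsto (fun p : ℂ × E => φ p.1 p.2) (𝓝 0) (𝓝 0) := by
      have := hφ.analyticAt.continuousAt.tendsto
      simpa [hφ0] using this
    have hsnd : ∀ {P : E → Prop}, (∀ᶠ l in 𝓝 0, P l) → ∀ᶠ p : ℂ × E in 𝓝 0, P p.2 := fun h =>
      (continuousAt_snd (p := (0 : ℂ × E))).eventually h
    filter_upwards [q.eval_den_ne_zero hm hφt, eventually_norm_lt r, hsnd hus, hsnd hGY]
      with p hD hp hdef hpY
    have e1 : deriv (fun x => φ x p.2) p.1 = eval p.1 (ofRealHom (Φ₁ p.2)) :=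
      (hasDerivAt_eval le_rfl (derivative_ofRealL (hΦ₁ p.2)) hp).deriv
    have e2 := congrArg (fun a => eval p.1 (ofRealHom a)) (sub_eq_zero.1 hdef)
    simp only [map_mul, ofRealHom_aeval_num, ofRealHom_aeval_den, eval_mul hp.le,
      eval_aeval hp.le, hpY p.1 hp] at e2
    rw [e1, fn, div_eq_iff hD]
    exact e2

end NormalForm

/-! ### Uniqueness of the parameters. -/

lemma exists_aeval_add {𝕜 A : Type*} [Field 𝕜] [CommRing A] [Algebra 𝕜 A] (p : Polynomial 𝕜)
    (a b : A) : ∃ c, Polynomial.aeval (a + b) p =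
      Polynomial.aeval a p + Polynomial.aeval a (Polynomial.derivative p) * b + c * b ^ 2 := by
  obtain ⟨c, hc⟩ := (p.map (algebraMap 𝕜 A)).binomExpansion a b
  refine ⟨c, ?_⟩
  rwa [Polynomial.derivative_map, Polynomial.eval_map_algebraMap, Polynomial.eval_map_algebraMap,
    Polynomial.eval_map_algebraMap] at hc

/-- If `φ` conjugates `X` to `N / D`, then a polynomial change of coordinate congruent to `φ`
modulo `X` conjugates `X` to `N / D` modulo `X ^ 2`. -/
lemma exists_sq_mul_eq {𝕜 A : Type*} [Field 𝕜] [CommRing A] [Algebra 𝕜 A] (N D : Polynomial 𝕜)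
    {φ φ₁ φ₂ X X₁ g g₁ : A} (hu : IsUnit φ₁)
    (h₁ : Polynomial.aeval φ N = φ₁ * X * Polynomial.aeval φ D)
    (h₂ : Polynomial.aeval φ (Polynomial.derivative N) * φ₁ = φ₂ * X * Polynomial.aeval φ D +
      φ₁ * X₁ * Polynomial.aeval φ D +
      φ₁ * X * (Polynomial.aeval φ (Polynomial.derivative D) * φ₁)) :
    ∃ c, Polynomial.aeval (φ - X * g) N -
      (φ₁ - X₁ * g - X * g₁) * X * Polynomial.aeval (φ - X * g) D = X ^ 2 * c := by
  obtain ⟨v, hv⟩ := hu.exists_right_inv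
  obtain ⟨n, hn⟩ := exists_aeval_add N φ (-(X * g))
  obtain ⟨d, hd⟩ := exists_aeval_add D φ (-(X * g))
  rw [← sub_eq_add_neg] at hn hd
  rw [hn, hd]
  set N₀ := Polynomial.aeval φ N
  set N' := Polynomial.aeval φ (Polynomial.derivative N)
  set D₀ := Polynomial.aeval φ D
  set D' := Polynomial.aeval φ (Polynomial.derivative D)
  refine ⟨-g * v * (φ₂ * D₀ + φ₁ ^ 2 * D') + n * g ^ 2 + g₁ * D₀ +
    (φ₁ - X₁ * g - X * g₁) * (D' * g - d * X * g ^ 2), ?_⟩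
  -- The differentiated equation, divided by the unit φ₁, gives N' ≡ X₁ D₀ modulo X. Hence the terms
  -- of first order in X g cancel modulo X².
  have e : N' = X₁ * D₀ + X * v * (φ₂ * D₀ + φ₁ ^ 2 * D') := by
    linear_combination v * h₂ + (-N' + X₁ * D₀) * hv
  rw [e, h₁]
  ring

lemma eventually_isUnit {ι A : Type*} [NormedRing A] [CompleteSpace A] {l : Filter ι}
    {f : ι → A} {a : A} (h : Tendsto f l (𝓝 a)) (ha : IsUnit a) : ∀ᶠ i in l, IsUnit (f i) :=
  h.eventually (Units.isOpen.mem_nhds ha)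

namespace NormalForm

section Uniqueness

variable (q : NormalForm) {𝕜 : Type*} [RCLike 𝕜] {r s : {r : ℝ // 0 < r}} {ι : Type*}

lemma tendsto_aeval_num {l : Filter ι} {a : ι → Wiener r 𝕜} {y : ι → Fin q.k → 𝕜} {m : ι → 𝕜}
    {a₀ : Wiener r 𝕜} {y₀ : Fin q.k → 𝕜} {m₀ : 𝕜} (ha : Tendsto a l (𝓝 a₀))
    (hy : Tendsto y l (𝓝 y₀)) (hm : Tendsto m l (𝓝 m₀)) :
    Tendsto (fun i => Polynomial.aeval (a i) (q.num (y i) (m i))) l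
      (𝓝 (Polynomial.aeval a₀ (q.num y₀ m₀))) := by
  simp only [aeval_num]
  refine (((ha.pow _).add (tendsto_finsetSum _ fun j _ =>
    (((continuous_apply j).tendsto _).comp hy).smul (ha.pow _))).mul
      (tendsto_const_nhds.sub ((hm.const_mul _).smul (ha.pow _)))).sub
        ((hm.const_mul _).smul (ha.pow _))

lemma tendsto_aeval_den {l : Filter ι} {a : ι → Wiener r 𝕜} {m : ι → 𝕜}
    {a₀ : Wiener r 𝕜} {m₀ : 𝕜} (ha : Tendsto a l (𝓝 a₀)) (hm : Tendsto m l (𝓝 m₀)) :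
    Tendsto (fun i => Polynomial.aeval (a i) (q.den (m i))) l
      (𝓝 (Polynomial.aeval a₀ (q.den m₀))) := by
  simp only [aeval_den]
  exact tendsto_const_nhds.add ((hm.const_mul _).smul (ha.pow _))

/-- Multiplication by X₀² D is x^(2k+2) times a unit, hence bounded below. This later forces the
quotient w to tend to 0. -/
lemma exists_norm_le {m₀ : 𝕜} {X₀ : Wiener r 𝕜} (hr : q.IsSmallRadius r m₀)
    (h₀ : X₀ * Polynomial.aeval var (q.den m₀) = Polynomial.aeval var (q.num 0 m₀)) :
    ∃ C > 0, ∀ a : Wiener r 𝕜, ‖a‖ ≤ C * ‖X₀ ^ 2 * Polynomial.aeval var (q.den m₀) * a‖ := by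
  obtain ⟨u, hu, hX⟩ := q.exists_unit hr h₀
  obtain ⟨v, hv⟩ := ((hu.pow 2).mul (q.isUnit_den hr)).exists_right_inv
  set D := (Polynomial.aeval var (q.den m₀) : Wiener r 𝕜)
  have hpos : 0 < (r : ℝ) ^ (2 * q.k + 2) := pow_pos r.2 _
  have hv0 : 0 < ‖v‖ := by
    rw [norm_pos_iff]
    rintro rfl
    have h := congrArg norm hv
    rw [mul_zero, norm_zero, norm_one] at h
    exact zero_ne_one h
  refine ⟨‖v‖ * ((r : ℝ) ^ (2 * q.k + 2))⁻¹, mul_pos hv0 (inv_pos.2 hpos), fun a => ?_⟩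
  have e : X₀ ^ 2 * D * a = var ^ (2 * q.k + 2) * (u ^ 2 * D * a) := by rw [hX]; ring
  rw [e, norm_var_pow_mul, mul_assoc, inv_mul_cancel_left₀ hpos.ne']
  calc ‖a‖ = ‖v * (u ^ 2 * D * a)‖ := by
        congr 1
        linear_combination (-a) * hv
    _ ≤ _ := norm_mul_le _ _

/-- A change of coordinate close to the identity which conjugates a vector field to the normal
form provides a solution of the equation without primitive. -/
lemma exists_tendsto_defect_eq_zero {l : Filter ι} [l.NeBot] (h : r < s) {m₀ : 𝕜}
    {X₀ : Wiener s 𝕜}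
    (hr : q.IsSmallRadius r m₀) (hs : q.IsSmallRadius s m₀)
    (h₀ : X₀ * Polynomial.aeval var (q.den m₀) = Polynomial.aeval var (q.num 0 m₀))
    {X φ : ι → Wiener s 𝕜} {y : ι → Fin q.k → 𝕜} {m : ι → 𝕜} (hX : Tendsto X l (𝓝 X₀))
    (hφ : Tendsto φ l (𝓝 var)) (hy : Tendsto y l (𝓝 0)) (hm : Tendsto m l (𝓝 m₀))
    (heq : ∀ᶠ i in l, toPS (Polynomial.aeval (φ i) (q.num (y i) (m i))) =
      PowerSeries.derivative _ (toPS (φ i)) * toPS (X i) *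
        toPS (Polynomial.aeval (φ i) (q.den (m i)))) :
    ∃ (b : ι → Fin (q.k + 1) → 𝕜) (w : ι → Wiener r 𝕜), Tendsto b l (𝓝 0) ∧ Tendsto w l (𝓝 0) ∧
      ∀ᶠ i in l, q.defect 0 ((restrict h (X i), derivative h (X i)), ((b i, (y i, m i)), w i))
        = 0 := by
  obtain ⟨d, hdc, hd0, hd⟩ := q.exists_division hs h₀
  -- An intermediate radius, because the second derivative of φ is needed on the disc of radius r.
  obtain ⟨t', hrt, hts⟩ := exists_between (show (r : ℝ) < s from h)
  obtain ⟨t, rfl⟩ : ∃ t : {r : ℝ // 0 < r}, (t : ℝ) = t' := ⟨⟨t', r.2.trans hrt⟩, rfl⟩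
  replace hrt : r < t := hrt
  replace hts : t < s := hts
  have hpair : Tendsto (fun i => (φ i - var, X i)) l (𝓝 (0, X₀)) := by
    have := hφ.sub_const var
    rw [sub_self] at this
    exact this.prodMk_nhds hX
  have hdt : Tendsto (fun i => d (φ i - var, X i)) l (𝓝 0) := by
    have := hdc.tendsto.comp hpair
    rwa [hd0] at this
  let b : ι → Fin (q.k + 1) → 𝕜 := fun i => (d (φ i - var, X i)).1
  let g : ι → Wiener s 𝕜 := fun i => (d (φ i - var, X i)).2
  have hb : Tendsto b l (𝓝 0) := (continuous_fst.tendsto _).comp hdt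
  let ψ : ι → Wiener r 𝕜 := fun i => var + lowPoly (b i)
  let ψ' : ι → Wiener r 𝕜 := fun i => 1 + lowPolyDeriv (b i)
  have hψ : Tendsto ψ l (𝓝 var) := by
    have h1 : Continuous fun b : Fin (q.k + 1) → 𝕜 => (var + lowPoly b : Wiener r 𝕜) := by
      unfold lowPoly; fun_prop
    have h2 := (h1.tendsto 0).comp hb
    rwa [lowPoly_zero, add_zero] at h2
  have hψ' : Tendsto ψ' l (𝓝 1) := by
    have h1 : Continuous fun b : Fin (q.k + 1) → 𝕜 => (1 + lowPolyDeriv b : Wiener r 𝕜) := by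
      unfold lowPolyDeriv; fun_prop
    have h2 := (h1.tendsto 0).comp hb
    rwa [lowPolyDeriv_zero, add_zero] at h2
  have hXr : Tendsto (fun i => restrict h (X i)) l (𝓝 (restrict h X₀)) :=
    ((restrict h).continuous.tendsto _).comp hX
  have h₀r : restrict h X₀ * Polynomial.aeval var (q.den m₀) =
      Polynomial.aeval var (q.num 0 m₀) := by
    refine toPS_injective ?_
    have := congrArg toPS h₀
    simpa [← Polynomial.aeval_algHom_apply] using this
  let T : ι → Wiener r 𝕜 := fun i => Polynomial.aeval (ψ i) (q.num (y i) (m i)) -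
    ψ' i * restrict h (X i) * Polynomial.aeval (ψ i) (q.den (m i))
  have hT : Tendsto T l (𝓝 0) := by
    have := (q.tendsto_aeval_num hψ hy hm).sub ((hψ'.mul hXr).mul (q.tendsto_aeval_den hψ hm))
    rwa [one_mul, h₀r, sub_self] at this
  have hDψ := q.tendsto_aeval_den hψ hm
  have hφ₁ : Tendsto (fun i => derivative h (φ i)) l (𝓝 1) := by
    have := ((derivative h).continuous.tendsto var).comp hφ
    have e : derivative h (var : Wiener s 𝕜) = 1 := by
      refine toPS_injective ?_
      rw [toPS_derivative, derivative_var, map_one, map_one]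
    rwa [e] at this
  have hw : ∀ᶠ i in l, ∃ w : Wiener r 𝕜,
      T i = restrict h (X i) ^ 2 * Polynomial.aeval (ψ i) (q.den (m i)) * w := by
    filter_upwards [heq, eventually_isUnit hφ₁ isUnit_one, eventually_isUnit hDψ (q.isUnit_den hr),
      hpair.eventually hd] with i he hu₁ huD hdi
    -- Division of φ - x by X gives φ - x = f + X g, so the truncated coordinate x + f differs from
    -- φ by a multiple of X.
    have hψi : ψ i = restrict h (φ i) - restrict h (X i) * restrict h (g i) := by
      refine toPS_injective ?_
      have h1 := congrArg toPS hdi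
      simp only [map_add, map_mul, map_sub, toPS_var] at h1
      have h2 : ∀ c : Fin (q.k + 1) → 𝕜, toPS (lowPoly c : Wiener r 𝕜) =
          toPS (lowPoly c : Wiener s 𝕜) := fun c => by simp [lowPoly]
      simp only [ψ, map_add, map_sub, map_mul, toPS_restrict, toPS_var, h2]
      linear_combination h1
    have hψi' : ψ' i = derivative h (φ i) - derivative h (X i) * restrict h (g i) -
        restrict h (X i) * derivative h (g i) := by
      refine toPS_injective ?_
      have h1 := congrArg (fun a => PowerSeries.derivative _ (toPS a)) hψi
      simp only [ψ, map_add, map_sub, map_mul, toPS_restrict, Derivation.leibniz, smul_eq_mul,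
        derivative_lowPoly, derivative_var] at h1
      simp only [ψ', map_add, map_sub, map_mul, toPS_restrict, toPS_derivative]
      linear_combination h1
    have e1 : Polynomial.aeval (restrict h (φ i)) (q.num (y i) (m i)) =
        derivative h (φ i) * restrict h (X i) *
          Polynomial.aeval (restrict h (φ i)) (q.den (m i)) := by
      refine toPS_injective ?_
      simpa [← Polynomial.aeval_algHom_apply] using he
    have hd1 : PowerSeries.derivative _ (toPS (restrict h (φ i))) = toPS (derivative h (φ i)) := by
      simp
    have hd2 : PowerSeries.derivative _ (toPS (restrict h (X i))) = toPS (derivative h (X i)) := by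
      simp
    have hd3 : PowerSeries.derivative _ (toPS (derivative h (φ i))) =
        toPS (derivative hrt (derivative hts (φ i))) := by
      simp
    have e2 := congrArg (fun a => PowerSeries.derivative _ (toPS a)) e1
    simp only [map_mul, Derivation.leibniz, smul_eq_mul, derivative_aeval _ hd1, hd2, hd3] at e2
    obtain ⟨c, hc⟩ := exists_sq_mul_eq (q.num (y i) (m i)) (q.den (m i)) (g := restrict h (g i))
      (g₁ := derivative h (g i)) hu₁ e1 (X₁ := derivative h (X i))
      (φ₂ := derivative hrt (derivative hts (φ i))) (by
        refine toPS_injective ?_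
        simp only [map_mul, map_add]
        linear_combination e2)
    rw [← hψi, ← hψi'] at hc
    obtain ⟨v, hv⟩ := huD.exists_right_inv
    refine ⟨v * c, ?_⟩
    change Polynomial.aeval (ψ i) (q.num (y i) (m i)) -
      ψ' i * restrict h (X i) * Polynomial.aeval (ψ i) (q.den (m i)) = _
    rw [hc]
    linear_combination (-restrict h (X i) ^ 2 * c) * hv
  obtain ⟨w, hw⟩ := hw.choice
  obtain ⟨C, hC, hlow⟩ := q.exists_norm_le hr h₀r
  refine ⟨b, w, hb, ?_, ?_⟩
  · have hXD : Tendsto (fun i => restrict h (X i) ^ 2 * Polynomial.aeval (ψ i) (q.den (m i))) l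
        (𝓝 (restrict h X₀ ^ 2 * Polynomial.aeval var (q.den m₀))) := (hXr.pow 2).mul hDψ
    have hnear : ∀ᶠ i in l, ‖restrict h (X i) ^ 2 * Polynomial.aeval (ψ i) (q.den (m i)) -
        restrict h X₀ ^ 2 * Polynomial.aeval var (q.den m₀)‖ < (2 * C)⁻¹ := by
      have := hXD.eventually (Metric.ball_mem_nhds _ (inv_pos.2 (mul_pos two_pos hC)))
      filter_upwards [this] with i hi
      rwa [← dist_eq_norm]
    -- From ‖w‖ ≤ C‖Z₀ w‖, T = Z w and ‖Z - Z₀‖ < 1/(2C) one gets ‖w‖ ≤ C‖T‖ + ‖w‖/2.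
    refine squeeze_zero_norm' (a := fun i => 2 * C * ‖T i‖) ?_ ?_
    · filter_upwards [hw, hnear] with i h1 h2
      have h3 := hlow (w i)
      set Z₀ := restrict h X₀ ^ 2 * Polynomial.aeval var (q.den m₀)
      set Z := restrict h (X i) ^ 2 * Polynomial.aeval (ψ i) (q.den (m i))
      have h4 : ‖Z₀ * w i‖ ≤ ‖T i‖ + (2 * C)⁻¹ * ‖w i‖ := by
        calc ‖Z₀ * w i‖ = ‖T i - (Z - Z₀) * w i‖ := by rw [h1]; congr 1; ring
          _ ≤ ‖T i‖ + ‖(Z - Z₀) * w i‖ := norm_sub_le _ _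
          _ ≤ _ := by
            gcongr
            exact (norm_mul_le _ _).trans (by gcongr)
      have h5 : C * ((2 * C)⁻¹ * ‖w i‖) = ‖w i‖ / 2 := by field_simp
      have h6 := mul_le_mul_of_nonneg_left h4 hC.le
      rw [mul_add, h5] at h6
      linarith
    · simpa using (hT.norm.const_mul (2 * C))
  · filter_upwards [hw] with i h1
    have e : T i = Polynomial.aeval (ψ i) (q.num (y i) (m i)) -
      ψ' i * restrict h (X i) * Polynomial.aeval (ψ i) (q.den (m i)) := rfl
    simp only [defect, change, changeDeriv, zero_apply, mul_zero, add_zero]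
    linear_combination h1 - e

end Uniqueness

end NormalForm

namespace NormalForm

variable (q : NormalForm) {E : Type*} [NormedAddCommGroup E] [NormedSpace ℝ E]

/-- The equation of conjugacy, as an identity of formal power series. -/
lemma eventually_formal_conjugacy {s : {r : ℝ // 0 < r}} {m₀ : ℂ} {Y φ : ℂ → E → ℂ}
    {y : E → Fin q.k → ℂ} {m : E → ℂ} (hm : Tendsto m (𝓝 0) (𝓝 m₀))
    (hφ : IsEquivalence φ Y fun x l => q.fn (y l) (m l) x) {F Φ : E → Wiener s ℂ}
    (hF : ∀ᶠ l in 𝓝 0, ∀ x, ‖x‖ < s → eval x (F l) = Y x l)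
    (hΦ : ∀ᶠ l in 𝓝 0, ∀ x, ‖x‖ < s → eval x (Φ l) = φ x l) :
    ∀ᶠ l in 𝓝 0, toPS (Polynomial.aeval (Φ l) (q.num (y l) (m l))) =
      PowerSeries.derivative _ (toPS (Φ l)) * toPS (F l) *
        toPS (Polynomial.aeval (Φ l) (q.den (m l))) := by
  obtain ⟨r', hr0, hrs⟩ := exists_between s.2
  lift r' to {r : ℝ // 0 < r} using hr0 with r
  replace hrs : r < s := hrs
  have hφt : Tendsto (fun p : ℂ × E => φ p.1 p.2) (𝓝 0) (𝓝 0) := by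
    have h := hφ.analytic.analyticAt.continuousAt.tendsto
    rwa [Prod.fst_zero, Prod.snd_zero, hφ.map_zero] at h
  have hden := eventually_eventually_of_prod
    (q.eval_den_ne_zero (hm.comp (continuousAt_snd (p := (0 : ℂ × E)))) hφt)
  filter_upwards [hF, hΦ, hden, eventually_eventually_of_prod hφ.pullback] with l h1 h2 h3 h4
  have key : Polynomial.aeval (restrict hrs (Φ l)) (q.num (y l) (m l)) =
      derivative hrs (Φ l) * restrict hrs (F l) *
        Polynomial.aeval (restrict hrs (Φ l)) (q.den (m l)) := by
    refine eq_of_eventuallyEq ?_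
    filter_upwards [h3, h4, Metric.ball_mem_nhds (0 : ℂ) r.2] with x hD hx hxr
    replace hxr : ‖x‖ < r := by simpa using hxr
    have hxs : ‖x‖ < s := hxr.trans hrs
    have hder : deriv (fun x => φ x l) x = eval x (derivative hrs (Φ l)) := by
      have e : (fun x => φ x l) =ᶠ[𝓝 x] fun x => eval x (Φ l) := by
        filter_upwards [Metric.isOpen_ball.mem_nhds (show x ∈ Metric.ball (0 : ℂ) s by simpa using hxs)]
          with z hz
        exact (h2 z (by simpa using hz)).symm
      rw [e.deriv_eq]
      exact (hasDerivAt_eval hrs.le (toPS_derivative hrs _).symm hxr).deriv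
    replace hD : (q.den (m l)).eval (φ x l) ≠ 0 := hD
    rw [hder, fn, div_eq_iff hD] at hx
    rw [eval_mul hxr.le, eval_mul hxr.le, eval_aeval hxr.le, eval_aeval hxr.le, eval_restrict,
      eval_restrict, h1 x hxs, h2 x hxs]
    exact hx
  simpa [← Polynomial.aeval_algHom_apply] using congrArg toPS key

/-- The parameters of a normal form which is equivalent to a given deformation are determined by
the deformation. -/
theorem eventually_eq_of_isEquivalence {m₀ : ℂ} {Y φ₁ φ₂ : ℂ → E → ℂ}
    {y₁ y₂ : E → Fin q.k → ℂ} {m₁ m₂ : E → ℂ} (hY : IsAnalyticFamily Y)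
    (h0 : ∀ᶠ x in 𝓝 0, Y x 0 = q.fn 0 m₀ x)
    (hy₁ : Tendsto y₁ (𝓝 0) (𝓝 0)) (hy₂ : Tendsto y₂ (𝓝 0) (𝓝 0))
    (hm₁ : Tendsto m₁ (𝓝 0) (𝓝 m₀)) (hm₂ : Tendsto m₂ (𝓝 0) (𝓝 m₀))
    (hφ₁ : IsEquivalence φ₁ Y fun x l => q.fn (y₁ l) (m₁ l) x)
    (hφ₂ : IsEquivalence φ₂ Y fun x l => q.fn (y₂ l) (m₂ l) x) :
    ∀ᶠ l in 𝓝 0, y₁ l = y₂ l ∧ m₁ l = m₂ l := by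
  obtain ⟨R, hR, hF⟩ := hY.exists_wiener
  obtain ⟨R₁, hR₁, hF₁⟩ := hφ₁.analytic.exists_wiener
  obtain ⟨R₂, hR₂, hF₂⟩ := hφ₂.analytic.exists_wiener
  obtain ⟨R₃, hR₃, hsmall⟩ := q.exists_isSmallRadius m₀
  obtain ⟨s, hs0, hsR⟩ := exists_between (lt_min (lt_min hR hR₃) (lt_min hR₁ hR₂))
  obtain ⟨⟨hsR, hsR₃⟩, hsR₁, hsR₂⟩ := by simpa only [lt_min_iff] using hsR
  obtain ⟨r, hr0, hrs⟩ := exists_between hs0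
  lift r to {r : ℝ // 0 < r} using hr0
  lift s to {r : ℝ // 0 < r} using hs0
  replace hrs : r < s := hrs
  obtain ⟨F, hFa, hFY⟩ := hF s hsR
  have hr := hsmall r (lt_trans hrs hsR₃)
  have hs := hsmall s hsR₃
  have hX₀ : F 0 * Polynomial.aeval var (q.den m₀) = Polynomial.aeval var (q.num 0 m₀) := by
    refine q.mul_den_eq_num ?_
    filter_upwards [h0, Metric.ball_mem_nhds (0 : ℂ) s.2] with x hx hxs
    rw [hFY.self_of_nhds x (by simpa using hxs), hx]
  have h₀r : restrict hrs (F 0) * Polynomial.aeval var (q.den m₀) =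
      Polynomial.aeval var (q.num 0 m₀) := by
    refine toPS_injective ?_
    simpa [← Polynomial.aeval_algHom_apply] using congrArg toPS hX₀
  -- `K = 0`, and the scalars are complex, so that equivalences which do not commute with
  -- conjugation are covered.
  obtain ⟨g, -, -, -, hg⟩ := q.exists_solution 0 hr h₀r (X₁ := derivative hrs (F 0))
    (by rw [toPS_restrict, toPS_derivative])
  -- The value of `g` depends only on the field and its derivative, so two equivalences of the same
  -- field share their parameters.
  have aux : ∀ {φ : ℂ → E → ℂ} {y : E → Fin q.k → ℂ} {m : E → ℂ} {Φ : E → Wiener s ℂ},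
      Tendsto y (𝓝 0) (𝓝 0) → Tendsto m (𝓝 0) (𝓝 m₀) →
      IsEquivalence φ Y (fun x l => q.fn (y l) (m l) x) → AnalyticAt ℝ Φ 0 →
      (∀ᶠ l in 𝓝 0, ∀ x, ‖x‖ < s → eval x (Φ l) = φ x l) →
      ∀ᶠ l in 𝓝 0, (g (restrict hrs (F l), derivative hrs (F l))).1.2 = (y l, m l) := by
    intro φ y m Φ hy hm hφ hΦa hΦ
    have hΦ0 : Φ 0 = var := by
      refine eq_of_eventuallyEq ?_
      filter_upwards [hφ.eq_id, Metric.ball_mem_nhds (0 : ℂ) s.2] with x hx hxs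
      rw [hΦ.self_of_nhds x (by simpa using hxs), hx, eval_var]
    have hΦt : Tendsto Φ (𝓝 0) (𝓝 var) := by
      rw [← hΦ0]
      exact hΦa.continuousAt
    obtain ⟨b, w, hb, hw, hbw⟩ := q.exists_tendsto_defect_eq_zero hrs hr hs hX₀
      hFa.continuousAt.tendsto hΦt hy hm (q.eventually_formal_conjugacy hm hφ hFY hΦ)
    have ht : Tendsto (fun l => ((restrict hrs (F l), derivative hrs (F l)),
        ((b l, (y l, m l)), w l))) (𝓝 0)
        (𝓝 ((restrict hrs (F 0), derivative hrs (F 0)), ((0, (0, m₀)), 0))) :=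
      ((((restrict hrs).continuous.tendsto _).comp hFa.continuousAt.tendsto).prodMk_nhds
        (((derivative hrs).continuous.tendsto _).comp hFa.continuousAt.tendsto)).prodMk_nhds
          ((hb.prodMk_nhds (hy.prodMk_nhds hm)).prodMk_nhds hw)
    filter_upwards [ht.eventually hg, hbw] with l h1 h2
    rw [h1 h2]
  obtain ⟨Φ₁, hΦ₁a, hΦ₁⟩ := hF₁ s hsR₁
  obtain ⟨Φ₂, hΦ₂a, hΦ₂⟩ := hF₂ s hsR₂
  filter_upwards [aux hy₁ hm₁ hφ₁ hΦ₁a hΦ₁, aux hy₂ hm₂ hφ₂ hΦ₂a hΦ₂] with l h1 h2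
  simpa using h1.symm.trans h2

end NormalForm

/-! ### Reduction of both symmetries to reality on the real axis. -/

lemma AxisSymmetry.sign_mul_sign (τ : AxisSymmetry) : τ.sign * τ.sign = 1 := by
  cases τ <;> simp [AxisSymmetry.sign]

lemma AxisSymmetry.conj_sign (τ : AxisSymmetry) : conj τ.sign = τ.sign := by
  cases τ <;> simp [AxisSymmetry.sign]

lemma AxisSymmetry.factor_mul_factor (τ : AxisSymmetry) : τ.factor * τ.factor = τ.sign := by
  cases τ <;> simp [AxisSymmetry.factor, AxisSymmetry.sign]

lemma AxisSymmetry.conj_factor (τ : AxisSymmetry) : conj τ.factor = τ.sign * τ.factor := by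
  cases τ <;> simp [AxisSymmetry.factor, AxisSymmetry.sign]

namespace IsAdmissible

variable {τ : AxisSymmetry} {k : ℕ} {c μ : ℂ}

lemma mul_self (h : IsAdmissible τ k c μ) : c * c = τ.sign := by
  obtain ⟨⟨ε, hε, rfl⟩, -⟩ := h
  have h1 : ε ^ (k + 1) * ε ^ (k + 1) = 1 := by
    rw [← mul_pow]
    rcases hε with rfl | rfl <;> simp
  linear_combination τ.factor_mul_factor * ε ^ (k + 1) * ε ^ (k + 1) + τ.sign * h1

lemma ne_zero (h : IsAdmissible τ k c μ) : c ≠ 0 := by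
  rintro rfl
  have h1 := h.mul_self
  have h2 := τ.sign_mul_sign
  rw [← h1] at h2
  simp at h2

lemma conj_eq (h : IsAdmissible τ k c μ) : conj c = τ.sign * c := by
  obtain ⟨⟨ε, hε, rfl⟩, -⟩ := h
  have : conj ε = ε := by rcases hε with rfl | rfl <;> simp
  rw [map_mul, map_pow, this, τ.conj_factor, mul_assoc]

lemma ofReal_re (h : IsAdmissible τ k c μ) : (((c * μ).re : ℝ) : ℂ) = c * μ :=
  Complex.ext rfl (by rw [Complex.ofReal_im, h.2])

lemma ofReal_re_mul_self (h : IsAdmissible τ k c μ) : (((c * c).re : ℝ) : ℂ) = c * c := by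
  rw [h.mul_self]
  cases τ <;> simp [AxisSymmetry.sign]

/-- After division by `c`, a vector field with the symmetry is real on the real axis. -/
lemma conj_inv_mul (h : IsAdmissible τ k c μ) {z w : ℂ} (hzw : conj z = τ.sign * w) :
    c⁻¹ * z = conj (c⁻¹ * w) := by
  have h1 : z = τ.sign * conj w := by
    rw [← Complex.conj_conj z, hzw, map_mul, τ.conj_sign]
  have h2 : τ.sign ≠ 0 := left_ne_zero_of_mul_eq_one τ.sign_mul_sign
  rw [h1, map_mul, map_inv₀, h.conj_eq]
  field_simp [h.ne_zero]
  rw [pow_two, τ.sign_mul_sign, one_mul]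

end IsAdmissible

/-- The parameter with given real coordinates `y_0, …, y_(k-1)` and `c * y_(2k+1)`. -/
noncomputable def paramOfReal (k : ℕ) (c : ℂ) : ((Fin k → ℝ) × ℝ) →L[ℝ] Param k c :=
  ((ContinuousLinearMap.fst ℝ (Fin k → ℝ) ℝ).prod
    ((c⁻¹ • Complex.ofRealCLM) ∘L ContinuousLinearMap.snd ℝ (Fin k → ℝ) ℝ)).codRestrict _ (by
      intro p
      change (c * (c⁻¹ * (p.2 : ℂ))).im = 0
      rcases eq_or_ne c 0 with rfl | hc
      · simp
      · rw [mul_inv_cancel_left₀ hc, Complex.ofReal_im])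

lemma mul_paramOfReal_snd {k : ℕ} {c : ℂ} (hc : c ≠ 0) (p : (Fin k → ℝ) × ℝ) :
    c * (paramOfReal k c p).1.2 = p.2 :=
  mul_inv_cancel_left₀ hc _

section Families

variable {E : Type*} [NormedAddCommGroup E] [NormedSpace ℝ E]

lemma IsAnalyticFamily.const_mul {f : ℂ → E → ℂ} (hf : IsAnalyticFamily f) (c : ℂ) :
    IsAnalyticFamily fun x l => c * f x l :=
  ⟨analyticAt_const.mul hf.analyticAt, hf.holomorphic.mono fun _ h => h.const_mul c⟩

lemma IsConjugacy.const_mul {φ X X' : ℂ → E → ℂ} (h : IsConjugacy φ X X') (c : ℂ) :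
    IsConjugacy φ (fun x l => c * X x l) fun x l => c * X' x l :=
  ⟨h.analytic, h.map_zero, h.invertible, h.pullback.mono fun p hp => by rw [hp]; ring⟩

lemma IsEquivalence.const_mul {φ X X' : ℂ → E → ℂ} (h : IsEquivalence φ X X') (c : ℂ) :
    IsEquivalence φ (fun x l => c * X x l) fun x l => c * X' x l :=
  ⟨h.toIsConjugacy.const_mul c, h.eq_id⟩

lemma isParameterMap_paramOfReal {k : ℕ} (c : ℂ) {y : E → Fin k → ℝ} {t : E → ℝ}
    (hy : AnalyticAt ℝ y 0) (ht : AnalyticAt ℝ t 0) (hy0 : y 0 = 0) :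
    IsParameterMap fun l => paramOfReal k c (y l, t l - t 0) :=
  ⟨((paramOfReal k c).analyticAt _).fun_comp (f := fun l => (y l, t l - t 0))
    (hy.prod (ht.sub analyticAt_const)), by rw [hy0, sub_self]; exact map_zero (paramOfReal k c)⟩

end Families

/-! ### Universality of the normal forms. -/

namespace NormalForm

variable (q : NormalForm) {E : Type*} [NormedAddCommGroup E] [NormedSpace ℝ E]

lemma isAnalyticFamily_fn {y : E → Fin q.k → ℂ} {m : E → ℂ} (hy : ∀ j, AnalyticAt ℝ (y · j) 0)
    (hm : AnalyticAt ℝ m 0) : IsAnalyticFamily fun x l => q.fn (y l) (m l) x := by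
  have hy' : ∀ j, AnalyticAt ℝ (fun p : ℂ × E => y p.2 j) 0 := fun j =>
    AnalyticAt.fun_comp (g := (y · j)) (f := Prod.snd) (hy j) analyticAt_snd
  have hm' : AnalyticAt ℝ (fun p : ℂ × E => m p.2) 0 :=
    AnalyticAt.fun_comp (g := m) (f := Prod.snd) hm analyticAt_snd
  have hx : AnalyticAt ℝ (fun p : ℂ × E => p.1) 0 := analyticAt_fst
  have hd := q.eval_den_ne_zero hm'.continuousAt.tendsto hx.continuousAt.tendsto
  constructor
  · have hd0 := hd.self_of_nhds
    simp only [fn, eval_num, eval_den] at hd0 ⊢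
    refine AnalyticAt.div ?_ ?_ hd0
    · refine (((hx.pow _).add (Finset.analyticAt_fun_sum _ fun j _ => (hy' j).mul (hx.pow _))).mul
        (analyticAt_const.sub ((analyticAt_const.mul hm').mul (hx.pow _)))).sub
          ((analyticAt_const.mul hm').mul (hx.pow _))
    · exact analyticAt_const.add ((analyticAt_const.mul hm').mul (hx.pow _))
  · filter_upwards [hd] with p hp
    exact (Polynomial.differentiableAt _).div (Polynomial.differentiableAt _) hp

lemma conj_fn {y : Fin q.k → ℂ} {m : ℂ} (hy : ∀ j, conj (y j) = y j) (hm : conj m = m) (x : ℂ) :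
    conj (q.fn y m (conj x)) = q.fn y m x := by
  simp [fn, eval_num, eval_den, hy, hm]

section Universal

variable {τ : AxisSymmetry} {c μ : ℂ} {X' : ℂ → Param q.k c → ℂ}

/-- Since t(0) = cμ, the shift by `t 0` makes the inducing map vanish at 0 while c (μ + y_(2k+1))
remains equal to t. -/
lemma induced_paramOfReal {E : Type*} [NormedAddCommGroup E] (h : IsAdmissible τ q.k c μ)
    (hX' : ∀ x y, X' x y = c * q.fn (fun j => (y.1.1 j : ℂ)) (c * (μ + y.1.2)) x)
    {y : E → Fin q.k → ℝ} {t : E → ℝ} (ht : (t 0 : ℂ) = c * μ) :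
    induced X' (fun l => paramOfReal q.k c (y l, t l - t 0)) =
      fun x l => c * q.fn (fun j => (y l j : ℂ)) (t l) x := by
  funext x l
  rw [induced, hX', mul_add, mul_paramOfReal_snd h.ne_zero, Complex.ofReal_sub, ht]
  simp [paramOfReal]

/-- The normal forms are universal deformations. -/
theorem isUniversalWithSymmetry (h : IsAdmissible τ q.k c μ)
    (hX' : ∀ x y, X' x y = c * q.fn (fun j => (y.1.1 j : ℂ)) (c * (μ + y.1.2)) x) :
    IsUniversalWithSymmetry τ X' := by
  have hX'eq : X' = fun x y => c * q.fn (fun j => (y.1.1 j : ℂ)) (c * (μ + y.1.2)) x := by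
    funext x y; exact hX' x y
  have hc := h.ne_zero
  have hX0 : ∀ x, X' x 0 = c * q.fn 0 ((c * μ).re : ℝ) x := by
    intro x
    rw [hX', h.ofReal_re]
    have h1 : (fun j => (((0 : Param q.k c).1.1 j : ℝ) : ℂ)) = 0 := by
      funext j; simp
    rw [h1]
    simp
  have hdiv : ∀ {m : ℕ} {X : ℂ → (Fin m → ℝ) → ℂ}, (∀ᶠ x : ℂ in 𝓝 0, X x 0 = X' x 0) →
      ∀ᶠ x : ℂ in 𝓝 0, c⁻¹ * X x 0 = q.fn 0 ((c * μ).re : ℝ) x := by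
    intro m X hX
    filter_upwards [hX] with x hx
    rw [hx, hX0, inv_mul_cancel_left₀ hc]
  refine ⟨?_, ?_, ?_, ?_⟩
  · rw [hX'eq]
    refine (q.isAnalyticFamily_fn (fun j => ?_) ?_).const_mul c
    · exact (Complex.ofRealCLM ∘L ContinuousLinearMap.proj j ∘L
        ContinuousLinearMap.fst ℝ (Fin q.k → ℝ) ℂ ∘L (Param q.k c).subtypeL).analyticAt 0
    · exact analyticAt_const.mul (analyticAt_const.add
        ((ContinuousLinearMap.snd ℝ (Fin q.k → ℝ) ℂ ∘L (Param q.k c).subtypeL).analyticAt 0))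
  · refine Eventually.of_forall fun p => ?_
    rw [hX', hX', map_mul, h.conj_eq, conj_fn, mul_assoc]
    · intro j; rw [Complex.conj_ofReal]
    · rw [Complex.conj_eq_iff_im, mul_add, Complex.add_im, h.2, zero_add]
      exact p.2.2
  · intro m X hX hsym h0
    obtain ⟨y, t, φ, hy, ht, hy0, ht0, hφ, he⟩ := q.exists_equivalence (hX.const_mul c⁻¹)
      (hsym.mono fun p hp => h.conj_inv_mul hp) (hdiv h0)
    refine ⟨_, φ, isParameterMap_paramOfReal c hy ht hy0, ?_, hφ⟩
    rw [q.induced_paramOfReal h hX' (by rw [ht0, h.ofReal_re])]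
    have h1 := he.const_mul c
    simp only [mul_inv_cancel_left₀ hc] at h1
    exact h1
  · intro m X hX hsym h0 ψ₁ ψ₂ φ₁ φ₂ hψ₁ hψ₂ h₁ h₂
    have hind : ∀ {φ : ℂ → (Fin m → ℝ) → ℂ} {ψ : (Fin m → ℝ) → Param q.k c},
        IsEquivalence φ X (induced X' ψ) → IsEquivalence φ (fun x l => c⁻¹ * X x l)
          fun x l => q.fn (fun j => ((ψ l).1.1 j : ℂ)) (c * (μ + (ψ l).1.2)) x := by
      intro φ ψ hφ
      have h3 := hφ.const_mul c⁻¹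
      simp only [induced, hX', inv_mul_cancel_left₀ hc] at h3
      exact h3
    have hty : ∀ {ψ : (Fin m → ℝ) → Param q.k c}, IsParameterMap ψ →
        Tendsto (fun l => fun j => ((ψ l).1.1 j : ℂ)) (𝓝 0) (𝓝 0) := by
      intro ψ hψ
      have h3 : Continuous fun z : Param q.k c => fun j => (z.1.1 j : ℂ) := by fun_prop
      have h4 := (h3.tendsto (ψ 0)).comp hψ.analyticAt.continuousAt
      rw [hψ.map_zero] at h4
      have h5 : (fun j => (((0 : Param q.k c).1.1 j : ℝ) : ℂ)) = 0 := by
        funext j; simp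
      rwa [h5] at h4
    have htm : ∀ {ψ : (Fin m → ℝ) → Param q.k c}, IsParameterMap ψ →
        Tendsto (fun l => c * (μ + (ψ l).1.2)) (𝓝 0) (𝓝 ((c * μ).re : ℝ)) := by
      intro ψ hψ
      have h3 : Continuous fun z : Param q.k c => c * (μ + z.1.2) := by fun_prop
      have h4 := (h3.tendsto (ψ 0)).comp hψ.analyticAt.continuousAt
      rw [hψ.map_zero] at h4
      rw [h.ofReal_re]
      have h5 : c * (μ + (0 : Param q.k c).1.2) = c * μ := by simp
      rwa [h5] at h4
    filter_upwards [q.eventually_eq_of_isEquivalence (hX.const_mul c⁻¹) (hdiv h0) (hty hψ₁)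
      (hty hψ₂) (htm hψ₁) (htm hψ₂) (hind h₁) (hind h₂)] with l hl
    refine Subtype.ext (Prod.ext (funext fun j => ?_) ?_)
    · exact_mod_cast congrFun hl.1 j
    · exact add_left_cancel (mul_left_cancel₀ hc hl.2)

end Universal

end NormalForm

/-! ### The three families as normal forms. -/

/-- The normal form with all nonlinear terms in the polynomial. -/
def polynomialForm (k : ℕ) (hk : 1 ≤ k) : NormalForm where
  k := k
  α := 0
  β := 1
  γ := 0
  δ := 1
  one_le_k := hk
  δ_ne_zero := one_ne_zero
  transversal := by norm_num

/-- The factored polynomial normal form. -/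
def productForm (k : ℕ) (hk : 1 ≤ k) : NormalForm where
  k := k
  α := 1
  β := 0
  γ := 0
  δ := 1
  one_le_k := hk
  δ_ne_zero := one_ne_zero
  transversal := by norm_num

/-- The rational normal form. -/
def quotientForm (k : ℕ) (hk : 1 ≤ k) (δ : ℝ) (hδ : δ ≠ 0) : NormalForm where
  k := k
  α := 0
  β := 0
  γ := 1
  δ := δ
  one_le_k := hk
  δ_ne_zero := hδ
  transversal := by norm_num

lemma X₁_eq_fn {k : ℕ} (hk : 1 ≤ k) (c μ x : ℂ) (y : Param k c) : X₁ k c μ x y =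
    c * (polynomialForm k hk).fn (fun j => (y.1.1 j : ℂ)) (c * (μ + y.1.2)) x := by
  rw [NormalForm.fn, NormalForm.eval_num, NormalForm.eval_den, X₁, unfoldingPoly]
  simp only [polynomialForm]
  norm_num
  exact Or.inl rfl

lemma X₂_eq_fn {k : ℕ} (hk : 1 ≤ k) (c μ x : ℂ) (y : Param k c) : X₂ k c μ x y =
    c * (productForm k hk).fn (fun j => (y.1.1 j : ℂ)) (c * (μ + y.1.2)) x := by
  rw [NormalForm.fn, NormalForm.eval_num, NormalForm.eval_den, X₂, unfoldingPoly]
  simp only [productForm]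
  norm_num [mul_assoc]
  exact Or.inl (Or.inl rfl)

/-- Multiplying numerator and denominator by `c` turns the constant `c` of the denominator into c²,
a real number, which is taken as δ. -/
lemma X₃_eq_fn {k : ℕ} (hk : 1 ≤ k) {c : ℂ} {δ : ℝ} (hδ : δ ≠ 0) (hc : (δ : ℂ) = c * c)
    (μ x : ℂ) (y : Param k c) : X₃ k c μ x y =
    c * (quotientForm k hk δ hδ).fn (fun j => (y.1.1 j : ℂ)) (c * (μ + y.1.2)) x := by
  have hc0 : c ≠ 0 := by
    rintro rfl
    exact hδ (by simpa using hc)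
  rw [NormalForm.fn, NormalForm.eval_num, NormalForm.eval_den, X₃, unfoldingPoly]
  simp only [quotientForm, hc, Complex.ofReal_zero, Complex.ofReal_one, zero_mul, sub_zero,
    mul_one, one_mul]
  have h : c * c + c * (μ + y.1.2) * x ^ k = c * (c + (μ + y.1.2) * x ^ k) := by ring
  rw [h, mul_div_assoc', mul_div_mul_left _ _ hc0]
  rfl

namespace IsAdmissible

variable {τ : AxisSymmetry} {k : ℕ} {c μ : ℂ}

lemma re_mul_self_ne_zero (h : IsAdmissible τ k c μ) : (c * c).re ≠ 0 := by
  intro h1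
  have h2 := h.ofReal_re_mul_self
  rw [h1, Complex.ofReal_zero] at h2
  exact mul_self_ne_zero.2 h.ne_zero h2.symm

lemma isUniversalWithSymmetry_X₁ (hk : 1 ≤ k) (h : IsAdmissible τ k c μ) :
    IsUniversalWithSymmetry τ (X₁ k c μ) :=
  (polynomialForm k hk).isUniversalWithSymmetry h (X₁_eq_fn hk c μ)

lemma isUniversalWithSymmetry_X₂ (hk : 1 ≤ k) (h : IsAdmissible τ k c μ) :
    IsUniversalWithSymmetry τ (X₂ k c μ) :=
  (productForm k hk).isUniversalWithSymmetry h (X₂_eq_fn hk c μ)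

lemma isUniversalWithSymmetry_X₃ (hk : 1 ≤ k) (h : IsAdmissible τ k c μ) :
    IsUniversalWithSymmetry τ (X₃ k c μ) :=
  (quotientForm k hk _ h.re_mul_self_ne_zero).isUniversalWithSymmetry h
    (X₃_eq_fn hk h.re_mul_self_ne_zero h.ofReal_re_mul_self μ)

end IsAdmissible

/-! ### Zeros of maximal multiplicity near the origin. -/

section Polynomial

open Polynomial

lemma pow_dvd_of_analyticOrderAt {p : ℂ[X]} {a : ℂ} {n : ℕ}
    (h : analyticOrderAt (fun x => p.eval x) a = n) : (X - C a) ^ n ∣ p := by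
  have hp : p ≠ 0 := by
    rintro rfl
    have h1 : analyticOrderAt (fun x => (0 : ℂ[X]).eval x) a = ⊤ :=
      analyticOrderAt_eq_top.2 (Eventually.of_forall fun _ => eval_zero)
    rw [h1] at h
    exact ENat.top_ne_natCast n h
  have han : ∀ q : ℂ[X], AnalyticAt ℂ (fun x => q.eval x) a := fun q =>
    AnalyticOnNhd.eval_polynomial q a (Set.mem_univ a)
  obtain ⟨Q, hQ, hdvd⟩ := exists_eq_pow_rootMultiplicity_mul_and_not_dvd p hp a
  have h1 : analyticOrderAt (fun x => p.eval x) a = (p.rootMultiplicity a : ℕ) := by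
    refine (han p).analyticOrderAt_eq_natCast.2 ⟨fun x => Q.eval x, han Q, ?_,
      Eventually.of_forall fun x => ?_⟩
    · rwa [Ne, ← IsRoot.def, ← dvd_iff_isRoot]
    · conv_lhs => rw [hQ]
      simp
  rw [h] at h1
  rw [show n = p.rootMultiplicity a by exact_mod_cast h1]
  exact pow_rootMultiplicity_dvd p a

/-- A root of multiplicity `k + 1` of the polynomial normal form, if it is close to the origin,
is the origin. -/
lemma eq_zero_of_pow_dvd {k : ℕ} {y : Fin k → ℂ} {a b : ℂ}
    (h : (X - C a) ^ (k + 1) ∣ X ^ (k + 1) + ∑ j : Fin k, C (y j) * X ^ (j : ℕ) -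
      C b * X ^ (2 * k + 1))
    (hb : b * ((2 * k + 1).choose k * a ^ (k + 1)) = ((k + 1 : ℕ) : ℂ) * a → a = 0) :
    a = 0 ∧ y = 0 := by
  have ha : a = 0 := by
    refine hb ?_
    -- After translation to a, the coefficient of degree k must vanish. The terms y_j x^j do not
    -- reach that degree, which leaves (k+1) a = b C(2k+1, k) a^(k+1).
    have h1 : X ^ (k + 1) ∣ taylor a (X ^ (k + 1) + ∑ j : Fin k, C (y j) * X ^ (j : ℕ) -
        C b * X ^ (2 * k + 1)) := by
      obtain ⟨Q, hQ⟩ := h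
      refine ⟨taylor a Q, ?_⟩
      rw [hQ, taylor_mul, taylor_pow, map_sub, taylor_X, taylor_C, add_sub_cancel_right]
    have h2 := X_pow_dvd_iff.1 h1 k (Nat.lt_succ_self k)
    have h3 : ∀ (n : ℕ) (c : ℂ), (taylor a (C c * X ^ n)).coeff k =
        c * n.choose k * a ^ (n - k) := by
      intro n c
      rw [taylor_coeff, C_mul_X_pow_eq_monomial, hasseDeriv_monomial, eval_monomial]
      ring
    have h4 : (X ^ (k + 1) : ℂ[X]) = C 1 * X ^ (k + 1) := by simp
    rw [h4, map_sub, map_add, map_sum, coeff_sub, coeff_add, finsetSum_coeff, h3, h3,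
      Finset.sum_eq_zero fun j _ => by rw [h3, Nat.choose_eq_zero_of_lt j.2]; simp,
      Nat.choose_succ_self_right, Nat.add_sub_cancel_left, show 2 * k + 1 - k = k + 1 by omega] at h2
    linear_combination -h2
  refine ⟨ha, funext fun i => ?_⟩
  subst ha
  rw [C_0, sub_zero] at h
  have h1 := X_pow_dvd_iff.1 h i (i.2.trans (Nat.lt_succ_self k))
  rw [coeff_sub, coeff_add, finsetSum_coeff, coeff_X_pow, if_neg (by omega), zero_add,
    coeff_C_mul_X_pow, if_neg (by omega), sub_zero, Finset.sum_eq_single i] at h1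
  · simpa using h1
  · intro j _ hj
    rw [coeff_C_mul_X_pow, if_neg fun e => hj (Fin.ext e.symm)]
  · simp

end Polynomial

namespace NormalForm

variable (q : NormalForm)

/-- If α = 0, `h₁` rules out the nonzero solutions a. If β = 0, `h₂` makes the second factor prime
to X - a, so it can be discarded. -/
lemma eq_zero_of_pow_dvd_num (hq : q.α = 0 ∨ q.β = 0) {y : Fin q.k → ℂ} {m a : ℂ}
    (h : (Polynomial.X - Polynomial.C a) ^ (q.k + 1) ∣ q.num y m)
    (h₁ : q.β * m * ((2 * q.k + 1).choose q.k * a ^ q.k) ≠ ((q.k + 1 : ℕ) : ℂ))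
    (h₂ : 1 - q.α * m * a ^ q.k ≠ 0) : a = 0 ∧ y = 0 := by
  rcases hq with hα | hβ
  · refine RealAxisDeformation.eq_zero_of_pow_dvd (b := q.β * m) (by simpa [num, hα] using h) ?_
    intro h3
    by_contra ha
    refine h₁ (mul_right_cancel₀ ha ?_)
    rw [← h3]
    ring
  · refine RealAxisDeformation.eq_zero_of_pow_dvd (b := 0) ?_ ?_
    · have hcop : IsCoprime ((Polynomial.X - Polynomial.C a) ^ (q.k + 1))
          (1 - Polynomial.C ((q.α : ℂ) * m) * Polynomial.X ^ q.k) := by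
        refine IsCoprime.pow_left ((Polynomial.irreducible_X_sub_C a).coprime_iff_not_dvd.2 ?_)
        rw [Polynomial.dvd_iff_isRoot, Polynomial.IsRoot.def]
        simpa using h₂
      refine hcop.dvd_of_dvd_mul_right ?_
      simpa [num, hβ] using h
    · intro h3
      rw [zero_mul] at h3
      exact (mul_eq_zero.1 h3.symm).resolve_left (by exact_mod_cast Nat.succ_ne_zero q.k)

/-- Quasi-homogeneity with weight 1 for x and -k for m; it is used to undo the blow-up. -/
lemma fn_zero_mul (m t z : ℂ) : q.fn 0 m (t * z) = t ^ (q.k + 1) * q.fn 0 (m * t ^ q.k) z := by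
  rw [fn, fn, ← mul_div_assoc]
  simp only [eval_num, eval_den]
  congr 1
  · simp; ring
  · ring

end NormalForm

/-- The derivative at the origin of an analytic family depends continuously on the parameter. -/
lemma IsAnalyticFamily.eventually_deriv_ne_zero {E : Type*} [NormedAddCommGroup E]
    [NormedSpace ℝ E] {φ : ℂ → E → ℂ} (hφ : IsAnalyticFamily φ)
    (h : deriv (fun x => φ x 0) 0 ≠ 0) : ∀ᶠ l in 𝓝 0, deriv (fun x => φ x l) 0 ≠ 0 := by
  obtain ⟨R, hR, hF⟩ := hφ.exists_wiener
  obtain ⟨s, hs0, hsR⟩ := exists_between hR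
  lift s to {r : ℝ // 0 < r} using hs0
  obtain ⟨Φ, hΦa, hΦ⟩ := hF s hsR
  have key : ∀ᶠ l in 𝓝 0, deriv (fun x => φ x l) 0 = coeffL 1 (Φ l) := by
    filter_upwards [hΦ] with l hl
    have e : (fun x => φ x l) =ᶠ[𝓝 0] fun x => eval x (Φ l) := by
      filter_upwards [Metric.ball_mem_nhds (0 : ℂ) s.2] with z hz
      exact (hl z (by simpa using hz)).symm
    rw [e.deriv_eq, (hasFPowerSeriesAt_eval (Φ l)).deriv]
    simp [coeffL]
  rw [key.self_of_nhds] at h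
  filter_upwards [key, (((coeffL 1).continuous.tendsto (Φ 0)).comp
    hΦa.continuousAt.tendsto).eventually_ne h] with l h1 h2
  rw [h1]
  exact h2

/-! ### Normal form of the initial field by blow-up. -/

namespace NormalForm

variable (q : NormalForm)

/-- A blow-up of a vector field is a deformation of the homogeneous vector field. -/
lemma isAnalyticFamily_blowUp {G : ℂ → ℂ} (hG : AnalyticAt ℂ G 0) (n : ℕ) (a θ : ℂ) :
    IsAnalyticFamily fun (x : ℂ) (ρ : ℝ) => a * (x ^ n * G (θ * ρ * x)) := by
  have h1 : AnalyticAt ℝ (fun p : ℂ × ℝ => θ * (p.2 : ℂ) * p.1) 0 :=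
    (analyticAt_const.mul ((Complex.ofRealCLM ∘L ContinuousLinearMap.snd ℝ ℂ ℝ).analyticAt 0)).mul
      analyticAt_fst
  refine IsAnalyticFamily.const_mul ⟨?_, ?_⟩ a
  · exact (analyticAt_fst.pow n).mul
      ((hG.restrictScalars (𝕜 := ℝ)).fun_comp_of_eq h1 (by simp))
  · have h2 : Tendsto (fun p : ℂ × ℝ => θ * (p.2 : ℂ) * p.1) (𝓝 0) (𝓝 0) := by
      simpa using h1.continuousAt.tendsto
    filter_upwards [h2.eventually hG.eventually_analyticAt] with p hp
    have h3 : DifferentiableAt ℂ (fun x : ℂ => θ * (p.2 : ℂ) * x) p.1 := by fun_prop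
    exact (differentiableAt_id.pow n).mul (hp.differentiableAt.comp p.1 h3)

/-- A vector field whose multiplicity is that of the normal form is conjugate to it. -/
theorem exists_conjugacy_initial (hq : q.α = 0 ∨ q.β = 0) {G : ℂ → ℂ} (hG : AnalyticAt ℂ G 0)
    (hreal : ∀ᶠ x in 𝓝 0, G (conj x) = conj (G x)) {θ : ℝ}
    (hθ : (θ : ℂ) ^ q.k * G 0 * q.δ = 1) :
    ∃ (M : ℝ) (χ : ℂ → ℂ), AnalyticAt ℂ χ 0 ∧ χ 0 = 0 ∧ deriv χ 0 ≠ 0 ∧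
      (∀ᶠ x in 𝓝 0, χ (conj x) = conj (χ x)) ∧
      ∀ᶠ x in 𝓝 0, q.fn 0 M (χ x) = deriv χ x * (x ^ (q.k + 1) * G x) := by
  have hk0 : q.k ≠ 0 := Nat.one_le_iff_ne_zero.1 q.one_le_k
  have hθ0 : (θ : ℂ) ≠ 0 := by
    intro h
    rw [h, zero_pow hk0] at hθ
    simp at hθ
  have hV := isAnalyticFamily_blowUp hG (q.k + 1) ((θ : ℂ) ^ q.k) θ
  have hlim : Tendsto (fun p : ℂ × ℝ => (θ : ℂ) * p.2 * p.1) (𝓝 0) (𝓝 0) := by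
    have h1 : Continuous fun p : ℂ × ℝ => (θ : ℂ) * p.2 * p.1 := by fun_prop
    simpa using h1.tendsto 0
  -- By the choice of θ the blow-up at ρ = 0 is x^(k+1)/δ, the normal form with y = 0 and m = 0.
  obtain ⟨y, m, φ, hy, hm, hy0, hm0, hφc, he⟩ := q.exists_equivalence (m₀ := 0) hV (by
      filter_upwards [hlim.eventually hreal] with p hp
      simp only [map_mul, map_pow, Complex.conj_ofReal] at hp ⊢
      rw [hp]) (by
      refine Eventually.of_forall fun x => ?_
      rw [fn, eval_num, eval_den]
      have hδ : (q.δ : ℂ) ≠ 0 := by exact_mod_cast q.δ_ne_zero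
      simp only [Complex.ofReal_zero, mul_zero, zero_mul, add_zero, sub_zero, mul_one,
        Pi.zero_apply, Finset.sum_const_zero]
      rw [eq_div_iff hδ]
      linear_combination x ^ (q.k + 1) * hθ)
  have hmt : Tendsto (fun ρ => (m ρ : ℂ)) (𝓝 0) (𝓝 0) := by
    have h1 := (Complex.continuous_ofReal.tendsto (m 0)).comp hm.continuousAt.tendsto
    rwa [hm0, Complex.ofReal_zero] at h1
  have hφt : Tendsto (fun p : ℂ × ℝ => φ p.1 p.2) (𝓝 0) (𝓝 0) := by
    have h1 := he.analytic.analyticAt.continuousAt.tendsto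
    rwa [Prod.fst_zero, Prod.snd_zero, he.map_zero] at h1
  have hat : Tendsto (fun ρ => φ 0 ρ) (𝓝 0) (𝓝 0) := by
    have h1 : Continuous fun ρ : ℝ => ((0 : ℂ), ρ) := by fun_prop
    exact hφt.comp (h1.tendsto' 0 0 rfl)
  have hpow : Tendsto (fun ρ => φ 0 ρ ^ q.k) (𝓝 0) (𝓝 0) := by
    simpa [hk0] using hat.pow q.k
  have e₁ : ∀ᶠ ρ in 𝓝 0,
      q.β * (m ρ : ℂ) * ((2 * q.k + 1).choose q.k * φ 0 ρ ^ q.k) ≠ ((q.k + 1 : ℕ) : ℂ) := by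
    refine ((hmt.const_mul (q.β : ℂ)).mul (hpow.const_mul ((2 * q.k + 1).choose q.k : ℂ))).eventually_ne ?_
    rw [mul_zero, mul_zero, mul_zero]
    exact_mod_cast (Nat.succ_ne_zero q.k).symm
  have e₂ : ∀ᶠ ρ in 𝓝 0, 1 - q.α * (m ρ : ℂ) * φ 0 ρ ^ q.k ≠ 0 := by
    refine (tendsto_const_nhds.sub ((hmt.const_mul (q.α : ℂ)).mul hpow)).eventually_ne ?_
    simp
  have e₃ : ∀ᶠ ρ in 𝓝 0, ∀ᶠ x in 𝓝 0, (q.den (m ρ : ℂ)).eval (φ x ρ) ≠ 0 :=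
    eventually_eventually_of_prod (P := fun p => (q.den (m p.2 : ℂ)).eval (φ p.1 p.2) ≠ 0)
      (q.eval_den_ne_zero (hmt.comp (continuousAt_snd (p := (0 : ℂ × ℝ)))) hφt)
  obtain ⟨ρ, hρ0, hpull, hconj, hhol, hder, h₁, h₂, h₃⟩ : ∃ ρ : ℝ, ρ ≠ 0 ∧
      (∀ᶠ x in 𝓝 0, q.fn (fun j => (y ρ j : ℂ)) (m ρ) (φ x ρ) = deriv (fun x => φ x ρ) x *
        ((θ : ℂ) ^ q.k * (x ^ (q.k + 1) * G (θ * ρ * x)))) ∧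
      (∀ᶠ x in 𝓝 0, φ (conj x) ρ = conj (φ x ρ)) ∧
      (∀ᶠ x in 𝓝 0, DifferentiableAt ℂ (fun x => φ x ρ) x) ∧
      deriv (fun x => φ x ρ) 0 ≠ 0 ∧
      q.β * (m ρ : ℂ) * ((2 * q.k + 1).choose q.k * φ 0 ρ ^ q.k) ≠ ((q.k + 1 : ℕ) : ℂ) ∧
      1 - q.α * (m ρ : ℂ) * φ 0 ρ ^ q.k ≠ 0 ∧
      ∀ᶠ x in 𝓝 0, (q.den (m ρ : ℂ)).eval (φ x ρ) ≠ 0 := by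
    have hall := (eventually_eventually_of_prod he.pullback).and
      ((eventually_eventually_of_prod hφc).and ((eventually_eventually_of_prod
        he.analytic.holomorphic).and ((he.analytic.eventually_deriv_ne_zero he.invertible).and
          (e₁.and (e₂.and e₃)))))
    exact ((eventually_mem_nhdsWithin (a := (0 : ℝ)) (s := {0}ᶜ)).and
      (hall.filter_mono nhdsWithin_le_nhds)).exists
  have hρ0' : (ρ : ℂ) ≠ 0 := by exact_mod_cast hρ0
  have hφa : AnalyticAt ℂ (fun x => φ x ρ) 0 := Complex.analyticAt_iff_eventually_differentiableAt.2 hhol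
  have hlin : ∀ c : ℂ, AnalyticAt ℂ (fun x => c * x) 0 := fun c => analyticAt_const.mul analyticAt_id
  have hlin0 : ∀ c : ℂ, Tendsto (fun x => c * x) (𝓝 0) (𝓝 0) := fun c => by
    simpa using (hlin c).continuousAt.tendsto
  -- The field vanishes at 0 to order k+1 and φ(·, ρ) is locally biholomorphic, so the numerator has
  -- a root of this multiplicity at φ(0, ρ).
  have hroot : (Polynomial.X - Polynomial.C (φ 0 ρ)) ^ (q.k + 1) ∣
      q.num (fun j => (y ρ j : ℂ)) (m ρ) := by
    refine pow_dvd_of_analyticOrderAt ?_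
    have hpoly : ∀ (p : Polynomial ℂ) (z : ℂ), AnalyticAt ℂ (fun x => p.eval x) z := fun p z =>
      AnalyticOnNhd.eval_polynomial p z (Set.mem_univ z)
    rw [← analyticOrderAt_comp_of_deriv_ne_zero hφa hder,
      ((hpoly _ _).comp hφa).analyticOrderAt_eq_natCast]
    refine ⟨fun x => deriv (fun x => φ x ρ) x * ((θ : ℂ) ^ q.k * G (θ * ρ * x)) *
      (q.den (m ρ : ℂ)).eval (φ x ρ), ?_, ?_, ?_⟩
    · refine (hφa.deriv.mul (analyticAt_const.mul (hG.fun_comp_of_eq (hlin _) (by simp)))).mul ?_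
      exact (hpoly _ _).fun_comp hφa
    · beta_reduce
      rw [mul_zero]
      exact mul_ne_zero (mul_ne_zero hder (left_ne_zero_of_mul_eq_one hθ)) h₃.self_of_nhds
    · filter_upwards [hpull, h₃] with x hx hD
      rw [fn, div_eq_iff hD] at hx
      rw [Function.comp_apply, hx, sub_zero, smul_eq_mul]
      ring
  obtain ⟨ha, hyρ⟩ := q.eq_zero_of_pow_dvd_num hq hroot h₁ h₂
  rw [hyρ] at hpull
  -- The source is rescaled by θρ and the target by ρ. The resulting factors ρ^k cancel, and m is
  -- divided by ρ^k according to its weight.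
  refine ⟨m ρ / ρ ^ q.k, fun x => ρ * φ ((θ * ρ : ℂ)⁻¹ * x) ρ, ?_, ?_, ?_, ?_, ?_⟩
  · exact analyticAt_const.mul (hφa.fun_comp_of_eq (hlin _) (by simp))
  · change (ρ : ℂ) * φ ((θ * ρ : ℂ)⁻¹ * 0) ρ = 0
    rw [mul_zero, ha, mul_zero]
  all_goals
    have hderiv : ∀ᶠ x in 𝓝 0, deriv (fun x => ρ * φ ((θ * ρ : ℂ)⁻¹ * x) ρ) x =
        (θ : ℂ)⁻¹ * deriv (fun x => φ x ρ) ((θ * ρ : ℂ)⁻¹ * x) := by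
      filter_upwards [(hlin0 (θ * ρ : ℂ)⁻¹).eventually hhol] with x hx
      have h4 : HasDerivAt (fun x : ℂ => (θ * ρ : ℂ)⁻¹ * x) ((θ * ρ : ℂ)⁻¹) x := by
        simpa using (hasDerivAt_id x).const_mul (θ * ρ : ℂ)⁻¹
      have h5 := ((hx.hasDerivAt.comp x h4).const_mul (ρ : ℂ)).deriv
      simp only [Function.comp_def] at h5
      rw [h5]
      field_simp
  · rw [hderiv.self_of_nhds, mul_zero]
    exact mul_ne_zero (inv_ne_zero hθ0) hder
  · filter_upwards [(hlin0 (θ * ρ : ℂ)⁻¹).eventually hconj] with x hx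
    simp only [map_mul, map_inv₀, Complex.conj_ofReal] at hx ⊢
    rw [hx]
  · filter_upwards [hderiv, (hlin0 (θ * ρ : ℂ)⁻¹).eventually hpull] with x hx hp
    have h4 : ((m ρ / ρ ^ q.k : ℝ) : ℂ) * ρ ^ q.k = m ρ := by
      push_cast
      field_simp
    have h5 : (θ * ρ : ℂ) * ((θ * ρ : ℂ)⁻¹ * x) = x := mul_inv_cancel_left₀ (mul_ne_zero hθ0 hρ0') x
    rw [fn_zero_mul, h4, hp, hx, h5]
    generalize (θ * ρ : ℂ)⁻¹ * x = w at h5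
    rw [← h5, mul_pow, mul_pow, pow_succ (θ : ℂ)]
    field_simp

end NormalForm

/-! ### Changes of coordinate independent of the parameter. -/

lemma tendsto_prodMap_fst {E : Type*} [NormedAddCommGroup E] {g : ℂ → ℂ}
    (hg : ContinuousAt g 0) (h0 : g 0 = 0) :
    Tendsto (fun p : ℂ × E => (g p.1, p.2)) (𝓝 0) (𝓝 0) := by
  have h1 : Tendsto g (𝓝 0) (𝓝 0) := by simpa [h0] using hg.tendsto
  rw [Prod.zero_eq_mk, nhds_prod_eq]
  exact (h1.comp tendsto_fst).prodMk tendsto_snd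

section Families

variable {E : Type*} [NormedAddCommGroup E] [NormedSpace ℝ E]

lemma IsAnalyticFamily.comp_fst {f : ℂ → E → ℂ} (hf : IsAnalyticFamily f) {g : ℂ → ℂ}
    (hg : AnalyticAt ℂ g 0) (h0 : g 0 = 0) : IsAnalyticFamily fun x l => f (g x) l := by
  constructor
  · have h1 : AnalyticAt ℝ (fun p : ℂ × E => (g p.1, p.2)) 0 :=
      ((hg.restrictScalars (𝕜 := ℝ)).fun_comp_of_eq analyticAt_fst rfl).prod analyticAt_snd
    exact hf.analyticAt.fun_comp_of_eq h1 (by simp [h0])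
  · filter_upwards [(tendsto_prodMap_fst hg.continuousAt h0).eventually hf.holomorphic,
      (continuousAt_fst (p := (0 : ℂ × E))).eventually hg.eventually_analyticAt] with p hp hgp
    exact DifferentiableAt.comp p.1 hp hgp.differentiableAt

lemma IsAnalyticFamily.mul_fst {f : ℂ → E → ℂ} (hf : IsAnalyticFamily f) {g : ℂ → ℂ}
    (hg : AnalyticAt ℂ g 0) : IsAnalyticFamily fun x l => g x * f x l := by
  constructor
  · exact ((hg.restrictScalars (𝕜 := ℝ)).fun_comp_of_eq analyticAt_fst rfl).mul hf.analyticAt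
  · filter_upwards [hf.holomorphic,
      (continuousAt_fst (p := (0 : ℂ × E))).eventually hg.eventually_analyticAt] with p hp hgp
    exact hgp.differentiableAt.mul hp

end Families

lemma tendsto_conj_zero : Tendsto (fun x : ℂ => conj x) (𝓝 0) (𝓝 0) := by
  simpa using (Complex.continuous_conj.tendsto 0)

lemma deriv_conj_of_eventually {χ : ℂ → ℂ} (h : ∀ᶠ x in 𝓝 0, χ (conj x) = conj (χ x)) :
    ∀ᶠ x in 𝓝 0, deriv χ (conj x) = conj (deriv χ x) := by
  filter_upwards [h.eventually_nhds] with x hx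
  have e : χ =ᶠ[𝓝 (conj x)] fun z => conj (χ (conj z)) := by
    have h1 : Tendsto (fun z : ℂ => conj z) (𝓝 (conj x)) (𝓝 x) := by
      simpa using Complex.continuous_conj.tendsto (conj x)
    filter_upwards [h1.eventually hx] with z hz
    rw [← hz, Complex.conj_conj]
  rw [e.deriv_eq]
  have h2 := congrFun (deriv_conj_conj (f := χ)) (conj x)
  simpa [Function.comp_def] using h2

/-- A local inverse of a conjugation which is real on the real axis. -/
lemma exists_localInverse {χ : ℂ → ℂ} (hχ : AnalyticAt ℂ χ 0) (h0 : χ 0 = 0)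
    (h' : deriv χ 0 ≠ 0) (hconj : ∀ᶠ x in 𝓝 0, χ (conj x) = conj (χ x)) :
    ∃ η : ℂ → ℂ, AnalyticAt ℂ η 0 ∧ η 0 = 0 ∧ (∀ᶠ x in 𝓝 0, η (χ x) = x) ∧
      ∀ᶠ x in 𝓝 0, η (conj x) = conj (η x) := by
  have hη := hχ.analyticAt_localInverse h'
  have hl := hχ.hasStrictDerivAt.eventually_left_inverse h'
  have hr := hχ.hasStrictDerivAt.eventually_right_inverse h'
  set η := hχ.hasStrictDerivAt.localInverse _ _ _ h'
  rw [h0] at hη hr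
  have hη0 : η 0 = 0 := by
    have := hl.self_of_nhds
    rwa [h0] at this
  have hηt : Tendsto η (𝓝 0) (𝓝 0) := by simpa [hη0] using hη.continuousAt.tendsto
  refine ⟨η, hη, hη0, hl, ?_⟩
  filter_upwards [hr, (tendsto_conj_zero.comp hηt).eventually hl, hηt.eventually hconj]
    with x h1 h2 h3
  rw [Function.comp_apply, h3, h1] at h2
  exact h2

/-! ### Conjugacy of families to the normal form. -/

namespace NormalForm

variable (q : NormalForm) {E : Type*} [NormedAddCommGroup E] [NormedSpace ℝ E]

/-- A real family whose initial vector field has the multiplicity of the normal form is conjugate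
to a family which is induced from the normal form. -/
theorem exists_conjugacy (hq : q.α = 0 ∨ q.β = 0) {Y : ℂ → E → ℂ} (hY : IsAnalyticFamily Y)
    (hreal : ∀ᶠ p : ℂ × E in 𝓝 0, Y (conj p.1) p.2 = conj (Y p.1 p.2)) {G : ℂ → ℂ}
    (hG : AnalyticAt ℂ G 0) (hGreal : ∀ᶠ x in 𝓝 0, G (conj x) = conj (G x))
    (h0 : ∀ᶠ x in 𝓝 0, Y x 0 = x ^ (q.k + 1) * G x) {θ : ℝ}
    (hθ : (θ : ℂ) ^ q.k * G 0 * q.δ = 1) :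
    ∃ (M : ℝ) (y : E → Fin q.k → ℝ) (m : E → ℝ) (φ : ℂ → E → ℂ), AnalyticAt ℝ y 0 ∧
      AnalyticAt ℝ m 0 ∧ y 0 = 0 ∧ m 0 = M ∧ CommutesWithConj φ ∧
      IsConjugacy φ Y fun x l => q.fn (fun j => (y l j : ℂ)) (m l) x := by
  obtain ⟨M, χ, hχ, hχ0, hχ', hχc, hχM⟩ := q.exists_conjugacy_initial hq hG hGreal hθ
  obtain ⟨η, hη, hη0, hηχ, hηc⟩ := exists_localInverse hχ hχ0 hχ' hχc
  have hηt : Tendsto η (𝓝 0) (𝓝 0) := by simpa [hη0] using hη.continuousAt.tendsto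
  have hχt : Tendsto χ (𝓝 0) (𝓝 0) := by simpa [hχ0] using hχ.continuousAt.tendsto
  have hfst : ∀ {P : ℂ → Prop}, (∀ᶠ x in 𝓝 0, P x) → ∀ᶠ p : ℂ × E in 𝓝 0, P p.1 := fun h =>
    (continuousAt_fst (p := (0 : ℂ × E))).eventually h
  have hχη : ∀ᶠ x in 𝓝 0, χ (η x) = x := by
    have h1 : map χ (𝓝 0) = 𝓝 0 := by
      have := hχ.hasStrictDerivAt.map_nhds_eq hχ'
      rwa [hχ0] at this
    rw [← h1, eventually_map]
    exact hηχ.mono fun x hx => by rw [hx]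
  -- The push-forward of Y by χ starts exactly at the normal form with y = 0 and m = M, so the
  -- existence theorem for deformations applies.
  obtain ⟨y, m, φ, hy, hm, hy0, hm0, hφ, he⟩ := q.exists_equivalence (m₀ := M)
    (Y := fun x l => deriv χ (η x) * Y (η x) l)
    ((hY.comp_fst hη hη0).mul_fst (hχ.deriv.fun_comp_of_eq hη hη0)) (by
      filter_upwards [(tendsto_prodMap_fst (E := E) hη.continuousAt hη0).eventually hreal, hfst hηc,
        hfst (hηt.eventually (deriv_conj_of_eventually hχc))] with p h1 h2 h3
      rw [h2, h1, h3, map_mul]) (by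
      filter_upwards [hηt.eventually h0, hηt.eventually hχM, hχη] with x h1 h2 h3
      rw [h1, ← h2, h3])
  refine ⟨M, y, m, fun x l => φ (χ x) l, hy, hm, hy0, hm0, ?_,
    ⟨he.analytic.comp_fst hχ hχ0, ?_, ?_, ?_⟩⟩
  · filter_upwards [hfst hχc, (tendsto_prodMap_fst (E := E) hχ.continuousAt hχ0).eventually hφ]
      with p h1 h2
    rw [h1, h2]
  · rw [hχ0, he.map_zero]
  · have h1 : (fun x => φ (χ x) 0) =ᶠ[𝓝 0] χ := hχt.eventually he.eq_id
    rw [h1.deriv_eq]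
    exact hχ'
  · have hlift := tendsto_prodMap_fst (E := E) hχ.continuousAt hχ0
    filter_upwards [hlift.eventually he.pullback, hlift.eventually he.analytic.holomorphic,
      hfst hηχ, hfst hχ.eventually_analyticAt] with p h1 h2 h3 h4
    rw [h1, h3]
    have h5 := (h2.hasDerivAt.comp p.1 h4.differentiableAt.hasDerivAt).deriv
    simp only [Function.comp_def] at h5
    rw [h5, mul_assoc]

end NormalForm

/-- With ε the sign of g, take θ = ε |g|^(-1/k). For even k the sign is corrected by ε^(k+1), for
odd k by θ^k. -/
lemma exists_sign_root {k : ℕ} (hk : 1 ≤ k) {g : ℝ} (hg : g ≠ 0) :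
    ∃ ε θ : ℝ, (ε = 1 ∨ ε = -1) ∧ θ ^ k * (ε ^ (k + 1) * g) = 1 := by
  have hk0 : k ≠ 0 := Nat.one_le_iff_ne_zero.1 hk
  have ht : ((|g|⁻¹ : ℝ) ^ (k : ℝ)⁻¹) ^ k = |g|⁻¹ := Real.rpow_inv_natCast_pow (by positivity) hk0
  have key : ∀ ε : ℝ, (ε = 1 ∨ ε = -1) → ε * g = |g| →
      (ε * (|g|⁻¹ : ℝ) ^ (k : ℝ)⁻¹) ^ k * (ε ^ (k + 1) * g) = 1 := by
    intro ε hε hg'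
    have h1 : ε ^ k * ε ^ k = 1 := by
      rw [← mul_pow]
      rcases hε with rfl | rfl <;> simp
    rw [mul_pow, ht]
    calc ε ^ k * |g|⁻¹ * (ε ^ (k + 1) * g) = (ε ^ k * ε ^ k) * |g|⁻¹ * (ε * g) := by ring
      _ = 1 := by rw [h1, hg', one_mul, inv_mul_cancel₀ (abs_ne_zero.2 hg)]
  rcases hg.lt_or_gt with h | h
  · exact ⟨-1, _, Or.inr rfl, key (-1) (Or.inr rfl) (by rw [abs_of_neg h]; ring)⟩
  · exact ⟨1, _, Or.inl rfl, key 1 (Or.inl rfl) (by rw [abs_of_pos h]; ring)⟩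

/-- The quotient of a real function by a power of the coordinate is real. -/
lemma conj_of_pow_mul {n : ℕ} {G : ℂ → ℂ} (hG : ContinuousAt G 0)
    (h : ∀ᶠ x in 𝓝 0, conj x ^ n * G (conj x) = conj (x ^ n * G x)) :
    ∀ᶠ x in 𝓝 0, G (conj x) = conj (G x) := by
  have h1 : ContinuousAt (fun x => G (conj x)) 0 :=
    ContinuousAt.comp (f := fun x : ℂ => conj x) (by simpa using hG)
      Complex.continuous_conj.continuousAt
  have h2 : ContinuousAt (fun x => conj (G x)) 0 := Complex.continuous_conj.continuousAt.comp hG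
  -- The power can be cancelled away from 0; continuity supplies the value at 0.
  refine (ContinuousAt.eventuallyEq_nhds_iff_eventuallyEq_nhdsNE h1 h2).1 ?_
  filter_upwards [h.filter_mono nhdsWithin_le_nhds, eventually_mem_nhdsWithin] with x hx hx0
  rw [map_mul, map_pow] at hx
  exact mul_left_cancel₀ (pow_ne_zero _ (by simpa using hx0)) hx

namespace NormalForm

variable (q : NormalForm)

/-- A family with the symmetry whose initial vector field has the multiplicity of the normal form
is conjugate to a family which is induced from it. -/
theorem hasNormalForm (hq : q.α = 0 ∨ q.β = 0) {τ : AxisSymmetry}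
    {N : (c μ : ℂ) → ℂ → Param q.k c → ℂ} (hN : ∀ c μ, IsAdmissible τ q.k c μ → ∀ x y,
      N c μ x y = c * q.fn (fun j => (y.1.1 j : ℂ)) (c * (μ + y.1.2)) x)
    {n : ℕ} {X : ℂ → (Fin n → ℝ) → ℂ} (hX : IsAnalyticFamily X) (hsym : HasSymmetry τ X)
    (hord : analyticOrderAt (fun x : ℂ => X x 0) 0 = ((q.k + 1 : ℕ) : ℕ∞)) :
    HasNormalForm τ q.k N X := by
  have hX₀ : AnalyticAt ℂ (fun x => X x 0) 0 :=
    Complex.analyticAt_iff_eventually_differentiableAt.2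
      (eventually_eventually_of_prod hX.holomorphic).self_of_nhds
  obtain ⟨G, hG, hG0, hXG⟩ := hX₀.analyticOrderAt_eq_natCast.1 hord
  simp only [sub_zero, smul_eq_mul] at hXG
  -- The choice ε = 1 is provisional: it only serves to show that G(0) divided by the factor is a
  -- real number g, whose sign then determines the final `c`.
  have hτ : IsAdmissible τ q.k τ.factor 0 := ⟨⟨1, Or.inl rfl, by simp⟩, by simp⟩
  have hGreal : ∀ {c μ : ℂ}, IsAdmissible τ q.k c μ →
      ∀ᶠ x in 𝓝 0, c⁻¹ * G (conj x) = conj (c⁻¹ * G x) := by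
    intro c μ h
    refine conj_of_pow_mul (n := q.k + 1) (G := fun x => c⁻¹ * G x) (continuousAt_const.mul hG.continuousAt) ?_
    filter_upwards [hXG, tendsto_conj_zero.eventually hXG,
      (eventually_eventually_of_prod hsym).self_of_nhds] with x h1 h2 h3
    have h4 := h.conj_inv_mul (z := X (conj x) 0) h3
    rw [h1, h2] at h4
    rw [mul_left_comm, h4, mul_left_comm]
  obtain ⟨g, hg⟩ : ∃ g : ℝ, (g : ℂ) = τ.factor⁻¹ * G 0 := by
    have h1 := (hGreal hτ).self_of_nhds
    rw [map_zero] at h1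
    exact Complex.conj_eq_iff_real.1 h1.symm |>.imp fun _ h => h.symm
  have hg0 : g ≠ 0 := by
    rintro rfl
    exact mul_ne_zero (inv_ne_zero hτ.ne_zero) hG0 (by simpa using hg.symm)
  obtain ⟨ε, θ, hε, hθ⟩ := exists_sign_root q.one_le_k (mul_ne_zero hg0 q.δ_ne_zero)
  have hεC : (ε : ℂ) = 1 ∨ (ε : ℂ) = -1 := by
    rcases hε with rfl | rfl <;> simp
  set c : ℂ := τ.factor * (ε : ℂ) ^ (q.k + 1) with hcdef
  have hadm : ∀ μ : ℂ, (c * μ).im = 0 → IsAdmissible τ q.k c μ := fun μ hμ =>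
    ⟨⟨ε, hεC, rfl⟩, hμ⟩
  have h₀ : IsAdmissible τ q.k c 0 := hadm 0 (by simp)
  have hc := h₀.ne_zero
  have hε2 : ((ε : ℂ) ^ (q.k + 1))⁻¹ = (ε : ℂ) ^ (q.k + 1) := by
    refine inv_eq_of_mul_eq_one_left ?_
    rw [← mul_pow]
    rcases hεC with h | h <;> simp [h]
  obtain ⟨M, y, m, φ, hy, hm, hy0, hm0, hφ, he⟩ := q.exists_conjugacy hq (hX.const_mul c⁻¹)
    (hsym.mono fun p hp => h₀.conj_inv_mul hp) (G := fun x => c⁻¹ * G x)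
    (analyticAt_const.mul hG) (hGreal h₀)
    (hXG.mono fun x hx => by rw [hx, mul_left_comm]) (θ := θ) (by
      have h1 : c⁻¹ * G 0 = (ε : ℂ) ^ (q.k + 1) * g := by
        rw [hcdef, mul_inv, hε2, hg]
        ring
      have h2 := congrArg (fun r : ℝ => (r : ℂ)) hθ
      push_cast at h2
      rw [h1]
      linear_combination h2)
  have hμ : c * (c⁻¹ * (M : ℂ)) = M := mul_inv_cancel_left₀ hc _
  have h := hadm (c⁻¹ * M) (by rw [hμ, Complex.ofReal_im])
  refine ⟨c, c⁻¹ * M, h, _, φ, isParameterMap_paramOfReal c hy hm hy0, ?_, hφ⟩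
  rw [q.induced_paramOfReal h (hN c _ h) (by rw [hm0, hμ])]
  have h1 := he.const_mul c
  simp only [mul_inv_cancel_left₀ hc] at h1
  exact h1

end NormalForm

section

variable {τ : AxisSymmetry} {k n : ℕ} {X : ℂ → (Fin n → ℝ) → ℂ}

lemma hasNormalForm_X₁ (hk : 1 ≤ k) (hX : IsAnalyticFamily X) (hsym : HasSymmetry τ X)
    (hord : analyticOrderAt (fun x : ℂ => X x 0) 0 = ((k + 1 : ℕ) : ℕ∞)) :
    HasNormalForm τ k (X₁ k) X :=
  (polynomialForm k hk).hasNormalForm (Or.inl rfl) (fun c μ _ => X₁_eq_fn hk c μ) hX hsym hord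

lemma hasNormalForm_X₂ (hk : 1 ≤ k) (hX : IsAnalyticFamily X) (hsym : HasSymmetry τ X)
    (hord : analyticOrderAt (fun x : ℂ => X x 0) 0 = ((k + 1 : ℕ) : ℕ∞)) :
    HasNormalForm τ k (X₂ k) X :=
  (productForm k hk).hasNormalForm (Or.inr rfl) (fun c μ _ => X₂_eq_fn hk c μ) hX hsym hord

lemma hasNormalForm_X₃ (hk : 1 ≤ k) (hX : IsAnalyticFamily X) (hsym : HasSymmetry τ X)
    (hord : analyticOrderAt (fun x : ℂ => X x 0) 0 = ((k + 1 : ℕ) : ℕ∞)) :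
    HasNormalForm τ k (X₃ k) X := by
  -- The normal form must be fixed before `c` is known. This is possible because c² = `τ.sign` for
  -- every admissible `c`.
  have hδ : τ.sign.re ≠ 0 := by cases τ <;> simp [AxisSymmetry.sign]
  have hδ' : ((τ.sign.re : ℝ) : ℂ) = τ.sign := by cases τ <;> simp [AxisSymmetry.sign]
  exact (quotientForm k hk _ hδ).hasNormalForm (Or.inl rfl)
    (fun c μ h => X₃_eq_fn hk hδ (hδ'.trans h.mul_self.symm) μ) hX hsym hord

end

end RealAxisDeformation

theorem mainTheorem6 (τ : RealAxisDeformation.AxisSymmetry) (k : ℕ) (hk : 1 ≤ k) :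
    (∀ c μ : ℂ, RealAxisDeformation.IsAdmissible τ k c μ →
      RealAxisDeformation.IsUniversalWithSymmetry τ (RealAxisDeformation.X₁ k c μ) ∧
      RealAxisDeformation.IsUniversalWithSymmetry τ (RealAxisDeformation.X₂ k c μ) ∧
      RealAxisDeformation.IsUniversalWithSymmetry τ (RealAxisDeformation.X₃ k c μ)) ∧
    (∀ (m : ℕ) (X : ℂ → (Fin m → ℝ) → ℂ),
      RealAxisDeformation.IsAnalyticFamily X →
      RealAxisDeformation.HasSymmetry τ X →
      analyticOrderAt (fun x : ℂ => X x 0) 0 = ((k + 1 : ℕ) : ℕ∞) →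
      RealAxisDeformation.HasNormalForm τ k (RealAxisDeformation.X₁ k) X ∧
      RealAxisDeformation.HasNormalForm τ k (RealAxisDeformation.X₂ k) X ∧
      RealAxisDeformation.HasNormalForm τ k (RealAxisDeformation.X₃ k) X) := by
  refine ⟨fun c μ h => ⟨h.isUniversalWithSymmetry_X₁ hk, h.isUniversalWithSymmetry_X₂ hk,
    h.isUniversalWithSymmetry_X₃ hk⟩, fun n X hX hsym hord =>
    ⟨RealAxisDeformation.hasNormalForm_X₁ hk hX hsym hord,
      RealAxisDeformation.hasNormalForm_X₂ hk hX hsym hord,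
      RealAxisDeformation.hasNormalForm_X₃ hk hX hsym hord⟩⟩
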